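/- Let $N\ge 2$, let $\Omega\subset\mathbb R^N$ be open, bounded and connected with boundary of class $C^2$, let $\alpha\in(0,1)$ and $p>1$, and put $d(x)=\operatorname{dist}(x,\partial\Omega)$ and $$(-\Delta)^\alpha u(x)=-\frac12\int_{\mathbb R^N}\frac{u(x+y)+u(x-y)-2u(x)}{|y|^{N+2\alpha}}\,dy .$$ Let $\tau_0(\alpha)$ be the unique $\tau\in(-1,0)$ with $$\int_0^{\infty}\frac{\chi_{(0,1)}(t)\,|1-t|^{\tau}+(1+t)^{\tau}-2}{t^{1+2\alpha}}\,dt=0 .$$ Let $f:\Omega\to[0,\infty)$ be of class $C^\beta_{loc}(\Omega)$ for some $\beta>0$, and suppose that for some $\gamma\in(-1-2\alpha,0)$ $$0<\liminf_{x\in\Omega,\,x\to\partial\Omega}f(x)d(x)^{-\gamma}\le\limsup_{x\in\Omega,\,x\to\partial\Omega}f(x)d(x)^{-\gamma}<+\infty .$$ Consider the problem $$(P)\qquad (-\Delta)^\alpha u+|u|^{p-1}u=f\ \text{ in }\Omega,\qquad u=0\ \text{ in }\mathbb R^N\setminus\overline\Omega,\qquad \lim_{x\in\Omega,\,x\to\partial\Omega}u(x)=+\infty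 .$$ A solution is a function $u$ that is continuous in $\Omega$, satisfies $\int_{\mathbb R^N}\frac{|u(y)|}{1+|y|^{N+2\alpha}}\,dy<\infty$ and the boundary condition, and solves the other two conditions either classically (for every $x\in\Omega$ the integral defining $(-\Delta)^\alpha u(x)$ converges absolutely and the equation holds at $x$; $u=0$ a.e. in $\mathbb R^N\setminus\overline\Omega$) or in the viscosity sense ($u=0$ in $\mathbb R^N\setminus\overline\Omega$, and whenever $x_0\in V$, $V$ is open with $\overline V\subset\Omega$, $\varphi\in C^2(\overline V)$, $\varphi(x_0)=u(x_0)$ and $\varphi\le u$ in $V$ [respectively $\varphi\ge u$ in $V$], the function $\tilde u$ equal to $\varphi$ in $V$ and to $u$ outside $V$ satisfies $(-\Delta)^\alpha\tilde u(x_0)+|u(x_0)|^{p-1}u(x_0)\ge f(x_0)$ [respectively $\le f(x_0)$]). (i) (Weak source) If $p\ge 1-\frac{2\alpha}{\tau_0(\alpha)}$, $-2\alpha-\frac{2\alpha}{p-1}\le\gamma<-2\alpha$ and $\tau\in(-1,0)\setminus\{\gamma+2\alpha\}$, then $(P)$ has no solution $u$ with $$0<\liminf_{x\in\Omega,\,x\to\partial\Omega}u(x)d(x)^{-\tau}\le\limsup_{x\in\Omega,\,x\to\partial\Omega}u(x)d(x)^{-\tau}<+\infty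 .\qquad(\ast)$$ (ii) (Strong source) If $p>1+2\alpha$, $-1-2\alpha<\gamma<-2\alpha-\frac{2\alpha}{p-1}$ and $\tau\in(-1,0)\setminus\{\gamma/p\}$, then $(P)$ has no solution $u$ satisfying $(\ast)$. -/

import Mathlib

open MeasureTheory Filter Topology

noncomputable section

namespace LargeSol

/-- Points and vectors of `ℝ^N`, with the Euclidean norm. -/
abbrev E (N : ℕ) : Type := EuclideanSpace ℝ (Fin N)

variable {N : ℕ}

/-- `Ω` has boundary of class `C²`: near each boundary point, after choosing a unit vector `ν`,
the set `Ω` is the strict epigraph, in the direction `ν`, of a `C²` function of the component of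
`x` orthogonal to `ν`. -/
def IsC2Domain (Ω : Set (E N)) : Prop :=
  ∀ x₀ ∈ frontier Ω, ∃ (ν : E N) (φ : E N → ℝ) (r : ℝ),
    ‖ν‖ = 1 ∧ ContDiff ℝ 2 φ ∧ 0 < r ∧
      ∀ x ∈ Metric.ball x₀ r, x ∈ Ω ↔ φ (x - inner ℝ ν x • ν) < inner ℝ ν x

/-- The distance to the boundary of `Ω`. -/
def bdist (Ω : Set (E N)) (x : E N) : ℝ := Metric.infDist x (frontier Ω)

/-- The filter of the limits `x ∈ Ω`, `x → ∂Ω`. -/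
def toBoundary (Ω : Set (E N)) : Filter (E N) := comap (bdist Ω) (𝓝 0) ⊓ 𝓟 Ω

/-- `0 < liminf u d^(-τ)` and `limsup u d^(-τ) < +∞` as `x ∈ Ω`, `x → ∂Ω`; the limits are taken
in the extended reals. -/
def HasBoundaryRate (Ω : Set (E N)) (u : E N → ℝ) (τ : ℝ) : Prop :=
  0 < liminf (fun x => ((u x * bdist Ω x ^ (-τ) : ℝ) : EReal)) (toBoundary Ω) ∧
    limsup (fun x => ((u x * bdist Ω x ^ (-τ) : ℝ) : EReal)) (toBoundary Ω) < ⊤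

/-- `f` is of class `C^β_loc(Ω)` for some `β > 0` (lowering the exponent, `β ≤ 1`). -/
def IsLocallyHolder (Ω : Set (E N)) (f : E N → ℝ) : Prop :=
  ∃ β : NNReal, 0 < β ∧ β ≤ 1 ∧
    ∀ K ⊆ Ω, IsCompact K → ∃ C : NNReal, HolderOnWith C β f K

/-- The integrand `δ(u,x,y) / |y|^(N+2α)`, with `δ(u,x,y) = u(x+y) + u(x-y) - 2 u(x)`. -/
def fracIntegrand (α : ℝ) (u : E N → ℝ) (x y : E N) : ℝ :=
  (u (x + y) + u (x - y) - 2 * u x) / ‖y‖ ^ ((N : ℝ) + 2 * α)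

/-- The fractional Laplacian `(-Δ)^α u (x)`. -/
def fracLap (α : ℝ) (u : E N → ℝ) (x : E N) : ℝ :=
  -(1 / 2) * ∫ y, fracIntegrand α u x y

/-- `u ∈ L¹_ω(ℝ^N)` with the weight `ω(y) = 1 / (1 + |y|^(N+2α))`. -/
def InWeightedL1 (α : ℝ) (u : E N → ℝ) : Prop :=
  Integrable (fun y => u y / (1 + ‖y‖ ^ ((N : ℝ) + 2 * α)))

open Classical in
/-- The function equal to `φ` in `V` and to `u` outside `V`. -/
def glue (V : Set (E N)) (φ u : E N → ℝ) (x : E N) : ℝ := if x ∈ V then φ x else u x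

/-- Viscosity super-solutions of `(-Δ)^α u = h(x,u)` in `Ω`, `u = g` in the exterior.
The values of `u` on `∂Ω` play no role. -/
def IsViscositySuper (α : ℝ) (Ω : Set (E N)) (h : E N → ℝ → ℝ) (g u : E N → ℝ) : Prop :=
  ContinuousOn u Ω ∧ InWeightedL1 α u ∧ (∀ x ∈ (closure Ω)ᶜ, g x ≤ u x) ∧
    ∀ x₀ ∈ Ω, ∀ V : Set (E N), IsOpen V → x₀ ∈ V → closure V ⊆ Ω →
      ∀ φ : E N → ℝ, ContDiffOn ℝ 2 φ (closure V) → u x₀ = φ x₀ → (∀ x ∈ V, φ x ≤ u x) →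
        h x₀ (u x₀) ≤ fracLap α (glue V φ u) x₀

/-- Viscosity sub-solutions of `(-Δ)^α u = h(x,u)` in `Ω`, `u = g` in the exterior. -/
def IsViscositySub (α : ℝ) (Ω : Set (E N)) (h : E N → ℝ → ℝ) (g u : E N → ℝ) : Prop :=
  ContinuousOn u Ω ∧ InWeightedL1 α u ∧ (∀ x ∈ (closure Ω)ᶜ, u x ≤ g x) ∧
    ∀ x₀ ∈ Ω, ∀ V : Set (E N), IsOpen V → x₀ ∈ V → closure V ⊆ Ω →
      ∀ φ : E N → ℝ, ContDiffOn ℝ 2 φ (closure V) → u x₀ = φ x₀ → (∀ x ∈ V, u x ≤ φ x) →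
        fracLap α (glue V φ u) x₀ ≤ h x₀ (u x₀)

/-- Viscosity solutions. -/
def IsViscositySol (α : ℝ) (Ω : Set (E N)) (h : E N → ℝ → ℝ) (g u : E N → ℝ) : Prop :=
  IsViscositySuper α Ω h g u ∧ IsViscositySub α Ω h g u

/-- Classical solutions: the integral defining `(-Δ)^α u (x)` converges and the equation holds at
every `x ∈ Ω`, and `u = g` almost everywhere in the exterior. -/
def IsClassicalSol (α : ℝ) (Ω : Set (E N)) (h : E N → ℝ → ℝ) (g u : E N → ℝ) : Prop :=
  ContinuousOn u Ω ∧ InWeightedL1 α u ∧ (∀ᵐ x, x ∈ (closure Ω)ᶜ → u x = g x) ∧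
    ∀ x ∈ Ω, Integrable (fracIntegrand α u x) ∧ fracLap α u x = h x (u x)

/-- Solutions, in the viscosity or in the classical sense, of
`(-Δ)^α u + |u|^(p-1) u = f` in `Ω`, `u = 0` in the exterior, `u → +∞` at `∂Ω`. -/
def IsLargeSolution (α p : ℝ) (Ω : Set (E N)) (f u : E N → ℝ) : Prop :=
  (IsViscositySol α Ω (fun x s => f x - |s| ^ (p - 1) * s) (fun _ => 0) u ∨
    IsClassicalSol α Ω (fun x s => f x - |s| ^ (p - 1) * s) (fun _ => 0) u) ∧
  Tendsto u (toBoundary Ω) atTop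

/-- `C(τ) = ∫₀^∞ (χ_(0,1)(t) |1-t|^τ + (1+t)^τ - 2) / t^(1+2α) dt`. -/
def Cfun (α τ : ℝ) : ℝ :=
  ∫ t in Set.Ioi (0 : ℝ),
    (Set.indicator (Set.Ioo 0 1) (fun s : ℝ => |1 - s| ^ τ) t + (1 + t) ^ τ - 2) /
      t ^ (1 + 2 * α)

/-- `τ₀(α)`: the unique `τ ∈ (-1,0)` with `C(τ) = 0`, written as the supremum of the
one-element set of these zeros. -/
def tau0 (α : ℝ) : ℝ := sSup {τ : ℝ | τ ∈ Set.Ioo (-1 : ℝ) 0 ∧ Cfun α τ = 0}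

end LargeSol

end

noncomputable section

set_option linter.unusedSectionVars false

namespace LargeSol

variable {N : ℕ}

/-! Near `∂Ω` three powers of the distance `d` compete: the source `d^γ`, the absorption `u^p ~
d^(τp)`, and the diffusion, of order `d^(τ-2α)`. Outside the excluded value of `τ` one of them
cannot be compensated, and two one-sided inequalities suffice to see it.

From below (`exists_test_below`): next to any point close to the boundary a concave paraboloid
touches `u` from below, which gives `f - u^p ≤ K d^(τ-2α)`. Hence the source cannot be strictly the
most singular term (`false_of_source_dominates`).

From above (`exists_test_above`): let `t` be the limsup of `u d^(-τ)`. At points where this quotient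
is almost `t`, the function `u` is touched from above by `t ℓ^τ` plus a small paraboloid, with `ℓ`
affine and close to `d`. After rescaling, the second differences of `u` are controlled by those of
the half-space profile `x₊^τ`, whose kernel integral is a positive multiple of `C(τ)`. This gives `a
μ^(τp) ≤ F μ^γ + (A C(τ) + η) μ^(τ-2α)` for arbitrarily small `μ` and `η`, so the absorption cannot
dominate, and the diffusion cannot outweigh the source if `C(τ) < 0`, nor balance the absorption if
`C(τ) ≤ 0`.

The sign of `C` comes from convexity in the exponent: `C` is positive somewhere in `(-1,0)` and
negative at `0`, so it is negative between `τ₀` and `0` (`tau0_spec`). The condition on `p` in the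
weak case says `τ₀ (p-1) ≤ -2α`, so `τ > τ₀` as soon as `τ (p-1) > -2α`.

The delicate point is the integral away from the touching point: `d^τ` and `ℓ^τ` blow up on
different hypersurfaces, so no pointwise comparison is available. A shear along a transversal
direction carries a defining function of `Ω` exactly to `ℓ`, preserves volume, and changes `|y|`
only by factors `1 ± ε` (`lintegral_posPow_shear_le`). Only the `C¹` regularity of the boundary
enters this argument. -/

lemma indicator_one_congr {X Y : Type*} {s : Set X} {t : Set Y} {x : X} {y : Y}
    (h : x ∈ s ↔ y ∈ t) : (s.indicator 1 x : ENNReal) = t.indicator 1 y := by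
  by_cases hx : x ∈ s
  · rw [Set.indicator_of_mem hx, Set.indicator_of_mem (h.1 hx), Pi.one_apply, Pi.one_apply]
  · rw [Set.indicator_of_notMem hx, Set.indicator_of_notMem fun hy => hx (h.2 hy)]

/-! ### The measure `|y|^(-q) dy`: scaling, symmetry, slicing by hyperplanes. -/

section PowerMeasure

open Module

variable {F : Type*} [NormedAddCommGroup F] [InnerProductSpace ℝ F] [FiniteDimensional ℝ F]
  [MeasurableSpace F] [BorelSpace F]

/-- The measure with density `|y|^(-q)`. -/
def powMeas (F : Type*) [NormedAddCommGroup F] [InnerProductSpace ℝ F] [FiniteDimensional ℝ F]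
    [MeasurableSpace F] [BorelSpace F] (q : ℝ) : Measure F :=
  volume.withDensity fun y => ENNReal.ofReal ((‖y‖ ^ q)⁻¹)

lemma measurable_powDensity (q : ℝ) :
    Measurable fun y : F => ENNReal.ofReal ((‖y‖ ^ q)⁻¹) := by fun_prop

lemma lintegral_powMeas (q : ℝ) (f : F → ENNReal) :
    ∫⁻ y, f y ∂powMeas F q = ∫⁻ y, ENNReal.ofReal ((‖y‖ ^ q)⁻¹) * f y :=
  lintegral_withDensity_eq_lintegral_mul_non_measurable _ (measurable_powDensity q)
    (ae_of_all _ fun _ => ENNReal.ofReal_lt_top) f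

lemma powMeas_apply (q : ℝ) {s : Set F} (hs : MeasurableSet s) :
    powMeas F q s = ∫⁻ y, ENNReal.ofReal ((‖y‖ ^ q)⁻¹) * s.indicator 1 y := by
  rw [← lintegral_powMeas, lintegral_indicator_one hs]

lemma integrable_powMeas_iff (q : ℝ) (f : F → ℝ) :
    Integrable f (powMeas F q) ↔ Integrable fun y => f y / ‖y‖ ^ q := by
  rw [powMeas, integrable_withDensity_iff_integrable_smul' (measurable_powDensity q)
    (ae_of_all _ fun _ => ENNReal.ofReal_lt_top)]
  refine iff_of_eq (congrArg (fun g : F → ℝ => Integrable g volume) ?_)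
  ext y
  rw [ENNReal.toReal_ofReal (by positivity), smul_eq_mul]
  ring

lemma integral_powMeas (q : ℝ) (f : F → ℝ) :
    ∫ y, f y ∂powMeas F q = ∫ y, f y / ‖y‖ ^ q := by
  rw [powMeas, integral_withDensity_eq_integral_toReal_smul (measurable_powDensity q)
    (ae_of_all _ fun _ => ENNReal.ofReal_lt_top)]
  congr 1
  ext y
  rw [ENNReal.toReal_ofReal (by positivity), smul_eq_mul]
  ring

lemma powMeas_absolutelyContinuous (q : ℝ) : powMeas F q ≪ volume :=
  withDensity_absolutelyContinuous _ _

lemma powMeas_compl_ball_lt_top {q : ℝ} (hq : (finrank ℝ F : ℝ) < q) {ρ : ℝ} (hρ : 0 < ρ) :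
    powMeas F q (Metric.ball 0 ρ)ᶜ < ⊤ := by
  have hq0 : 0 < q := lt_of_le_of_lt (by positivity) hq
  have hfin := finite_integral_one_add_norm (E := F) (μ := volume) hq
  rw [powMeas_apply _ Metric.isOpen_ball.measurableSet.compl]
  refine lt_of_le_of_lt (b := ∫⁻ y : F, ENNReal.ofReal (((1 + ρ) / ρ) ^ q) *
    ENNReal.ofReal ((1 + ‖y‖) ^ (-q))) (lintegral_mono fun y => ?_) ?_
  · by_cases hy : y ∈ (Metric.ball (0 : F) ρ)ᶜ
    · simp only [Set.indicator_of_mem hy, Pi.one_apply, mul_one]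
      rw [← ENNReal.ofReal_mul (by positivity)]
      apply ENNReal.ofReal_le_ofReal
      have hy' : ρ ≤ ‖y‖ := by simpa using hy
      have hy0 : 0 < ‖y‖ := hρ.trans_le hy'
      rw [Real.rpow_neg (by positivity), ← div_eq_mul_inv, inv_eq_one_div,
        div_le_div_iff₀ (by positivity) (by positivity), one_mul,
        ← Real.mul_rpow (by positivity) (by positivity)]
      apply Real.rpow_le_rpow (by positivity) _ hq0.le
      rw [div_mul_eq_mul_div, le_div_iff₀ hρ]
      nlinarith
    · simp [Set.indicator_of_notMem hy]
  · rw [lintegral_const_mul _ (by fun_prop)]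
    exact ENNReal.mul_lt_top ENNReal.ofReal_lt_top hfin

lemma integrableOn_norm_sq_powMeas {q : ℝ} (hd : 1 ≤ finrank ℝ F)
    (hq : q < (finrank ℝ F : ℝ) + 2) (ρ : ℝ) :
    IntegrableOn (fun y : F => ‖y‖ ^ 2) (Metric.ball 0 ρ) (powMeas F q) := by
  rw [← integrable_indicator_iff Metric.isOpen_ball.measurableSet,
    integrable_powMeas_iff]
  have : (fun y : F => (Metric.ball (0 : F) ρ).indicator (fun y => ‖y‖ ^ 2) y / ‖y‖ ^ q)
      = (Metric.ball (0 : F) ρ).indicator (fun y => ‖y‖ ^ 2 / ‖y‖ ^ q) := by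
    ext y; simp only [Set.indicator]; split_ifs <;> simp
  rw [this, integrable_indicator_iff Metric.isOpen_ball.measurableSet]
  refine integrableOn_ball_of_norm_le_rpow (C := 1) (α := q - 2) hd (by linarith) ?_
    (Measurable.aestronglyMeasurable (by fun_prop))
  filter_upwards with y
  rw [one_mul, Real.norm_of_nonneg (by positivity)]
  rcases (norm_nonneg y).eq_or_lt with h | h
  · rw [← h]; simp; positivity
  · rw [neg_sub, Real.rpow_sub h, Real.rpow_two]

lemma map_smul_powMeas (q : ℝ) {c : ℝ} (hc : 0 < c) :
    (powMeas F q).map (fun y => c • y) =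
      ENNReal.ofReal (c ^ (q - finrank ℝ F)) • powMeas F q := by
  ext s hs
  have hm : Measurable fun y : F => c • y := by fun_prop
  rw [Measure.map_apply hm hs, powMeas_apply _ (hm hs), Measure.smul_apply,
    powMeas_apply _ hs, smul_eq_mul]
  have h1 : ∀ y : F, ENNReal.ofReal ((‖y‖ ^ q)⁻¹) * ((fun y => c • y) ⁻¹' s).indicator 1 y
      = (fun z : F => ENNReal.ofReal (c ^ q) * (ENNReal.ofReal ((‖z‖ ^ q)⁻¹) * s.indicator 1 z))
        (c • y) := by
    intro y
    have : (s.indicator 1 (c • y) : ENNReal) = ((fun y => c • y) ⁻¹' s).indicator 1 y :=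
      indicator_one_congr Iff.rfl
    simp only [this]
    rw [← mul_assoc, ← ENNReal.ofReal_mul (by positivity), norm_smul, Real.norm_of_nonneg hc.le,
      Real.mul_rpow hc.le (norm_nonneg _), mul_inv, mul_inv_cancel_left₀ (by positivity)]
  simp_rw [h1]
  have hmeas : Measurable fun z : F =>
      ENNReal.ofReal (c ^ q) * (ENNReal.ofReal ((‖z‖ ^ q)⁻¹) * s.indicator 1 z) := by
    refine Measurable.const_mul (Measurable.mul (by fun_prop) ?_) _
    exact measurable_one.indicator hs
  rw [← lintegral_map hmeas hm, Measure.map_addHaar_smul _ hc.ne', lintegral_smul_measure,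
    lintegral_const_mul _ (by
      exact Measurable.mul (by fun_prop) (measurable_one.indicator hs)),
    smul_eq_mul, ← mul_assoc, ← ENNReal.ofReal_mul (by positivity)]
  congr 2
  rw [Real.rpow_sub hc, Real.rpow_natCast, abs_of_pos (by positivity)]
  field_simp

lemma map_neg_powMeas (q : ℝ) : (powMeas F q).map (fun y => -y) = powMeas F q := by
  ext s hs
  have hm : Measurable fun y : F => -y := by fun_prop
  rw [Measure.map_apply hm hs, powMeas_apply _ (hm hs), powMeas_apply _ hs,
    ← lintegral_neg_eq_self]
  congr 1
  ext y
  rw [norm_neg, indicator_one_congr (s := (fun y : F => -y) ⁻¹' s) (t := s) (x := -y) (y := y)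
    (by simp)]

/-- The constant `∫ (1 + |y|²)^(-q/2) dy`. -/
def sliceConst (F : Type*) [NormedAddCommGroup F] [InnerProductSpace ℝ F] [FiniteDimensional ℝ F]
    [MeasurableSpace F] [BorelSpace F] (q : ℝ) : ENNReal :=
  ∫⁻ y : F, ENNReal.ofReal ((Real.sqrt (1 + ‖y‖ ^ 2) ^ q)⁻¹)

lemma sliceConst_lt_top {q : ℝ} (hq : (finrank ℝ F : ℝ) < q) : sliceConst F q < ⊤ := by
  have h := (integrable_rpow_neg_one_add_norm_sq (E := F) (μ := volume) hq).lintegral_lt_top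
  refine lt_of_le_of_lt (lintegral_mono fun y => ?_) h
  apply ENNReal.ofReal_le_ofReal
  rw [Real.sqrt_eq_rpow, ← Real.rpow_mul (by positivity), ← Real.rpow_neg (by positivity)]
  apply le_of_eq; congr 1; ring

lemma sliceConst_pos (q : ℝ) : 0 < sliceConst F q := by
  rw [sliceConst, lintegral_pos_iff_support (by fun_prop)]
  have : (Function.support fun y : F => ENNReal.ofReal ((Real.sqrt (1 + ‖y‖ ^ 2) ^ q)⁻¹))
      = Set.univ := by
    ext y; simp; positivity
  rw [this]
  exact isOpen_univ.measure_pos volume Set.univ_nonempty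

/-- Rescaling by `|s|` reduces the slice at height `s` to the slice at height `1`; this lowers the
exponent by the dimension of the slice. -/
lemma lintegral_slice (q : ℝ) {s : ℝ} (hs : s ≠ 0) :
    ∫⁻ y : F, ENNReal.ofReal ((Real.sqrt (s ^ 2 + ‖y‖ ^ 2) ^ q)⁻¹) =
      ENNReal.ofReal ((|s| ^ (q - finrank ℝ F))⁻¹) * sliceConst F q := by
  have hs' : 0 < |s| := abs_pos.2 hs
  have hmeas : Measurable fun y : F => ENNReal.ofReal ((Real.sqrt (s ^ 2 + ‖y‖ ^ 2) ^ q)⁻¹) := by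
    fun_prop
  have h1 : ∀ y : F, ENNReal.ofReal ((Real.sqrt (s ^ 2 + ‖|s| • y‖ ^ 2) ^ q)⁻¹)
      = ENNReal.ofReal ((|s| ^ q)⁻¹) * ENNReal.ofReal ((Real.sqrt (1 + ‖y‖ ^ 2) ^ q)⁻¹) := by
    intro y
    rw [← ENNReal.ofReal_mul (by positivity), ← mul_inv, ← Real.mul_rpow (by positivity)
      (by positivity)]
    congr 3
    rw [norm_smul, Real.norm_of_nonneg hs'.le, mul_pow, sq_abs, ← mul_one_add,
      Real.sqrt_mul (sq_nonneg s), Real.sqrt_sq_eq_abs]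
  have h2 : ∫⁻ y : F, ENNReal.ofReal ((Real.sqrt (s ^ 2 + ‖|s| • y‖ ^ 2) ^ q)⁻¹)
      = ENNReal.ofReal ((|s| ^ finrank ℝ F)⁻¹) *
        ∫⁻ y : F, ENNReal.ofReal ((Real.sqrt (s ^ 2 + ‖y‖ ^ 2) ^ q)⁻¹) := by
    rw [← lintegral_map hmeas (by fun_prop : Measurable fun y : F => |s| • y),
      Measure.map_addHaar_smul _ hs'.ne', lintegral_smul_measure, smul_eq_mul,
      abs_of_pos (by positivity)]
  have h3 : ∫⁻ y : F, ENNReal.ofReal ((Real.sqrt (s ^ 2 + ‖y‖ ^ 2) ^ q)⁻¹) =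
      ENNReal.ofReal (|s| ^ finrank ℝ F) * ∫⁻ y : F,
        ENNReal.ofReal ((Real.sqrt (s ^ 2 + ‖|s| • y‖ ^ 2) ^ q)⁻¹) := by
    rw [h2, ← mul_assoc, ← ENNReal.ofReal_mul (by positivity), mul_inv_cancel₀ (by positivity)]
    simp
  rw [h3]
  simp_rw [h1]
  rw [lintegral_const_mul _ (by fun_prop), ← mul_assoc, ← ENNReal.ofReal_mul (by positivity),
    sliceConst]
  congr 2
  rw [Real.rpow_sub hs', Real.rpow_natCast]
  field_simp

/-- Slicing of `|y|^(-q) dy` by hyperplanes. -/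
lemma map_inner_powMeas (q : ℝ) {n : F} (hn : ‖n‖ = 1) :
    (powMeas F q).map (fun y => inner ℝ n y) =
      sliceConst ((ℝ ∙ n)ᗮ : Submodule ℝ F) q • powMeas ℝ (q - ((finrank ℝ F - 1 : ℕ) : ℝ)) := by
  have hn0 : n ≠ 0 := by rintro rfl; simp at hn
  set K : Submodule ℝ F := ℝ ∙ n with hK
  have hfr : finrank ℝ (Kᗮ : Submodule ℝ F) = finrank ℝ F - 1 := by
    have h1 := K.finrank_add_finrank_orthogonal
    have h2 : finrank ℝ K = 1 := finrank_span_singleton hn0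
    omega
  ext s hs
  have hm : Measurable fun y : F => (inner ℝ n y : ℝ) := by fun_prop
  rw [Measure.map_apply hm hs, powMeas_apply _ (hm hs), Measure.smul_apply,
    powMeas_apply _ hs, smul_eq_mul, ← hfr]
  -- The splitting into the line `ℝ n` and its orthogonal complement is an isometry, so Tonelli
  -- applies. The slice at height `r ≠ 0` is then evaluated by `lintegral_slice`, and the height `0`
  -- is negligible.
  have e1 : MeasurePreserving (fun p : K × Kᗮ => K.orthogonalDecomposition.symm (WithLp.toLp 2 p)) :=
    (K.orthogonalDecomposition.symm.measurePreserving).comp (WithLp.volume_preserving_toLp _ _)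
  have hm2 : Measurable fun y : F => ENNReal.ofReal ((‖y‖ ^ q)⁻¹) *
      ((fun y : F => (inner ℝ n y : ℝ)) ⁻¹' s).indicator 1 y :=
    (measurable_powDensity q).mul (measurable_one.indicator (hm hs))
  rw [← e1.lintegral_comp hm2, Measure.volume_eq_prod, lintegral_prod _ (by
    exact (hm2.comp e1.measurable).aemeasurable)]
  have e2 := (LinearIsometryEquiv.toSpanUnitSingleton (𝕜 := ℝ) n hn).measurePreserving
  have key : ∀ (a : K) (b : Kᗮ), K.orthogonalDecomposition.symm (WithLp.toLp 2 (a, b))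
      = (a : F) + b := fun a b => by
    rw [LinearIsometryEquiv.symm_apply_eq]
    simp [Submodule.orthogonalDecomposition_apply]
  rw [← e2.lintegral_comp (by
    exact Measurable.lintegral_prod_right' (hm2.comp e1.measurable)),
    ← lintegral_const_mul _ (by
      exact Measurable.mul (measurable_powDensity _) (measurable_one.indicator hs))]
  apply lintegral_congr_ae
  filter_upwards [compl_mem_ae_iff.2 (measure_singleton (0 : ℝ))] with r hr
  have hr0 : r ≠ 0 := hr
  have hin : ∀ b : Kᗮ, inner ℝ n (r • n + (b : F)) = r := fun b => by
    have : inner ℝ n (b : F) = 0 := (Submodule.mem_orthogonal _ _).1 b.2 n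
      (Submodule.mem_span_singleton_self n)
    rw [inner_add_right, inner_smul_right, this, real_inner_self_eq_norm_sq, hn]; simp
  have hno : ∀ b : Kᗮ, ‖r • n + (b : F)‖ = Real.sqrt (r ^ 2 + ‖b‖ ^ 2) := fun b => by
    have : inner ℝ n (b : F) = 0 := (Submodule.mem_orthogonal _ _).1 b.2 n
      (Submodule.mem_span_singleton_self n)
    rw [eq_comm, Real.sqrt_eq_iff_mul_self_eq (by positivity) (by positivity), ← sq,
      norm_add_sq_real, inner_smul_left, this, norm_smul, hn]
    simp
  calc _ = ∫⁻ b : Kᗮ, ENNReal.ofReal ((Real.sqrt (r ^ 2 + ‖b‖ ^ 2) ^ q)⁻¹) * s.indicator 1 r := by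
        congr 1
        ext b
        rw [key, LinearIsometryEquiv.toSpanUnitSingleton_apply, hno]
        congr 1
        exact indicator_one_congr (by rw [Set.mem_preimage, hin])
    _ = _ := by
        rw [lintegral_mul_const _ (by fun_prop), lintegral_slice _ hr0, Real.norm_eq_abs]
        ring

end PowerMeasure

/-! ### The one-dimensional profile `x₊^τ` and its second difference at `1`. -/

/-- The positive-part power `x₊^τ`. -/
def posPow (τ x : ℝ) : ℝ := if 0 < x then x ^ τ else 0

/-- The second difference of `x₊^τ` at `1`. -/
def posPowDiff (τ s : ℝ) : ℝ := posPow τ (1 + s) + posPow τ (1 - s) - 2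

lemma posPow_of_pos {τ x : ℝ} (hx : 0 < x) : posPow τ x = x ^ τ := if_pos hx

lemma posPow_of_nonpos {τ x : ℝ} (hx : x ≤ 0) : posPow τ x = 0 := if_neg hx.not_gt

lemma posPow_nonneg (τ x : ℝ) : 0 ≤ posPow τ x := by
  unfold posPow; split_ifs with h
  · positivity
  · rfl

lemma measurable_posPow (τ : ℝ) : Measurable (posPow τ) :=
  Measurable.ite measurableSet_Ioi (by fun_prop) measurable_const

lemma posPow_mul {τ c : ℝ} (hc : 0 < c) (x : ℝ) : posPow τ (c * x) = c ^ τ * posPow τ x := by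
  rcases lt_or_ge 0 x with h | h
  · rw [posPow_of_pos h, posPow_of_pos (by positivity), Real.mul_rpow hc.le h.le]
  · rw [posPow_of_nonpos h, posPow_of_nonpos (mul_nonpos_of_nonneg_of_nonpos hc.le h), mul_zero]

lemma measurable_posPowDiff (τ : ℝ) : Measurable (posPowDiff τ) := by
  have := measurable_posPow τ
  unfold posPowDiff
  fun_prop

lemma posPowDiff_neg (τ s : ℝ) : posPowDiff τ (-s) = posPowDiff τ s := by
  unfold posPowDiff; rw [sub_neg_eq_add, ← sub_eq_add_neg]; ring

/-- Bernoulli's inequality for the concave power `-τ ∈ [0,1]`, applied to `x⁻¹`. -/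
lemma rpow_le_one_add_mul_inv_sub_one {τ x : ℝ} (h1 : -1 ≤ τ) (h0 : τ ≤ 0) (hx : 0 < x) :
    x ^ τ ≤ 1 + (-τ) * (x⁻¹ - 1) := by
  have := rpow_one_add_le_one_add_mul_self (s := x⁻¹ - 1) (p := -τ)
    (by have := inv_pos.2 hx; linarith) (by linarith) (by linarith)
  rwa [add_sub_cancel, Real.inv_rpow hx.le, Real.rpow_neg hx.le, inv_inv] at this

/-- The two powers have product `(1 - s²)^τ ≥ 1`, so by the arithmetic-geometric mean inequality
their sum is at least `2`. -/
lemma posPowDiff_nonneg {τ s : ℝ} (h0 : τ ≤ 0) (hs : |s| < 1) : 0 ≤ posPowDiff τ s := by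
  have hs' := abs_lt.1 hs
  have h1 : 0 < 1 + s := by linarith
  have h2 : 0 < 1 - s := by linarith
  unfold posPowDiff
  rw [posPow_of_pos h1, posPow_of_pos h2]
  have hprod : 1 ≤ (1 + s) ^ τ * (1 - s) ^ τ := by
    rw [← Real.mul_rpow h1.le h2.le]
    exact Real.one_le_rpow_of_pos_of_le_one_of_nonpos (by positivity)
      (by nlinarith [sq_nonneg s]) h0
  have ha := Real.rpow_pos_of_pos h1 τ
  have hb := Real.rpow_pos_of_pos h2 τ
  nlinarith [sq_nonneg ((1 + s) ^ τ - (1 - s) ^ τ)]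

/-- The linear terms cancel in the second difference; the quadratic bound makes the kernel
singularity at `0` integrable for `q < 3`. -/
lemma posPowDiff_le {τ s : ℝ} (h1 : -1 ≤ τ) (h0 : τ ≤ 0) (hs : |s| ≤ 1 / 2) :
    posPowDiff τ s ≤ 3 * s ^ 2 := by
  have hs' := abs_le.1 hs
  have hp : 0 < 1 + s := by linarith
  have hm : 0 < 1 - s := by linarith
  unfold posPowDiff
  rw [posPow_of_pos hp, posPow_of_pos hm]
  have e1 := rpow_le_one_add_mul_inv_sub_one h1 h0 hp
  have e2 := rpow_le_one_add_mul_inv_sub_one h1 h0 hm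
  have hs2 : s ^ 2 ≤ 1 / 4 := by nlinarith
  have e3 : (1 + s)⁻¹ + (1 - s)⁻¹ - 2 = 2 * s ^ 2 / (1 - s ^ 2) := by
    have : 1 - s ^ 2 ≠ 0 := by nlinarith
    field_simp
    ring
  have e4 : 2 * s ^ 2 / (1 - s ^ 2) ≤ 3 * s ^ 2 := by
    rw [div_le_iff₀ (by linarith)]
    nlinarith [sq_nonneg s]
  have e5 : 0 ≤ 2 * s ^ 2 / (1 - s ^ 2) := div_nonneg (by positivity) (by linarith)
  nlinarith

/-- Away from `0` the only singularity is the pole at `s = -1`, integrable because `τ > -1`, where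
the kernel is at most `2^q`. For `s ≥ 0` the profile is at most `1` and the kernel has finite mass.
-/
lemma integrableOn_posPow_one_add {τ q : ℝ} (h1 : -1 < τ) (h0 : τ ≤ 0) (hq : 1 < q) :
    IntegrableOn (fun s => posPow τ (1 + s)) (Metric.ball 0 (1 / 2))ᶜ (powMeas ℝ q) := by
  have hms : MeasurableSet (Metric.ball (0 : ℝ) (1 / 2))ᶜ := Metric.isOpen_ball.measurableSet.compl
  have hfin := powMeas_compl_ball_lt_top (F := ℝ) (q := q) (by simpa using hq)
    (ρ := 1 / 2) (by norm_num)
  have i1 : Integrable ((Metric.ball (0 : ℝ) (1 / 2))ᶜ.indicator fun _ => (1 : ℝ)) (powMeas ℝ q) := by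
    rw [integrable_indicator_iff hms]
    exact integrableOn_const hfin.ne
  rw [integrable_powMeas_iff] at i1
  have i2 : Integrable ((Set.Ioo (-1 : ℝ) 0).indicator fun s => (s + 1) ^ τ) := by
    rw [integrable_indicator_iff measurableSet_Ioo]
    have : IntervalIntegrable (fun x : ℝ => x ^ τ) volume 0 1 :=
      intervalIntegral.intervalIntegrable_rpow' h1
    have h3 := this.comp_add_right 1
    rw [intervalIntegrable_iff_integrableOn_Ioo_of_le (by norm_num)] at h3
    simpa using h3
  rw [← integrable_indicator_iff hms, integrable_powMeas_iff]
  refine (i1.add (i2.const_mul (2 ^ q))).mono' ?_ ?_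
  · refine Measurable.aestronglyMeasurable (Measurable.div (Measurable.indicator ?_ hms) (by fun_prop))
    exact (measurable_posPow τ).comp (by fun_prop)
  · filter_upwards with s
    simp only [Pi.add_apply]
    by_cases hs : s ∈ (Metric.ball (0 : ℝ) (1 / 2))ᶜ
    · have hs2 : 1 / 2 ≤ |s| := by simpa using hs
      have hs0 : 0 < |s| := by linarith
      simp only [Set.indicator_of_mem hs, Real.norm_eq_abs]
      rw [abs_of_nonneg (div_nonneg (posPow_nonneg _ _) (by positivity))]
      have hind : 0 ≤ (Set.Ioo (-1 : ℝ) 0).indicator (fun s => (s + 1) ^ τ) s := by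
        apply Set.indicator_nonneg
        intro x hx
        have : 0 < x + 1 := by linarith [hx.1]
        positivity
      rcases le_or_gt (1 + s) 0 with h | h
      · rw [posPow_of_nonpos h]
        rw [zero_div]
        positivity
      · rw [posPow_of_pos h]
        rcases le_or_gt 0 s with h' | h'
        · have : (1 + s) ^ τ ≤ 1 := Real.rpow_le_one_of_one_le_of_nonpos (by linarith) h0
          have : (1 + s) ^ τ / |s| ^ q ≤ 1 / |s| ^ q := by gcongr
          have : 0 ≤ 2 ^ q * (Set.Ioo (-1 : ℝ) 0).indicator (fun s => (s + 1) ^ τ) s := by positivity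
          linarith
        · rw [Set.indicator_of_mem (show s ∈ Set.Ioo (-1 : ℝ) 0 from ⟨by linarith, h'⟩), add_comm s 1]
          have : (1 + s) ^ τ / |s| ^ q ≤ 2 ^ q * (1 + s) ^ τ := by
            rw [div_le_iff₀ (by positivity), mul_right_comm, ← Real.mul_rpow (by norm_num) hs0.le]
            have : 1 ≤ (2 * |s|) ^ q := Real.one_le_rpow (by linarith) (by linarith)
            have : 0 ≤ (1 + s) ^ τ := by positivity
            nlinarith
          have : 0 ≤ 1 / |s| ^ q := by positivity
          linarith
    · simp only [Set.indicator_of_notMem hs, zero_div, norm_zero, zero_add]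
      refine mul_nonneg (by positivity) (Set.indicator_nonneg ?_ s)
      intro x hx
      have : 0 < x + 1 := by linarith [hx.1]
      positivity

lemma measurePreserving_neg_powMeas {F : Type*} [NormedAddCommGroup F] [InnerProductSpace ℝ F]
    [FiniteDimensional ℝ F] [MeasurableSpace F] [BorelSpace F] (q : ℝ) :
    MeasurePreserving (fun y : F => -y) (powMeas F q) (powMeas F q) :=
  ⟨by fun_prop, map_neg_powMeas q⟩

lemma integrableOn_posPow_one_sub {τ q : ℝ} (h1 : -1 < τ) (h0 : τ ≤ 0) (hq : 1 < q) :
    IntegrableOn (fun s => posPow τ (1 - s)) (Metric.ball 0 (1 / 2))ᶜ (powMeas ℝ q) := by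
  have h := (measurePreserving_neg_powMeas (F := ℝ) q).integrableOn_comp_preimage
    (MeasurableEquiv.neg ℝ).measurableEmbedding (f := fun s => posPow τ (1 + s))
    (s := (Metric.ball 0 (1 / 2))ᶜ)
  have h2 : (fun y : ℝ => -y) ⁻¹' (Metric.ball 0 (1 / 2))ᶜ = (Metric.ball 0 (1 / 2))ᶜ := by
    ext; simp
  rw [h2] at h
  have h3 := h.2 (integrableOn_posPow_one_add h1 h0 hq)
  refine h3.congr_fun (fun s _ => ?_) Metric.isOpen_ball.measurableSet.compl
  simp [sub_eq_add_neg]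

lemma integrable_posPowDiff {τ q : ℝ} (h1 : -1 < τ) (h0 : τ ≤ 0) (hq : 1 < q) (hq3 : q < 3) :
    Integrable (posPowDiff τ) (powMeas ℝ q) := by
  have hms : MeasurableSet (Metric.ball (0 : ℝ) (1 / 2)) := Metric.isOpen_ball.measurableSet
  rw [← integrableOn_univ, ← Set.union_compl_self (Metric.ball (0 : ℝ) (1 / 2))]
  refine IntegrableOn.union ?_ ?_
  · refine ((integrableOn_norm_sq_powMeas (F := ℝ) (q := q) (by simp)
      (by simp; linarith) (1 / 2)).const_mul 3).mono'
      (measurable_posPowDiff τ).aestronglyMeasurable ?_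
    filter_upwards [ae_restrict_mem hms] with s hs
    have hs' : |s| < 1 / 2 := by simpa using hs
    rw [Real.norm_eq_abs, abs_of_nonneg (posPowDiff_nonneg h0 (by linarith)), Real.norm_eq_abs,
      sq_abs]
    exact posPowDiff_le h1.le h0 hs'.le
  · have hfin := powMeas_compl_ball_lt_top (F := ℝ) (q := q) (by simpa using hq)
      (ρ := 1 / 2) (by norm_num)
    exact ((integrableOn_posPow_one_add h1 h0 hq).add (integrableOn_posPow_one_sub h1 h0 hq)).sub
      (integrableOn_const hfin.ne)

/-! ### The constant `C(τ)`: convexity, its zero, its sign. -/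

section Constant

variable {α : ℝ}

lemma cfun_integrand_eq {τ t : ℝ} (ht : 0 < t) :
    Set.indicator (Set.Ioo 0 1) (fun s : ℝ => |1 - s| ^ τ) t + (1 + t) ^ τ - 2
      = posPowDiff τ t := by
  unfold posPowDiff
  rw [posPow_of_pos (by linarith : 0 < 1 + t)]
  rcases lt_or_ge t 1 with h | h
  · rw [Set.indicator_of_mem (Set.mem_Ioo.2 ⟨ht, h⟩), posPow_of_pos (by linarith),
      abs_of_pos (by linarith)]
    ring
  · rw [Set.indicator_of_notMem (fun hh => not_lt.2 h hh.2), posPow_of_nonpos (by linarith)]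
    ring

lemma cfun_eq (τ : ℝ) : Cfun α τ = ∫ t in Set.Ioi (0 : ℝ), posPowDiff τ t / t ^ (1 + 2 * α) := by
  refine setIntegral_congr_fun measurableSet_Ioi fun t ht => ?_
  simp only [cfun_integrand_eq ht]

lemma integral_posPowDiff (τ : ℝ) :
    ∫ s, posPowDiff τ s ∂powMeas ℝ (1 + 2 * α) = 2 * Cfun α τ := by
  rw [integral_powMeas, cfun_eq, ← integral_comp_abs]
  congr 1
  ext s
  rw [Real.norm_eq_abs]
  rcases abs_choice s with h | h
  · rw [h]
  · rw [h, posPowDiff_neg]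

lemma integrableOn_cfun (hα : α ∈ Set.Ioo (0 : ℝ) 1) {τ : ℝ} (hτ : τ ∈ Set.Ioc (-1 : ℝ) 0) :
    IntegrableOn (fun t => posPowDiff τ t / t ^ (1 + 2 * α)) (Set.Ioi 0) := by
  have h := integrable_posPowDiff (q := 1 + 2 * α) hτ.1 hτ.2 (by linarith [hα.1])
    (by linarith [hα.2])
  rw [integrable_powMeas_iff] at h
  refine h.integrableOn.congr_fun (fun t ht => ?_) measurableSet_Ioi
  simp only [Real.norm_eq_abs, abs_of_pos (show 0 < t from ht)]

lemma convexOn_rpow_exponent {x : ℝ} (hx : 0 < x) : ConvexOn ℝ Set.univ fun τ : ℝ => x ^ τ := by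
  have := (convexOn_exp).comp_linearMap (LinearMap.mul ℝ ℝ (Real.log x))
  refine this.congr fun τ _ => ?_
  simp [Real.rpow_def_of_pos hx]

lemma convexOn_posPowDiff (s : ℝ) : ConvexOn ℝ Set.univ fun τ => posPowDiff τ s := by
  have h : ∀ x : ℝ, ConvexOn ℝ Set.univ fun τ => posPow τ x := fun x => by
    rcases lt_or_ge 0 x with h | h
    · simp_rw [posPow_of_pos h]; exact convexOn_rpow_exponent h
    · simp_rw [posPow_of_nonpos h]; exact convexOn_const 0 convex_univ
  exact (((h (1 + s)).add (h (1 - s))).add (convexOn_const (-2) convex_univ)).congr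
    fun τ _ => by simp [posPowDiff, sub_eq_add_neg]

/-- Each `x^τ` is convex in the exponent `τ`, and integration against a positive kernel preserves
convexity. -/
lemma convexOn_cfun (hα : α ∈ Set.Ioo (0 : ℝ) 1) : ConvexOn ℝ (Set.Ioc (-1 : ℝ) 0) (Cfun α) := by
  refine ⟨convex_Ioc _ _, fun x hx y hy a b ha hb hab => ?_⟩
  have hxy : a • x + b • y ∈ Set.Ioc (-1 : ℝ) 0 := convex_Ioc _ _ hx hy ha hb hab
  rw [cfun_eq, cfun_eq, cfun_eq, ← integral_smul, ← integral_smul,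
    ← integral_add (by exact (integrableOn_cfun hα hx).smul a)
      (by exact (integrableOn_cfun hα hy).smul b)]
  refine setIntegral_mono_on (integrableOn_cfun hα hxy)
    (((integrableOn_cfun hα hx).smul a).add ((integrableOn_cfun hα hy).smul b)) measurableSet_Ioi
    fun t ht => ?_
  have ht0 : 0 < t := ht
  have := (convexOn_posPowDiff t).2 (Set.mem_univ x) (Set.mem_univ y) ha hb hab
  simp only [smul_eq_mul] at this ⊢
  rw [← mul_div_assoc, ← mul_div_assoc, ← add_div]
  gcongr

/-- For `τ = 0` the second difference vanishes on `(0,1)` and equals `-1` from `1` on. -/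
lemma cfun_zero_neg (hα : α ∈ Set.Ioo (0 : ℝ) 1) : Cfun α 0 < 0 := by
  have h0 : (0 : ℝ) ∈ Set.Ioc (-1 : ℝ) 0 := by simp
  rw [cfun_eq, ← neg_pos, ← integral_neg]
  have hval : ∀ t : ℝ, 0 < t → posPowDiff 0 t = if t < 1 then 0 else -1 := fun t ht => by
    unfold posPowDiff
    rw [posPow_of_pos (by linarith), Real.rpow_zero]
    split_ifs with h
    · rw [posPow_of_pos (by linarith), Real.rpow_zero]; norm_num
    · rw [posPow_of_nonpos (by linarith)]; norm_num
  rw [setIntegral_pos_iff_support_of_nonneg_ae]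
  · refine lt_of_lt_of_le ?_ (measure_mono (s := Set.Ioo (1 : ℝ) 2) ?_)
    · simp
    · intro t ht
      have ht0 : 0 < t := by linarith [ht.1]
      refine ⟨?_, ht0⟩
      rw [Function.mem_support, hval t ht0, if_neg (not_lt.2 ht.1.le)]
      have : 0 < t ^ (1 + 2 * α) := by positivity
      simp [this.ne']
  · filter_upwards [ae_restrict_mem measurableSet_Ioi] with t ht
    have ht0 : 0 < t := ht
    rw [hval t ht0]
    split_ifs
    · simp
    · rw [neg_div, neg_neg]; simp; positivity
  · exact (integrableOn_cfun hα h0).neg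

/-- On `[1,∞)` the integrand is at least `-2 t^(-1-2α)`, which costs `1/α`. On `(0,1)` it is
nonnegative, and on `(1/2,1)` it is at least `(1-t)^τ - 2`, whose integral blows up as `τ → -1`. -/
lemma cfun_pos_of_near (hα : α ∈ Set.Ioo (0 : ℝ) 1) {τ : ℝ} (hτ : τ ∈ Set.Ioo (-1 : ℝ) 0)
    (h : 2 + 1 / α < (1 / 2) ^ (τ + 1) / (τ + 1)) : 0 < Cfun α τ := by
  have hτ1 : 0 < τ + 1 := by linarith [hτ.1]
  have hint := integrableOn_cfun hα ⟨hτ.1, hτ.2.le⟩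
  have hsplit : Set.Ioi (0 : ℝ) = Set.Ioo 0 1 ∪ Set.Ici 1 := (Set.Ioo_union_Ici_eq_Ioi one_pos).symm
  rw [cfun_eq, hsplit, setIntegral_union
    (show Disjoint (Set.Ioo (0 : ℝ) 1) (Set.Ici 1) from
      Set.disjoint_left.2 fun x hx hx' => not_lt.2 hx' hx.2) measurableSet_Ici
    (hint.mono_set Set.Ioo_subset_Ioi_self) (hint.mono_set (Set.Ici_subset_Ioi.2 one_pos))]
  have hI : -(1 / α) ≤ ∫ t in Set.Ici (1 : ℝ), posPowDiff τ t / t ^ (1 + 2 * α) := by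
    have hi : IntegrableOn (fun t : ℝ => -2 * t ^ (-(1 + 2 * α))) (Set.Ioi 1) :=
      (integrableOn_Ioi_rpow_of_lt (by linarith [hα.1]) one_pos).const_mul _
    have e : ∫ t in Set.Ioi (1 : ℝ), -2 * t ^ (-(1 + 2 * α)) = -(1 / α) := by
      rw [integral_const_mul, integral_Ioi_rpow_of_lt (by linarith [hα.1]) one_pos]
      have := hα.1.ne'
      have h2 : -(1 + 2 * α) + 1 = -(2 * α) := by ring
      rw [h2, Real.one_rpow]
      field_simp
    rw [← e, integral_Ici_eq_integral_Ioi]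
    refine setIntegral_mono_on hi (hint.mono_set (Set.Ioi_subset_Ioi zero_le_one)) measurableSet_Ioi
      fun t ht => ?_
    have ht0 : (0 : ℝ) < t := one_pos.trans ht
    rw [Real.rpow_neg ht0.le, ← div_eq_mul_inv]
    gcongr
    unfold posPowDiff
    linarith [posPow_nonneg τ (1 + t), posPow_nonneg τ (1 - t)]
  have hJ : (1 / 2) ^ (τ + 1) / (τ + 1) - 1 ≤
      ∫ t in Set.Ioo (0 : ℝ) 1, posPowDiff τ t / t ^ (1 + 2 * α) := by
    have hsub : Set.Ioo (1 / 2 : ℝ) 1 ⊆ Set.Ioo 0 1 := Set.Ioo_subset_Ioo_left (by norm_num)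
    have hii : IntervalIntegrable (fun x : ℝ => (1 - x) ^ τ) volume (1 / 2) 1 := by
      have : IntervalIntegrable (fun x : ℝ => x ^ τ) volume 0 (1 / 2) :=
        intervalIntegral.intervalIntegrable_rpow' hτ.1
      have h3 := (this.comp_sub_left 1).symm
      norm_num at h3 ⊢
      exact h3
    have hii2 : IntervalIntegrable (fun x : ℝ => (1 - x) ^ τ - 2) volume (1 / 2) 1 :=
      hii.sub intervalIntegrable_const
    have e : ∫ t in Set.Ioo (1 / 2 : ℝ) 1, ((1 - t) ^ τ - 2) = (1 / 2) ^ (τ + 1) / (τ + 1) - 1 := by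
      rw [← integral_Ioc_eq_integral_Ioo, ← intervalIntegral.integral_of_le (by norm_num),
        intervalIntegral.integral_sub hii intervalIntegrable_const,
        intervalIntegral.integral_comp_sub_left (fun x => x ^ τ) 1, integral_rpow (Or.inl hτ.1)]
      norm_num
      rw [Real.zero_rpow hτ1.ne', sub_zero]
    rw [← e]
    have hnn : ∀ t ∈ Set.Ioo (0 : ℝ) 1, 0 ≤ posPowDiff τ t / t ^ (1 + 2 * α) := fun t ht =>
      div_nonneg (posPowDiff_nonneg hτ.2.le (abs_lt.2 ⟨by linarith [ht.1], ht.2⟩))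
        (Real.rpow_nonneg ht.1.le _)
    refine le_trans (setIntegral_mono_on ?_ (hint.mono_set (hsub.trans Set.Ioo_subset_Ioi_self))
      measurableSet_Ioo fun t ht => ?_) (setIntegral_mono_set
        (hint.mono_set Set.Ioo_subset_Ioi_self)
        (by filter_upwards [ae_restrict_mem measurableSet_Ioo] with t ht using hnn t ht)
        hsub.eventuallyLE)
    · exact (intervalIntegrable_iff_integrableOn_Ioo_of_le (by norm_num)).1 hii2
    · have ht' := hsub ht
      have h1 : t ^ (1 + 2 * α) ≤ 1 := Real.rpow_le_one ht'.1.le ht'.2.le (by linarith [hα.1])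
      have h2 := posPowDiff_nonneg hτ.2.le (abs_lt.2 ⟨by linarith [ht'.1], ht'.2⟩)
      have h4 : 0 < t ^ (1 + 2 * α) := Real.rpow_pos_of_pos ht'.1 _
      refine le_trans ?_ (le_div_self h2 h4 h1)
      unfold posPowDiff
      rw [posPow_of_pos (by linarith [ht'.2] : 0 < 1 - t)]
      linarith [posPow_nonneg τ (1 + t)]
  linarith

lemma exists_cfun_pos (hα : α ∈ Set.Ioo (0 : ℝ) 1) :
    ∃ τ ∈ Set.Ioo (-1 : ℝ) 0, 0 < Cfun α τ := by
  have hα0 := hα.1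
  set M := 2 + 1 / α with hM
  have hM0 : 2 < M := by have : 0 < 1 / α := by positivity
                         linarith
  -- With `τ + 1 = 1/(2M) < 1` the numerator exceeds `1/2`, so the quotient required by
  -- `cfun_pos_of_near` exceeds `M`.
  refine ⟨-1 + 1 / (2 * M), ⟨by have : 0 < 1 / (2 * M) := by positivity
                                linarith, ?_⟩, ?_⟩
  · have : 1 / (2 * M) < 1 := by rw [div_lt_one (by positivity)]; linarith
    linarith
  · have hlt : 1 / (2 * M) < 1 := by rw [div_lt_one (by positivity)]; linarith
    have hpos : 0 < 1 / (2 * M) := by positivity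
    refine cfun_pos_of_near hα ⟨by linarith, by linarith⟩ ?_
    rw [← hM, neg_add_cancel_comm]
    have h1 : (1 / 2 : ℝ) < (1 / 2) ^ (1 / (2 * M)) := by
      conv_lhs => rw [← Real.rpow_one (1 / 2)]
      exact Real.rpow_lt_rpow_of_exponent_gt (by norm_num) (by norm_num) hlt
    rw [lt_div_iff₀ hpos]
    calc M * (1 / (2 * M)) = 1 / 2 := by field_simp
      _ < _ := h1

/-- Convexity in `τ` places the zero of `C` and the sign of `C` beyond it. -/
lemma tau0_spec (hα : α ∈ Set.Ioo (0 : ℝ) 1) :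
    tau0 α ∈ Set.Ioo (-1 : ℝ) 0 ∧ Cfun α (tau0 α) = 0 ∧
      ∀ τ, tau0 α < τ → τ < 0 → Cfun α τ < 0 := by
  have hconv := convexOn_cfun hα
  have hC0 := cfun_zero_neg hα
  -- Between a point where `C ≤ 0` and the endpoint `0`, where `C < 0`, the chord is negative, and
  -- `C` lies below it.
  have hneg : ∀ z ∈ Set.Ioo (-1 : ℝ) 0, Cfun α z ≤ 0 → ∀ τ, z < τ → τ < 0 → Cfun α τ < 0 := by
    intro z hz hCz τ h1 h2
    have hz0 : z < 0 := hz.2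
    have h := hconv.2 ⟨hz.1, hz.2.le⟩ (show (0 : ℝ) ∈ Set.Ioc (-1 : ℝ) 0 by simp)
      (show 0 ≤ τ / z from div_nonneg_of_nonpos h2.le hz0.le)
      (show 0 ≤ 1 - τ / z by rw [sub_nonneg, div_le_one_of_neg hz0]; exact h1.le) (by ring)
    simp only [smul_eq_mul, mul_zero, add_zero, div_mul_cancel₀ _ hz0.ne] at h
    have hlt : 0 < 1 - τ / z := by rw [sub_pos, div_lt_one_of_neg hz0]; exact h1
    have h3 : 0 ≤ τ / z := div_nonneg_of_nonpos h2.le hz0.le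
    nlinarith
  obtain ⟨a, ha, hCa⟩ := exists_cfun_pos hα
  have hcont : ContinuousOn (Cfun α) (Set.Ioo (-1) 0) := by
    have := (hconv.subset Set.Ioo_subset_Ioc_self (convex_Ioo _ _)).continuousOn isOpen_Ioo
    exact this
  -- Convexity gives continuity only in the open interval, so the intermediate value theorem needs
  -- an interior point with `C < 0`. The weight `l` is the one for which the chord from `(a, C(a))`
  -- to `(0, C(0))` has height `C(0)/2`.
  obtain ⟨b, hab, hb0, hCb⟩ : ∃ b, a < b ∧ b < 0 ∧ Cfun α b < 0 := by
    set C0 := Cfun α 0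
    set Ca := Cfun α a
    set l := (-C0) / (2 * (Ca - C0)) with hl
    have hd : 0 < Ca - C0 := by linarith
    have hl0 : 0 < l := div_pos (by linarith) (by linarith)
    have hl1 : l < 1 := by rw [hl, div_lt_one (by linarith)]; linarith
    have hlm : l * (Ca - C0) = -C0 / 2 := by rw [hl]; field_simp
    have h := hconv.2 ⟨ha.1, ha.2.le⟩ (show (0 : ℝ) ∈ Set.Ioc (-1 : ℝ) 0 by simp)
      hl0.le (show 0 ≤ 1 - l by linarith) (by ring)
    simp only [smul_eq_mul, mul_zero, add_zero] at h
    exact ⟨l * a, by nlinarith [ha.2], by nlinarith [ha.2], by nlinarith⟩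
  obtain ⟨z, hz, hCz⟩ : (0 : ℝ) ∈ Cfun α '' Set.Icc a b :=
    intermediate_value_Icc' hab.le (hcont.mono fun x hx => ⟨ha.1.trans_le hx.1, hx.2.trans_lt hb0⟩)
      ⟨hCb.le, hCa.le⟩
  have hzI : z ∈ Set.Ioo (-1 : ℝ) 0 := ⟨ha.1.trans_le hz.1, hz.2.trans_lt hb0⟩
  have heq : {τ : ℝ | τ ∈ Set.Ioo (-1 : ℝ) 0 ∧ Cfun α τ = 0} = {z} := by
    ext w
    simp only [Set.mem_ofPred_eq, Set.mem_singleton_iff]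
    refine ⟨fun ⟨hw, hCw⟩ => ?_, fun h => h ▸ ⟨hzI, hCz⟩⟩
    rcases lt_trichotomy w z with h | h | h
    · exact absurd hCz (hneg w hw hCw.le z h hzI.2).ne
    · exact h
    · exact absurd hCw (hneg z hzI hCz.le w h hw.2).ne
  have ht : tau0 α = z := by rw [tau0, heq, csSup_singleton]
  rw [ht]
  exact ⟨hzI, hCz, hneg z hzI hCz.le⟩

end Constant

/-! ### The kernel of the fractional Laplacian. -/

/-- The kernel `|y|^(-N-2α) dy`. -/
abbrev kern (N : ℕ) (α : ℝ) : Measure (E N) := powMeas (E N) ((N : ℝ) + 2 * α)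

lemma fracLap_eq_integral_kern (α : ℝ) (w : E N → ℝ) (x : E N) :
    fracLap α w x = -(1 / 2) * ∫ y, (w (x + y) + w (x - y) - 2 * w x) ∂kern N α := by
  rw [fracLap, integral_powMeas]; rfl

lemma integrable_fracIntegrand_iff (α : ℝ) (w : E N → ℝ) (x : E N) :
    Integrable (fracIntegrand α w x) ↔
      Integrable (fun y => w (x + y) + w (x - y) - 2 * w x) (kern N α) := by
  rw [integrable_powMeas_iff]; rfl

lemma kern_compl_ball_lt_top {α : ℝ} (hα : 0 < α) {ρ : ℝ} (hρ : 0 < ρ) :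
    kern N α (Metric.ball 0 ρ)ᶜ < ⊤ :=
  powMeas_compl_ball_lt_top (by simp [hα]) hρ

lemma integrableOn_norm_sq_kern (hN : 1 ≤ N) {α : ℝ} (hα : α < 1) (ρ : ℝ) :
    IntegrableOn (fun y : E N => ‖y‖ ^ 2) (Metric.ball 0 ρ) (kern N α) :=
  integrableOn_norm_sq_powMeas (by simpa using hN) (by simp; linarith) ρ

lemma map_smul_kern (α : ℝ) {c : ℝ} (hc : 0 < c) :
    (kern N α).map (fun y => c • y) = ENNReal.ofReal (c ^ (2 * α)) • kern N α := by
  rw [kern, map_smul_powMeas _ hc]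
  simp

lemma measurableEmbedding_smul {c : ℝ} (hc : c ≠ 0) :
    MeasurableEmbedding fun y : E N => c • y :=
  (Homeomorph.smulOfNeZero c hc).measurableEmbedding

lemma integral_comp_smul_kern (α : ℝ) {c : ℝ} (hc : 0 < c) (f : E N → ℝ) :
    ∫ y, f (c • y) ∂kern N α = c ^ (2 * α) * ∫ y, f y ∂kern N α := by
  rw [← (measurableEmbedding_smul hc.ne').integral_map, map_smul_kern α hc, integral_smul_measure,
    ENNReal.toReal_ofReal (by positivity), smul_eq_mul]

lemma integrable_comp_smul_kern_iff (α : ℝ) {c : ℝ} (hc : 0 < c) (f : E N → ℝ) :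
    Integrable (fun y => f (c • y)) (kern N α) ↔ Integrable f (kern N α) := by
  have h := (measurableEmbedding_smul (N := N) hc.ne').integrable_map_iff (μ := kern N α) (g := f)
  rw [map_smul_kern α hc, integrable_smul_measure (by
    simp only [ne_eq, ENNReal.ofReal_eq_zero, not_le]; positivity) ENNReal.ofReal_ne_top] at h
  exact h.symm

/-- Inside the ball the second difference is kept whole, to use its cancellation. Outside, the
kernel has finite mass and the terms can be separated; by symmetry `g y` and `g (-y)` contribute
equally. -/
lemma integral_secondDiff {α ρ : ℝ} (hα : 0 < α) (hρ : 0 < ρ) {g G : E N → ℝ}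
    (hG : ∀ y ∈ Metric.ball (0 : E N) ρ, g y + g (-y) - 2 * g 0 = G y)
    (hGi : IntegrableOn G (Metric.ball 0 ρ) (kern N α))
    (hgi : IntegrableOn g (Metric.ball 0 ρ)ᶜ (kern N α)) :
    Integrable (fun y => g y + g (-y) - 2 * g 0) (kern N α) ∧
      ∫ y, (g y + g (-y) - 2 * g 0) ∂kern N α =
        (∫ y in Metric.ball 0 ρ, G y ∂kern N α) + 2 * (∫ y in (Metric.ball 0 ρ)ᶜ, g y ∂kern N α)
          - 2 * g 0 * (kern N α).real (Metric.ball 0 ρ)ᶜ := by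
  have hmb : MeasurableSet (Metric.ball (0 : E N) ρ) := Metric.isOpen_ball.measurableSet
  have hfin := kern_compl_ball_lt_top (N := N) hα hρ
  have mp := measurePreserving_neg_powMeas (F := E N) ((N : ℝ) + 2 * α)
  have me : MeasurableEmbedding fun y : E N => -y := (MeasurableEquiv.neg (E N)).measurableEmbedding
  have hpre : (fun y : E N => -y) ⁻¹' (Metric.ball 0 ρ)ᶜ = (Metric.ball 0 ρ)ᶜ := by ext; simp
  have i1 : IntegrableOn (fun y => g y + g (-y) - 2 * g 0) (Metric.ball 0 ρ) (kern N α) :=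
    hGi.congr_fun (fun y hy => (hG y hy).symm) hmb
  have hgn : IntegrableOn (fun y => g (-y)) (Metric.ball 0 ρ)ᶜ (kern N α) := by
    have := mp.integrableOn_comp_preimage me (f := g) (s := (Metric.ball 0 ρ)ᶜ)
    rw [hpre] at this
    exact this.2 hgi
  have hgn' : ∫ y in (Metric.ball 0 ρ)ᶜ, g (-y) ∂kern N α
      = ∫ y in (Metric.ball 0 ρ)ᶜ, g y ∂kern N α := by
    have := mp.setIntegral_preimage_emb me g (Metric.ball 0 ρ)ᶜ
    rw [hpre] at this
    exact this
  have hc : IntegrableOn (fun _ => 2 * g 0) (Metric.ball 0 ρ)ᶜ (kern N α) :=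
    integrableOn_const hfin.ne
  have i2 : IntegrableOn (fun y => g y + g (-y) - 2 * g 0) (Metric.ball 0 ρ)ᶜ (kern N α) :=
    (hgi.add hgn).sub hc
  have i3 : Integrable (fun y => g y + g (-y) - 2 * g 0) (kern N α) := by
    rw [← integrableOn_univ, ← Set.union_compl_self (Metric.ball (0 : E N) ρ)]
    exact i1.union i2
  refine ⟨i3, ?_⟩
  have e0 : IntegrableOn (fun y => g y + g (-y)) (Metric.ball 0 ρ)ᶜ (kern N α) := hgi.add hgn
  rw [← integral_add_compl hmb i3, setIntegral_congr_fun hmb hG, integral_sub e0 hc,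
    integral_add hgi hgn, hgn', setIntegral_const, smul_eq_mul]
  ring

/-- The fractional Laplacian at `x`, computed at scale `c`, for a function whose second differences
at `x` are explicit near `x`. -/
lemma fracLap_scaled {α ρ c : ℝ} (hα : 0 < α) (hρ : 0 < ρ) (hc : 0 < c) {w : E N → ℝ} {x : E N}
    {G : E N → ℝ}
    (hG : ∀ y ∈ Metric.ball (0 : E N) ρ, w (x + c • y) + w (x - c • y) - 2 * w x = G y)
    (hGi : IntegrableOn G (Metric.ball 0 ρ) (kern N α))
    (hgi : IntegrableOn (fun y => w (x + c • y)) (Metric.ball 0 ρ)ᶜ (kern N α)) :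
    Integrable (fracIntegrand α w x) ∧
      fracLap α w x = -(1 / 2) * c ^ (-(2 * α)) * ((∫ y in Metric.ball 0 ρ, G y ∂kern N α)
        + 2 * (∫ y in (Metric.ball 0 ρ)ᶜ, w (x + c • y) ∂kern N α)
          - 2 * w x * (kern N α).real (Metric.ball 0 ρ)ᶜ) := by
  have h := integral_secondDiff (g := fun y => w (x + c • y)) hα hρ
    (fun y hy => by simpa [sub_eq_add_neg] using hG y hy) hGi hgi
  simp only [smul_zero, add_zero, smul_neg, ← sub_eq_add_neg] at h
  have hs := integral_comp_smul_kern α hc (fun y => w (x + y) + w (x - y) - 2 * w x)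
  refine ⟨?_, ?_⟩
  · rw [integrable_fracIntegrand_iff]
    exact (integrable_comp_smul_kern_iff α hc (fun y => w (x + y) + w (x - y) - 2 * w x)).1 h.1
  · rw [fracLap_eq_integral_kern, ← h.2, hs, Real.rpow_neg hc.le]
    have : 0 < c ^ (2 * α) := by positivity
    field_simp

/-! ### The half-space profile in `ℝ^N`. -/

section HalfSpace

variable {α τ : ℝ} {n : E N}

/-- Integrating out the `N - 1` tangential variables lowers the exponent `N + 2α` to `1 + 2α`; this
is how the one-dimensional constant `C(τ)` enters. -/
lemma map_inner_kern (hN : 1 ≤ N) (α : ℝ) (hn : ‖n‖ = 1) :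
    (kern N α).map (fun y => inner ℝ n y) =
      sliceConst ((ℝ ∙ n)ᗮ : Submodule ℝ (E N)) ((N : ℝ) + 2 * α) • powMeas ℝ (1 + 2 * α) := by
  rw [kern, map_inner_powMeas _ hn]
  congr 2
  rw [finrank_euclideanSpace_fin, Nat.cast_sub hN]
  push_cast; ring

lemma sliceConst_kern_lt_top (hα : 0 < α) :
    sliceConst ((ℝ ∙ n)ᗮ : Submodule ℝ (E N)) ((N : ℝ) + 2 * α) < ⊤ := by
  refine sliceConst_lt_top ?_
  have h := (ℝ ∙ n : Submodule ℝ (E N)).finrank_add_finrank_orthogonal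
  rw [finrank_euclideanSpace_fin] at h
  have : (Module.finrank ℝ ((ℝ ∙ n)ᗮ : Submodule ℝ (E N)) : ℝ) ≤ N := by exact_mod_cast (by omega)
  linarith

lemma integrable_comp_inner_kern (hN : 1 ≤ N) (hα : 0 < α) (hn : ‖n‖ = 1) {g : ℝ → ℝ}
    (hg : Measurable g) (hi : Integrable g (powMeas ℝ (1 + 2 * α))) :
    Integrable (fun y : E N => g (inner ℝ n y)) (kern N α) := by
  have := (integrable_map_measure (μ := kern N α) (f := fun y : E N => (inner ℝ n y : ℝ)) (g := g)
    hg.aestronglyMeasurable (by fun_prop)).1 (by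
      rw [map_inner_kern hN α hn]
      exact hi.smul_measure (sliceConst_kern_lt_top hα).ne)
  exact this

lemma integral_posPowDiff_inner (hN : 1 ≤ N) (hn : ‖n‖ = 1) :
    ∫ y : E N, posPowDiff τ (inner ℝ n y) ∂kern N α =
      (sliceConst ((ℝ ∙ n)ᗮ : Submodule ℝ (E N)) ((N : ℝ) + 2 * α)).toReal * (2 * Cfun α τ) := by
  rw [← integral_map (φ := fun y : E N => (inner ℝ n y : ℝ)) (f := posPowDiff τ) (by fun_prop)
    (measurable_posPowDiff τ).aestronglyMeasurable, map_inner_kern hN α hn, integral_smul_measure,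
    integral_posPowDiff, smul_eq_mul]

lemma integrable_posPowDiff_inner (hN : 1 ≤ N) (hα : α ∈ Set.Ioo (0 : ℝ) 1)
    (hτ : τ ∈ Set.Ioo (-1 : ℝ) 0) (hn : ‖n‖ = 1) :
    Integrable (fun y : E N => posPowDiff τ (inner ℝ n y)) (kern N α) :=
  integrable_comp_inner_kern hN hα.1 hn (measurable_posPowDiff τ)
    (integrable_posPowDiff hτ.1 hτ.2.le (by linarith [hα.1]) (by linarith [hα.2]))

lemma posPow_one_add_le (h1 : -1 < τ) (h0 : τ ≤ 0) {s : ℝ} (hs : |s| < 1 / 2) :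
    posPow τ (1 + s) ≤ 2 := by
  have hs' := abs_lt.1 hs
  rw [posPow_of_pos (by linarith)]
  calc (1 + s) ^ τ ≤ (1 / 2) ^ τ := Real.rpow_le_rpow_of_nonpos (by norm_num) (by linarith) h0
    _ ≤ (1 / 2) ^ (-1 : ℝ) := Real.rpow_le_rpow_of_exponent_ge (by norm_num) (by norm_num) h1.le
    _ = 2 := by rw [Real.rpow_neg_one]; norm_num

/-- Where `|⟨n,y⟩| < 1/2` the profile is at most `2` and the kernel has finite mass off the ball;
elsewhere slicing reduces to one dimension. -/
lemma integrableOn_posPow_inner (hN : 1 ≤ N) (hα : α ∈ Set.Ioo (0 : ℝ) 1)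
    (hτ : τ ∈ Set.Ioo (-1 : ℝ) 0) (hn : ‖n‖ = 1) {ρ : ℝ} (hρ : 0 < ρ) :
    IntegrableOn (fun y : E N => posPow τ (1 + inner ℝ n y)) (Metric.ball 0 ρ)ᶜ (kern N α) := by
  have hmb : MeasurableSet (Metric.ball (0 : ℝ) (1 / 2))ᶜ := Metric.isOpen_ball.measurableSet.compl
  have hm : Measurable fun s : ℝ => posPow τ (1 + s) := (measurable_posPow τ).comp (by fun_prop)
  have h1 := (integrable_indicator_iff hmb).2
    (integrableOn_posPow_one_add (q := 1 + 2 * α) hτ.1 hτ.2.le (by linarith [hα.1]))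
  have h2 := integrable_comp_inner_kern hN hα.1 hn (hm.indicator hmb) h1
  have h3 : IntegrableOn (fun _ : E N => (2 : ℝ)) (Metric.ball 0 ρ)ᶜ (kern N α) :=
    integrableOn_const (kern_compl_ball_lt_top hα.1 hρ).ne
  refine (h2.integrableOn.add h3).mono' (hm.comp (by fun_prop)).aestronglyMeasurable ?_
  filter_upwards with y
  rw [Real.norm_of_nonneg (posPow_nonneg _ _)]
  simp only [Pi.add_apply]
  by_cases hy : (inner ℝ n y : ℝ) ∈ (Metric.ball (0 : ℝ) (1 / 2))ᶜ
  · rw [Set.indicator_of_mem hy]; linarith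
  · rw [Set.indicator_of_notMem hy, zero_add]
    exact posPow_one_add_le hτ.1 hτ.2.le (by simpa using hy)

/-- The outer part of the half-space integral. -/
def halfOuter (α τ : ℝ) (n : E N) (ρ : ℝ) : ℝ :=
  ∫ y in (Metric.ball 0 ρ)ᶜ, posPow τ (1 + inner ℝ n y) ∂kern N α

/-- The shear argument shrinks the excluded ball by the factor `1 - ε`; this shows that the loss
disappears in the limit. -/
lemma tendsto_halfOuter (hN : 1 ≤ N) (hα : α ∈ Set.Ioo (0 : ℝ) 1)
    (hτ : τ ∈ Set.Ioo (-1 : ℝ) 0) (hn : ‖n‖ = 1) {ρ : ℝ} (hρ : 0 < ρ) :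
    Tendsto (fun ε => halfOuter α τ n ((1 - ε) * ρ)) (𝓝[>] 0) (𝓝 (halfOuter α τ n ρ)) := by
  have hmb : ∀ r, MeasurableSet (Metric.ball (0 : E N) r)ᶜ :=
    fun r => Metric.isOpen_ball.measurableSet.compl
  have hm : Measurable fun y : E N => posPow τ (1 + inner ℝ n y) :=
    (measurable_posPow τ).comp (by fun_prop)
  unfold halfOuter
  simp_rw [← integral_indicator (hmb _)]
  refine tendsto_integral_filter_of_dominated_convergence
    ((Metric.ball 0 (ρ / 2))ᶜ.indicator fun y : E N => posPow τ (1 + inner ℝ n y)) ?_ ?_ ?_ ?_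
  · filter_upwards with ε using (hm.indicator (hmb _)).aestronglyMeasurable
  · filter_upwards [Ioo_mem_nhdsGT (show (0 : ℝ) < 1 / 2 by norm_num)] with ε hε
    filter_upwards with y
    rw [Real.norm_of_nonneg (Set.indicator_nonneg (fun _ _ => posPow_nonneg _ _) _)]
    refine Set.indicator_le_indicator_of_subset (Set.compl_subset_compl.2
      (Metric.ball_subset_ball ?_)) (fun _ => posPow_nonneg _ _) y
    nlinarith [hε.2]
  · exact (integrable_indicator_iff (hmb _)).2
      (integrableOn_posPow_inner hN hα hτ hn (by positivity))
  · filter_upwards with y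
    refine tendsto_const_nhds.congr' ?_
    rcases lt_or_ge ‖y‖ ρ with h | h
    · have ht : Tendsto (fun ε : ℝ => (1 - ε) * ρ) (𝓝[>] 0) (𝓝 ρ) := by
        have : ContinuousAt (fun ε : ℝ => (1 - ε) * ρ) 0 := by fun_prop
        simpa [ContinuousAt] using this.tendsto.mono_left nhdsWithin_le_nhds
      filter_upwards [ht.eventually (lt_mem_nhds h)] with ε hε
      rw [Set.indicator_of_notMem (by simpa using h), Set.indicator_of_notMem (by simpa using hε)]
    · filter_upwards [self_mem_nhdsWithin] with ε hε
      have hε0 : 0 < ε := hε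
      rw [Set.indicator_of_mem (by simpa using h), Set.indicator_of_mem]
      simp only [Set.mem_compl_iff, Metric.mem_ball, dist_zero_right, not_lt]
      nlinarith

lemma integral_posPowDiff_inner_split (hN : 1 ≤ N) (hα : α ∈ Set.Ioo (0 : ℝ) 1)
    (hτ : τ ∈ Set.Ioo (-1 : ℝ) 0) (hn : ‖n‖ = 1) {ρ : ℝ} (hρ : 0 < ρ) :
    ∫ y : E N, posPowDiff τ (inner ℝ n y) ∂kern N α =
      (∫ y in Metric.ball 0 ρ, posPowDiff τ (inner ℝ n y) ∂kern N α) + 2 * halfOuter α τ n ρ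
        - 2 * (kern N α).real (Metric.ball 0 ρ)ᶜ := by
  have h1 : ∀ y : E N, posPow τ (1 + inner ℝ n y) + posPow τ (1 + inner ℝ n (-y))
      - 2 * posPow τ (1 + inner ℝ n (0 : E N)) = posPowDiff τ (inner ℝ n y) := fun y => by
    rw [inner_neg_right, inner_zero_right, add_zero, posPow_of_pos one_pos, Real.one_rpow,
      posPowDiff]
    ring_nf
  have h := (integral_secondDiff (g := fun y : E N => posPow τ (1 + inner ℝ n y)) hα.1 hρ
    (fun y _ => h1 y) (integrable_posPowDiff_inner hN hα hτ hn).integrableOn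
    (integrableOn_posPow_inner hN hα hτ hn hρ)).2
  simp only [h1] at h
  rw [h, inner_zero_right, add_zero, posPow_of_pos one_pos, Real.one_rpow, mul_one]
  rfl

end HalfSpace

/-! ### Uniform control of the far part of the integral. -/

section Tail

variable {α : ℝ} {u : E N → ℝ}

lemma one_add_norm_rpow_le {q r R : ℝ} (hq : 0 < q) (hr : 0 < r) {x y : E N}
    (hx : ‖x‖ ≤ R) (hy : r ≤ ‖y‖) :
    1 + ‖x + y‖ ^ q ≤ (r⁻¹ ^ q + (1 + R / r) ^ q) * ‖y‖ ^ q := by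
  have hy0 : 0 < ‖y‖ := hr.trans_le hy
  have hR : 0 ≤ R := (norm_nonneg x).trans hx
  rw [add_mul, ← Real.mul_rpow (by positivity) hy0.le, ← Real.mul_rpow (by positivity) hy0.le]
  refine add_le_add (Real.one_le_rpow ?_ hq.le) (Real.rpow_le_rpow (by positivity) ?_ hq.le)
  · rw [inv_mul_eq_div, le_div_iff₀ hr]; linarith
  · have : R ≤ R / r * ‖y‖ := by
      rw [div_mul_eq_mul_div, le_div_iff₀ hr]
      gcongr
    linarith [norm_add_le x y]

/-- Far from the pole, the weighted space controls the kernel integral uniformly. -/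
lemma exists_tail_bound (hα : 0 < α) (hu : InWeightedL1 α u) {r : ℝ} (hr : 0 < r) (R : ℝ) :
    ∃ M : ℝ, 0 ≤ M ∧ ∀ x : E N, ‖x‖ ≤ R →
      IntegrableOn (fun y => u (x + y)) (Metric.ball 0 r)ᶜ (kern N α) ∧
      ∫ y in (Metric.ball 0 r)ᶜ, |u (x + y)| ∂kern N α ≤ M := by
  set q : ℝ := (N : ℝ) + 2 * α with hq
  have hq0 : 0 < q := by positivity
  set C : ℝ := r⁻¹ ^ q + (1 + R / r) ^ q with hC
  have hms : MeasurableSet (Metric.ball (0 : E N) r)ᶜ := Metric.isOpen_ball.measurableSet.compl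
  refine ⟨|C| * ∫ y, |u y / (1 + ‖y‖ ^ q)|, by positivity, fun x hx => ?_⟩
  have hi := hu.abs.comp_add_left x
  have hle : ∀ y : E N, (Metric.ball (0 : E N) r)ᶜ.indicator (fun y => |u (x + y)|) y / ‖y‖ ^ q
      ≤ |C| * |u (x + y) / (1 + ‖x + y‖ ^ q)| := by
    intro y
    by_cases hy : y ∈ (Metric.ball (0 : E N) r)ᶜ
    · have hy' : r ≤ ‖y‖ := by simpa using hy
      have hy0 : 0 < ‖y‖ := hr.trans_le hy'
      have h1 := one_add_norm_rpow_le hq0 hr hx hy'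
      have h2 : 0 < 1 + ‖x + y‖ ^ q := by positivity
      rw [Set.indicator_of_mem hy, abs_div, abs_of_pos h2, ← mul_div_assoc,
        div_le_div_iff₀ (by positivity) h2, mul_comm |C|, mul_assoc]
      gcongr
      exact h1.trans (by gcongr; exact le_abs_self _)
    · rw [Set.indicator_of_notMem hy, zero_div]; positivity
  have hmeas : AEStronglyMeasurable u := by
    have h := hu.aestronglyMeasurable.mul (f := fun y => u y / (1 + ‖y‖ ^ q))
      (g := fun y => 1 + ‖y‖ ^ q) (Measurable.aestronglyMeasurable (by fun_prop))
    refine h.congr (ae_of_all _ fun y => ?_)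
    have : 0 < 1 + ‖y‖ ^ q := by positivity
    simp only [Pi.mul_apply]
    field_simp
  have hmeas' : AEStronglyMeasurable (fun y => u (x + y)) volume :=
    hmeas.comp_measurePreserving (measurePreserving_add_left volume x)
  have hI : Integrable fun y : E N =>
      (Metric.ball (0 : E N) r)ᶜ.indicator (fun y => |u (x + y)|) y / ‖y‖ ^ q := by
    refine (hi.const_mul |C|).mono' ?_ (ae_of_all _ fun y => ?_)
    · have h3 : AEStronglyMeasurable (fun y : E N => ‖y‖ ^ q) volume :=
        Measurable.aestronglyMeasurable (by fun_prop)
      exact ((hmeas'.norm.indicator hms).aemeasurable.div h3.aemeasurable).aestronglyMeasurable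
    · rw [Real.norm_of_nonneg (div_nonneg (Set.indicator_nonneg (fun _ _ => abs_nonneg _) _)
        (by positivity))]
      exact hle y
  have hI2 := (integrable_powMeas_iff q _).2 hI
  rw [integrable_indicator_iff hms] at hI2
  refine ⟨?_, ?_⟩
  · refine hI2.mono' ?_ (ae_of_all _ fun y => le_of_eq (Real.norm_eq_abs _))
    exact (hmeas'.mono_ac (powMeas_absolutelyContinuous q)).restrict
  · rw [← integral_indicator hms, integral_powMeas]
    refine (integral_mono hI (hi.const_mul |C|) hle).trans (le_of_eq ?_)
    rw [integral_const_mul, integral_add_left_eq_self (fun y => |u y / (1 + ‖y‖ ^ q)|)]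

end Tail

/-! ### Test functions for viscosity and classical solutions alike. -/

section Touching

variable {α : ℝ} {Ω : Set (E N)} {h : E N → ℝ → ℝ} {g u : E N → ℝ}

lemma glue_of_mem {V : Set (E N)} {φ : E N → ℝ} {x : E N} (hx : x ∈ V) : glue V φ u x = φ x :=
  if_pos hx

lemma glue_of_notMem {V : Set (E N)} {φ : E N → ℝ} {x : E N} (hx : x ∉ V) :
    glue V φ u x = u x := if_neg hx

lemma le_glue {V : Set (E N)} {φ : E N → ℝ} (hle : ∀ z ∈ V, u z ≤ φ z) (z : E N) :
    u z ≤ glue V φ u z := by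
  by_cases hz : z ∈ V
  · rw [glue_of_mem hz]; exact hle z hz
  · rw [glue_of_notMem hz]

lemma glue_le {V : Set (E N)} {φ : E N → ℝ} (hle : ∀ z ∈ V, φ z ≤ u z) (z : E N) :
    glue V φ u z ≤ u z := by
  by_cases hz : z ∈ V
  · rw [glue_of_mem hz]; exact hle z hz
  · rw [glue_of_notMem hz]

lemma fracLap_mono {w v : E N → ℝ} {x : E N} (hx : w x = v x) (hle : ∀ z, w z ≤ v z)
    (hw : Integrable (fracIntegrand α w x)) (hv : Integrable (fracIntegrand α v x)) :
    fracLap α v x ≤ fracLap α w x := by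
  unfold fracLap
  have : ∫ y, fracIntegrand α w x y ≤ ∫ y, fracIntegrand α v x y := by
    refine integral_mono hw hv fun y => ?_
    unfold fracIntegrand
    rw [hx]
    gcongr <;> exact hle _
  linarith

/-- Testing from above, for both notions of solution. -/
lemma fracLap_glue_le (hsol : IsViscositySol α Ω h g u ∨ IsClassicalSol α Ω h g u)
    {x : E N} {ρ : ℝ} (hρ : 0 < ρ) (hball : Metric.closedBall x ρ ⊆ Ω) {φ : E N → ℝ}
    (hφ : ContDiffOn ℝ 2 φ (Metric.closedBall x ρ)) (hx : u x = φ x)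
    (hle : ∀ z ∈ Metric.ball x ρ, u z ≤ φ z)
    (hint : Integrable (fracIntegrand α (glue (Metric.ball x ρ) φ u) x)) :
    fracLap α (glue (Metric.ball x ρ) φ u) x ≤ h x (u x) := by
  have hxΩ : x ∈ Ω := hball (Metric.mem_closedBall_self hρ.le)
  rcases hsol with hv | hc
  · exact hv.2.2.2.2 x hxΩ _ Metric.isOpen_ball (Metric.mem_ball_self hρ)
      (by rwa [closure_ball x hρ.ne']) φ (by rwa [closure_ball x hρ.ne']) hx hle
  -- In the classical case the glued function lies above `u` and agrees with it at `x`, so its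
  -- fractional Laplacian there is the smaller one.
  · rw [← (hc.2.2.2 x hxΩ).2]
    refine fracLap_mono ?_ (le_glue hle) (hc.2.2.2 x hxΩ).1 hint
    rw [glue_of_mem (Metric.mem_ball_self hρ), hx]

/-- Testing from below, for both notions of solution. -/
lemma le_fracLap_glue (hsol : IsViscositySol α Ω h g u ∨ IsClassicalSol α Ω h g u)
    {x : E N} {ρ : ℝ} (hρ : 0 < ρ) (hball : Metric.closedBall x ρ ⊆ Ω) {φ : E N → ℝ}
    (hφ : ContDiffOn ℝ 2 φ (Metric.closedBall x ρ)) (hx : u x = φ x)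
    (hle : ∀ z ∈ Metric.ball x ρ, φ z ≤ u z)
    (hint : Integrable (fracIntegrand α (glue (Metric.ball x ρ) φ u) x)) :
    h x (u x) ≤ fracLap α (glue (Metric.ball x ρ) φ u) x := by
  have hxΩ : x ∈ Ω := hball (Metric.mem_closedBall_self hρ.le)
  rcases hsol with hv | hc
  · exact hv.1.2.2.2 x hxΩ _ Metric.isOpen_ball (Metric.mem_ball_self hρ)
      (by rwa [closure_ball x hρ.ne']) φ (by rwa [closure_ball x hρ.ne']) hx hle
  · rw [← (hc.2.2.2 x hxΩ).2]
    refine fracLap_mono ?_ (glue_le hle) hint (hc.2.2.2 x hxΩ).1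
    rw [glue_of_mem (Metric.mem_ball_self hρ), hx]

lemma sol_continuousOn (hsol : IsViscositySol α Ω h g u ∨ IsClassicalSol α Ω h g u) :
    ContinuousOn u Ω := hsol.elim (fun hv => hv.1.1) fun hc => hc.1

lemma sol_inWeightedL1 (hsol : IsViscositySol α Ω h g u ∨ IsClassicalSol α Ω h g u) :
    InWeightedL1 α u := hsol.elim (fun hv => hv.1.2.1) fun hc => hc.2.1

lemma sol_exterior (hsol : IsViscositySol α Ω h g u ∨ IsClassicalSol α Ω h g u) :
    ∀ᵐ x, x ∈ (closure Ω)ᶜ → u x = g x :=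
  hsol.elim (fun hv => ae_of_all _ fun x hx => le_antisymm (hv.2.2.2.1 x hx) (hv.1.2.2.1 x hx))
    fun hc => hc.2.2.1

end Touching

/-! ### Volume-preserving shears. -/

section Shear

/-- A shear in the direction `b` preserves the volume. -/
lemma lintegral_shear {e : E N → ℝ} {b : E N} (he : Differentiable ℝ e)
    (hb : ∀ (z : E N) (a : ℝ), e (z + a • b) = e z) {A : Set (E N)} (hA : MeasurableSet A)
    (g : E N → ENNReal) :
    ∫⁻ z in A, g (z + e z • b) = ∫⁻ z in (fun z => z + e z • b) '' A, g z := by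
  have hder : ∀ z, HasFDerivAt (fun z => z + e z • b)
      (ContinuousLinearMap.id ℝ (E N) + (fderiv ℝ e z).smulRight b) z := fun z =>
    (hasFDerivAt_id z).add ((he z).hasFDerivAt.smul_const b)
  -- Since `e` is constant along `b`, its derivative annihilates `b`; the Jacobian matrix is thus a
  -- transvection, of determinant `1`.
  have hz : ∀ z, fderiv ℝ e z b = 0 := fun z => by
    have h1 : HasDerivAt (fun a : ℝ => e (z + a • b)) (fderiv ℝ e z b) 0 := by
      have h2 : HasDerivAt (fun a : ℝ => z + a • b) b 0 := by
        simpa using ((hasDerivAt_id (0 : ℝ)).smul_const b).const_add z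
      have h3 : HasFDerivAt e (fderiv ℝ e z) (z + (0 : ℝ) • b) := by simpa using (he z).hasFDerivAt
      exact h3.comp_hasDerivAt 0 h2
    simp_rw [hb z] at h1
    exact h1.unique (hasDerivAt_const 0 (e z))
  have hinj : Function.Injective fun z => z + e z • b := fun z w hzw => by
    have hzw' : z + e z • b = w + e w • b := hzw
    have h1 : z = w + (e w - e z) • b := by
      rw [sub_smul, ← add_sub_assoc, ← hzw', add_sub_cancel_right]
    have h2 : e z = e w := by rw [h1, hb]
    rw [h1, h2]; simp
  rw [lintegral_image_eq_lintegral_abs_det_fderiv_mul volume hA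
    (fun z _ => (hder z).hasFDerivWithinAt) hinj.injOn]
  refine lintegral_congr fun z => ?_
  have hdet : (ContinuousLinearMap.id ℝ (E N) + (fderiv ℝ e z).smulRight b).det = 1 := by
    have := LinearMap.transvection.det (fderiv ℝ e z : E N →ₗ[ℝ] ℝ) b
    rw [ContinuousLinearMap.coe_coe, hz, add_zero] at this
    rw [ContinuousLinearMap.det, ← this]
    congr 1
  rw [hdet]
  simp

end Shear

/-! ### Defining functions of the boundary and the distance to it. -/

section Chart

variable {Ω : Set (E N)}

/-- A `C¹` defining function of `Ω` near a boundary point, with unit normal `n`, strictly affine in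
the direction `b`. -/
structure Chart (Ω : Set (E N)) (x₀ : E N) where
  D : E N → ℝ
  b : E N
  n : E N
  r : ℝ
  norm_n : ‖n‖ = 1
  diff : Differentiable ℝ D
  translate : ∀ (z : E N) (a : ℝ), D (z + a • b) = D z + a
  inner_b : inner ℝ n b = 1
  r_pos : 0 < r
  mem_iff : ∀ z ∈ Metric.ball x₀ r, z ∈ Ω ↔ 0 < D z
  strict : HasStrictFDerivAt D (innerSL ℝ n) x₀

lemma exists_chart (hC2 : IsC2Domain Ω) {x₀ : E N} (hx₀ : x₀ ∈ frontier Ω) :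
    Nonempty (Chart Ω x₀) := by
  obtain ⟨ν, φ, r, hν, hφ, hr, hmem⟩ := hC2 x₀ hx₀
  set s : E N → ℝ := fun x => inner ℝ ν x - φ (x - (inner ℝ ν x : ℝ) • ν) with hs
  have hsC : ContDiff ℝ 2 s := by
    have : ContDiff ℝ 2 fun x : E N => (inner ℝ ν x : ℝ) := contDiff_const.inner ℝ contDiff_id
    exact this.sub (hφ.comp (contDiff_id.sub (this.smul contDiff_const)))
  have htr : ∀ (z : E N) (a : ℝ), s (z + a • ν) = s z + a := fun z a => by
    have h1 : (inner ℝ ν (z + a • ν) : ℝ) = inner ℝ ν z + a := by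
      rw [inner_add_right, inner_smul_right, real_inner_self_eq_norm_sq, hν]; ring
    have h2 : z + a • ν - (inner ℝ ν z + a : ℝ) • ν = z - (inner ℝ ν z : ℝ) • ν := by
      rw [add_smul]; abel
    simp only [hs, h1, h2]; ring
  have hstrict : HasStrictFDerivAt s (fderiv ℝ s x₀) x₀ :=
    hsC.contDiffAt.hasStrictFDerivAt (by norm_num)
  set m' : E N := (InnerProductSpace.toDual ℝ (E N)).symm (fderiv ℝ s x₀) with hm'
  have hinner : ∀ y, inner ℝ m' y = fderiv ℝ s x₀ y := fun y => by
    rw [hm', InnerProductSpace.toDual_symm_apply]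
  have hone : fderiv ℝ s x₀ ν = 1 := by
    have h1 : HasDerivAt (fun a : ℝ => s (x₀ + a • ν)) (fderiv ℝ s x₀ ν) 0 := by
      have h2 : HasDerivAt (fun a : ℝ => x₀ + a • ν) ν 0 := by
        simpa using ((hasDerivAt_id (0 : ℝ)).smul_const ν).const_add x₀
      have h3 : HasFDerivAt s (fderiv ℝ s x₀) (x₀ + (0 : ℝ) • ν) := by
        simpa using hstrict.hasFDerivAt
      exact h3.comp_hasDerivAt 0 h2
    simp_rw [htr x₀] at h1
    exact h1.unique ((hasDerivAt_id (0 : ℝ)).const_add (s x₀))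
  have hm0 : m' ≠ 0 := fun h0 => by
    have := hinner ν
    rw [hone, h0, inner_zero_left] at this
    norm_num at this
  set m := ‖m'‖ with hm
  have hmpos : 0 < m := norm_pos_iff.2 hm0
  exact ⟨{
    D := fun z => m⁻¹ * s z
    b := m • ν
    n := m⁻¹ • m'
    r := r
    norm_n := by rw [norm_smul, norm_inv, Real.norm_of_nonneg hmpos.le, inv_mul_cancel₀ hmpos.ne']
    diff := (hsC.differentiable (by norm_num)).const_mul _
    translate := fun z a => by
      rw [smul_smul, htr]
      field_simp
    inner_b := by
      rw [inner_smul_left, inner_smul_right, hinner, hone]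
      simp [hmpos.ne']
    r_pos := hr
    mem_iff := fun z hz => by
      rw [hmem z hz, mul_pos_iff_of_pos_left (inv_pos.2 hmpos)]
      simp only [hs, sub_pos]
    strict := by
      have h := hstrict.const_mul m⁻¹
      have e : innerSL ℝ (m⁻¹ • m') = m⁻¹ • fderiv ℝ s x₀ := by
        ext y
        rw [innerSL_apply_apply, inner_smul_left, hinner]
        simp
      rw [e]
      exact h }⟩

namespace Chart

variable {x₀ : E N} (c : Chart Ω x₀)

lemma D_center (hΩ : IsOpen Ω) (hx₀ : x₀ ∈ frontier Ω) : c.D x₀ = 0 := by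
  refine le_antisymm (not_lt.1 fun h => ?_) (not_lt.1 fun h => ?_)
  · have := (c.mem_iff x₀ (Metric.mem_ball_self c.r_pos)).2 h
    rw [hΩ.frontier_eq] at hx₀
    exact hx₀.2 this
  · have hn : {z | c.D z < 0} ∩ Metric.ball x₀ c.r ∈ 𝓝 x₀ := inter_mem
      ((isOpen_lt c.diff.continuous continuous_const).mem_nhds h) (Metric.ball_mem_nhds _ c.r_pos)
    obtain ⟨z, hz, hzΩ⟩ := mem_closure_iff_nhds.1 hx₀.1 _ hn
    exact lt_asymm hz.1 ((c.mem_iff z hz.2).1 hzΩ)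

lemma D_frontier (hΩ : IsOpen Ω) {z : E N} (hz : z ∈ frontier Ω) (hzr : z ∈ Metric.ball x₀ c.r) :
    c.D z = 0 := by
  refine le_antisymm (not_lt.1 fun h => ?_) (not_lt.1 fun h => ?_)
  · have := (c.mem_iff z hzr).2 h
    rw [hΩ.frontier_eq] at hz
    exact hz.2 this
  · have hn : {z | c.D z < 0} ∩ Metric.ball x₀ c.r ∈ 𝓝 z := inter_mem
      ((isOpen_lt c.diff.continuous continuous_const).mem_nhds h) (Metric.isOpen_ball.mem_nhds hzr)
    obtain ⟨w, hw, hwΩ⟩ := mem_closure_iff_nhds.1 hz.1 _ hn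
    exact lt_asymm hw.1 ((c.mem_iff w hw.2).1 hwΩ)

/-- The shear by `D - ⟨n,·⟩` along `b` carries the level set into the hyperplane `⟨n,·⟩ = 0` without
changing its volume. -/
lemma volume_D_eq_zero : volume {z : E N | c.D z = 0} = 0 := by
  have he : Differentiable ℝ fun z => c.D z - inner ℝ c.n z :=
    c.diff.sub ((differentiable_const c.n).inner ℝ differentiable_id)
  have hb : ∀ (z : E N) (a : ℝ), c.D (z + a • c.b) - inner ℝ c.n (z + a • c.b)
      = c.D z - inner ℝ c.n z := fun z a => by
    rw [c.translate, inner_add_right, inner_smul_right, c.inner_b]; ring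
  have hA : MeasurableSet {z : E N | c.D z = 0} :=
    (isClosed_eq c.diff.continuous continuous_const).measurableSet
  have h := lintegral_shear he hb hA fun _ => 1
  rw [setLIntegral_one, setLIntegral_one] at h
  rw [h]
  refine measure_mono_null (t := ((innerSL ℝ c.n).toLinearMap.ker : Set (E N))) ?_ ?_
  · rintro _ ⟨z, hz, rfl⟩
    have hz' : c.D z = 0 := hz
    simp [inner_add_right, inner_smul_right, c.inner_b, hz']
  · refine Measure.addHaar_submodule _ _ fun htop => ?_
    have : c.b ∈ (innerSL ℝ c.n).toLinearMap.ker := htop ▸ Submodule.mem_top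
    simp [c.inner_b] at this

lemma exists_almost_affine {κ : ℝ} (hκ : 0 < κ) :
    ∃ r, 0 < r ∧ r ≤ c.r ∧ ∀ z ∈ Metric.ball x₀ r, ∀ w ∈ Metric.ball x₀ r,
      |c.D z - c.D w - inner ℝ c.n (z - w)| ≤ κ * ‖z - w‖ := by
  have h := (hasStrictFDerivAt_iff_isLittleO.1 c.strict).def hκ
  rw [nhds_prod_eq] at h
  obtain ⟨t, ht, h⟩ := Filter.mem_prod_self_iff.1 h
  obtain ⟨r, hr, hrt⟩ := Metric.mem_nhds_iff.1 ht
  refine ⟨min r c.r, lt_min hr c.r_pos, min_le_right _ _, fun z hz w hw => ?_⟩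
  have := h (Set.mk_mem_prod (hrt (Metric.ball_subset_ball (min_le_left _ _) hz))
    (hrt (Metric.ball_subset_ball (min_le_left _ _) hw)))
  simpa using this



end Chart

lemma volume_frontier_eq_zero (hΩ : IsOpen Ω) (hC2 : IsC2Domain Ω) : volume (frontier Ω) = 0 := by
  refine measure_null_of_locally_null _ fun x hx => ?_
  obtain ⟨c⟩ := exists_chart hC2 hx
  refine ⟨Metric.ball x c.r ∩ frontier Ω, inter_mem
    (mem_nhdsWithin_of_mem_nhds (Metric.ball_mem_nhds x c.r_pos)) self_mem_nhdsWithin, ?_⟩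
  exact measure_mono_null (fun z hz => c.D_frontier hΩ hz.2 hz.1) c.volume_D_eq_zero

lemma bdist_nonneg (x : E N) : 0 ≤ bdist Ω x := Metric.infDist_nonneg

lemma bdist_pos (hΩ : IsOpen Ω) (hne : (frontier Ω).Nonempty) {x : E N} (hx : x ∈ Ω) :
    0 < bdist Ω x := by
  refine (isClosed_frontier.notMem_iff_infDist_pos hne).1 fun h => ?_
  rw [hΩ.frontier_eq] at h
  exact h.2 hx

lemma bdist_le_dist {x y : E N} (hx : x ∈ Ω) (hy : y ∉ Ω) : bdist Ω x ≤ dist x y := by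
  obtain ⟨w, hw, h⟩ := exists_mem_frontier_infDist_compl_eq_dist hx
    (fun h => hy (h ▸ Set.mem_univ y))
  calc bdist Ω x ≤ dist x w := Metric.infDist_le_dist_of_mem hw
    _ = Metric.infDist x Ωᶜ := h.symm
    _ ≤ dist x y := Metric.infDist_le_dist_of_mem hy

lemma ball_bdist_subset {x : E N} (hx : x ∈ Ω) : Metric.ball x (bdist Ω x) ⊆ Ω := fun y hy => by
  by_contra h
  have := bdist_le_dist hx h
  rw [Metric.mem_ball, dist_comm] at hy
  linarith

lemma bdist_le_add (x y : E N) : bdist Ω x ≤ bdist Ω y + dist x y :=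
  Metric.infDist_le_infDist_add_dist

lemma frontier_nonempty [Nonempty (Fin N)] (hb : Bornology.IsBounded Ω) (hne : Ω.Nonempty) :
    (frontier Ω).Nonempty := by
  refine nonempty_frontier_iff.2 ⟨hne, fun h => ?_⟩
  rw [h] at hb
  exact NormedSpace.unbounded_univ ℝ (E N) hb

/-- Near a boundary point the defining function is almost affine and almost the distance. -/
lemma Chart.exists_radius (hΩ : IsOpen Ω) {x₀ : E N} (hx₀ : x₀ ∈ frontier Ω)
    (c : Chart Ω x₀) {κ : ℝ} (hκ : 0 < κ) (hκ2 : κ ≤ 1 / 2) :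
    ∃ r, 0 < r ∧ (∀ z ∈ Metric.ball x₀ r, z ∈ Ω ↔ 0 < c.D z) ∧
      (∀ z ∈ Metric.ball x₀ r, ∀ w ∈ Metric.ball x₀ r,
        |c.D z - c.D w - inner ℝ c.n (z - w)| ≤ κ * ‖z - w‖) ∧
      ∀ z ∈ Metric.ball x₀ r, z ∈ Ω →
        (1 - κ) * bdist Ω z ≤ c.D z ∧ c.D z ≤ (1 + κ) * bdist Ω z := by
  obtain ⟨r, hr, hrc, haff⟩ := c.exists_almost_affine hκ
  have hsub : Metric.ball x₀ (r / 8) ⊆ Metric.ball x₀ r := Metric.ball_subset_ball (by linarith)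
  refine ⟨r / 8, by positivity, fun z hz => c.mem_iff z (Metric.ball_subset_ball hrc (hsub hz)),
    fun z hz w hw => haff z (hsub hz) w (hsub hw), fun z hz hzΩ => ?_⟩
  have hD0 := c.D_center hΩ hx₀
  have hzx : dist z x₀ < r / 8 := hz
  have hcs : ∀ v : E N, |(inner ℝ c.n v : ℝ)| ≤ ‖v‖ := fun v => by
    simpa [c.norm_n] using abs_real_inner_le_norm c.n v
  constructor
  · have hDz : c.D z ≤ (1 + κ) * (r / 8) := by
      have h1 := haff z (hsub hz) x₀ (Metric.mem_ball_self hr)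
      rw [hD0, sub_zero, ← dist_eq_norm] at h1
      have h2 := hcs (z - x₀)
      rw [← dist_eq_norm] at h2
      have := (abs_le.1 h1).2
      have := (abs_le.1 h2).2
      nlinarith
    have hDpos : 0 < c.D z := (c.mem_iff z (Metric.ball_subset_ball hrc (hsub hz))).1 hzΩ
    -- The step `a` is such that moving from `z` by `-a n` lowers `D` by at least `(1 - κ) a = D z`.
    -- The endpoint is therefore not in `Ω`, and `bdist Ω z ≤ a`.
    set a := c.D z / (1 - κ) with ha
    have h1κ : 0 < 1 - κ := by linarith
    have ha0 : 0 < a := div_pos hDpos h1κ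
    have haD : (1 - κ) * a = c.D z := by rw [ha]; field_simp
    have har : a ≤ 3 * (r / 8) := by nlinarith
    have hnorm : ‖a • c.n‖ = a := by rw [norm_smul, c.norm_n, Real.norm_of_nonneg ha0.le, mul_one]
    have hdist : dist z (z - a • c.n) = a := by rw [dist_eq_norm, sub_sub_cancel, hnorm]
    have hwr : z - a • c.n ∈ Metric.ball x₀ r := by
      rw [Metric.mem_ball]
      have := dist_triangle_left (z - a • c.n) x₀ z
      linarith
    have h1 := haff z (hsub hz) _ hwr
    rw [sub_sub_cancel, inner_smul_right, real_inner_self_eq_norm_sq, c.norm_n, hnorm] at h1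
    have hw : z - a • c.n ∉ Ω := fun hmem => by
      have := (c.mem_iff _ (Metric.ball_subset_ball hrc hwr)).1 hmem
      have := (abs_le.1 h1).1
      nlinarith
    have h2 := bdist_le_dist hzΩ hw
    rw [hdist] at h2
    rw [← haD]
    gcongr
  -- For the other bound compare `z` with a nearest boundary point, where `D` vanishes.
  · obtain ⟨p, hp, hpd⟩ := isClosed_frontier.exists_infDist_eq_dist ⟨x₀, hx₀⟩ z
    have hd : bdist Ω z = dist z p := hpd
    have hle : dist z p ≤ dist z x₀ := by rw [← hd]; exact Metric.infDist_le_dist_of_mem hx₀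
    have hpr : p ∈ Metric.ball x₀ r := by
      rw [Metric.mem_ball]
      have := dist_triangle_left p x₀ z
      linarith
    have h1 := haff z (hsub hz) p hpr
    rw [c.D_frontier hΩ hp (Metric.ball_subset_ball hrc hpr), sub_zero, ← dist_eq_norm] at h1
    have h2 := hcs (z - p)
    rw [← dist_eq_norm] at h2
    rw [hd]
    linarith [(abs_le.1 h1).2, (abs_le.1 h2).2]

end Chart

/-! ### Boundary rates as two-sided bounds. -/

section Rate

variable {Ω : Set (E N)}

lemma eventually_toBoundary_iff {P : E N → Prop} :
    (∀ᶠ x in toBoundary Ω, P x) ↔ ∃ δ > 0, ∀ x ∈ Ω, bdist Ω x < δ → P x := by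
  unfold toBoundary
  rw [eventually_inf_principal, eventually_comap]
  constructor
  · intro h
    obtain ⟨δ, hδ, h⟩ := Metric.eventually_nhds_iff.1 h
    refine ⟨δ, hδ, fun x hx hd => h (y := bdist Ω x) ?_ x rfl hx⟩
    rwa [Real.dist_eq, sub_zero, abs_of_nonneg (bdist_nonneg x)]
  · rintro ⟨δ, hδ, h⟩
    refine Metric.eventually_nhds_iff.2 ⟨δ, hδ, fun y hy x hxy hx => h x hx ?_⟩
    rw [hxy]
    rw [Real.dist_eq, sub_zero] at hy
    exact (le_abs_self y).trans_lt hy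

lemma HasBoundaryRate.exists_bounds (hΩ : IsOpen Ω) (hne : (frontier Ω).Nonempty) {u : E N → ℝ}
    {τ : ℝ} (h : HasBoundaryRate Ω u τ) :
    ∃ c C δ : ℝ, 0 < c ∧ 0 < C ∧ 0 < δ ∧ ∀ x ∈ Ω, bdist Ω x < δ →
      c * bdist Ω x ^ τ ≤ u x ∧ u x ≤ C * bdist Ω x ^ τ := by
  obtain ⟨c, hc0, hc⟩ := EReal.lt_iff_exists_real_btwn.1 h.1
  obtain ⟨C, hC, -⟩ := EReal.lt_iff_exists_real_btwn.1 h.2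
  have h1 := eventually_lt_of_lt_liminf hc
  have h2 := eventually_lt_of_limsup_lt hC
  obtain ⟨δ, hδ, hd⟩ := eventually_toBoundary_iff.1 (h1.and h2)
  refine ⟨c, max C 1, δ, by exact_mod_cast hc0, by positivity, hδ, fun x hx hxd => ?_⟩
  obtain ⟨h3, h4⟩ := hd x hx hxd
  have hb := bdist_pos hΩ hne hx
  have h3' : c < u x * bdist Ω x ^ (-τ) := by exact_mod_cast h3
  have h4' : u x * bdist Ω x ^ (-τ) < C := by exact_mod_cast h4
  have hbτ := Real.rpow_pos_of_pos hb τ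
  rw [Real.rpow_neg hb.le, ← div_eq_mul_inv] at h3' h4'
  rw [lt_div_iff₀ hbτ] at h3'
  rw [div_lt_iff₀ hbτ] at h4'
  exact ⟨h3'.le, h4'.le.trans (by gcongr; exact le_max_left _ _)⟩

lemma exists_bdist_lt (hne : (frontier Ω).Nonempty) {δ : ℝ} (hδ : 0 < δ) :
    ∃ x ∈ Ω, bdist Ω x < δ := by
  obtain ⟨p, hp⟩ := hne
  obtain ⟨x, hx, hd⟩ := Metric.mem_closure_iff.1 hp.1 δ hδ
  exact ⟨x, hx, (Metric.infDist_le_dist_of_mem hp).trans_lt (by rwa [dist_comm])⟩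

end Rate

/-! ### Integrals over complements of small balls. -/

section Outer

variable {α : ℝ}

lemma preimage_smul_compl_ball {c ρ : ℝ} (hc : 0 < c) :
    (fun y : E N => c • y) ⁻¹' (Metric.ball 0 (c * ρ))ᶜ = (Metric.ball 0 ρ)ᶜ := by
  ext y
  simp [norm_smul, abs_of_pos hc, hc]

lemma integrableOn_comp_smul_kern {c ρ : ℝ} (hc : 0 < c) {f : E N → ℝ}
    (hf : IntegrableOn f (Metric.ball 0 (c * ρ))ᶜ (kern N α)) :
    IntegrableOn (fun y => f (c • y)) (Metric.ball 0 ρ)ᶜ (kern N α) := by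
  have hms : ∀ r, MeasurableSet (Metric.ball (0 : E N) r)ᶜ :=
    fun r => Metric.isOpen_ball.measurableSet.compl
  rw [← integrable_indicator_iff (hms _)] at hf ⊢
  have := (integrable_comp_smul_kern_iff α hc _).2 hf
  refine this.congr (ae_of_all _ fun y => ?_)
  rw [← preimage_smul_compl_ball (ρ := ρ) hc]
  rfl

lemma setIntegral_comp_smul_kern {c ρ : ℝ} (hc : 0 < c) (f : E N → ℝ) :
    ∫ y in (Metric.ball 0 ρ)ᶜ, f (c • y) ∂kern N α =
      c ^ (2 * α) * ∫ y in (Metric.ball 0 (c * ρ))ᶜ, f y ∂kern N α := by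
  have hms : ∀ r, MeasurableSet (Metric.ball (0 : E N) r)ᶜ :=
    fun r => Metric.isOpen_ball.measurableSet.compl
  rw [← integral_indicator (hms _), ← integral_indicator (hms _), ← integral_comp_smul_kern α hc]
  congr 1
  ext y
  rw [← preimage_smul_compl_ball (ρ := ρ) hc]
  rfl

lemma ae_kern_add {P : E N → Prop} (h : ∀ᵐ z, P z) (x : E N) : ∀ᵐ y ∂kern N α, P (x + y) :=
  (powMeas_absolutelyContinuous _).ae_le
    ((measurePreserving_add_left volume x).quasiMeasurePreserving.ae h)

lemma neg_tail_le_setIntegral {ρ r : ℝ} {f : E N → ℝ}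
    (hf : IntegrableOn f (Metric.ball 0 ρ)ᶜ (kern N α))
    (hfr : IntegrableOn f (Metric.ball 0 r)ᶜ (kern N α))
    (hpos : ∀ᵐ y ∂kern N α, ‖y‖ < r → 0 ≤ f y) :
    -∫ y in (Metric.ball 0 r)ᶜ, |f y| ∂kern N α ≤ ∫ y in (Metric.ball 0 ρ)ᶜ, f y ∂kern N α := by
  have hms : ∀ r, MeasurableSet (Metric.ball (0 : E N) r)ᶜ :=
    fun r => Metric.isOpen_ball.measurableSet.compl
  rw [← integral_neg, ← integral_indicator (hms _), ← integral_indicator (hms _)]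
  refine integral_mono_ae ((integrable_indicator_iff (hms _)).2 hfr.abs.neg)
    ((integrable_indicator_iff (hms _)).2 hf) ?_
  filter_upwards [hpos] with y hy
  by_cases h1 : y ∈ (Metric.ball (0 : E N) r)ᶜ <;> by_cases h2 : y ∈ (Metric.ball (0 : E N) ρ)ᶜ
  · rw [Set.indicator_of_mem h1, Set.indicator_of_mem h2]; exact neg_abs_le _
  · rw [Set.indicator_of_mem h1, Set.indicator_of_notMem h2]; simp
  · rw [Set.indicator_of_notMem h1, Set.indicator_of_mem h2]; exact hy (by simpa using h1)
  · rw [Set.indicator_of_notMem h1, Set.indicator_of_notMem h2]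

end Outer

/-! ### Testing from below. -/

/-- The values of `u` on `∂Ω` are arbitrary; they do not matter because `∂Ω` is a null set. -/
lemma ae_mem_or_eq_zero {α : ℝ} {Ω : Set (E N)} {h : E N → ℝ → ℝ} {u : E N → ℝ}
    (hΩ : IsOpen Ω) (hC2 : IsC2Domain Ω)
    (hsol : IsViscositySol α Ω h (fun _ => 0) u ∨ IsClassicalSol α Ω h (fun _ => 0) u) :
    ∀ᵐ z, z ∈ Ω ∨ (z ∉ Ω ∧ u z = 0) := by
  filter_upwards [sol_exterior hsol, compl_mem_ae_iff.2 (volume_frontier_eq_zero hΩ hC2)]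
    with z hz hzf
  by_cases hzΩ : z ∈ Ω
  · exact Or.inl hzΩ
  · refine Or.inr ⟨hzΩ, hz fun hzc => hzf ?_⟩
    rw [hΩ.frontier_eq]
    exact ⟨hzc, hzΩ⟩

lemma rpow_le_of_div_two_le {τ l d : ℝ} (hτ : τ ∈ Set.Ioo (-1 : ℝ) 0) (hl : 0 < l)
    (hd : l / 2 ≤ d) : d ^ τ ≤ 2 * l ^ τ := by
  calc d ^ τ ≤ (l / 2) ^ τ := Real.rpow_le_rpow_of_nonpos (by positivity) hd hτ.2.le
    _ = (1 / 2) ^ τ * l ^ τ := by rw [← Real.mul_rpow (by norm_num) hl.le]; ring_nf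
    _ ≤ 2 * l ^ τ := by
      gcongr
      calc ((1 : ℝ) / 2) ^ τ ≤ (1 / 2) ^ (-1 : ℝ) :=
            Real.rpow_le_rpow_of_exponent_ge (by norm_num) (by norm_num) hτ.1.le
        _ = 2 := by rw [Real.rpow_neg_one]; norm_num

lemma norm_add_sq_add_norm_sub_sq (a y : E N) :
    ‖a + y‖ ^ 2 + ‖a - y‖ ^ 2 = 2 * ‖a‖ ^ 2 + 2 * ‖y‖ ^ 2 := by
  rw [norm_add_sq_real, norm_sub_sq_real]; ring

/-- Testing from below with a paraboloid near every point close to the boundary. -/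
lemma exists_test_below {α τ : ℝ} (hN : 1 ≤ N) (hα : α ∈ Set.Ioo (0 : ℝ) 1)
    (hτ : τ ∈ Set.Ioo (-1 : ℝ) 0) {Ω : Set (E N)} (hΩ : IsOpen Ω) (hb : Bornology.IsBounded Ω)
    (hC2 : IsC2Domain Ω) (hne : (frontier Ω).Nonempty) {h : E N → ℝ → ℝ} {u : E N → ℝ}
    (hsol : IsViscositySol α Ω h (fun _ => 0) u ∨ IsClassicalSol α Ω h (fun _ => 0) u)
    {c C δ : ℝ} (hc : 0 < c) (hC : 0 < C) (hδ : 0 < δ)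
    (hu : ∀ x ∈ Ω, bdist Ω x < δ → c * bdist Ω x ^ τ ≤ u x ∧ u x ≤ C * bdist Ω x ^ τ) :
    ∃ K δ' : ℝ, 0 < δ' ∧ ∀ x ∈ Ω, bdist Ω x < δ' → ∃ z ∈ Ω,
      bdist Ω x / 2 ≤ bdist Ω z ∧ bdist Ω z ≤ 2 * bdist Ω x ∧
      h z (u z) ≤ K * bdist Ω x ^ (τ - 2 * α) := by
  obtain ⟨R, hR⟩ := hb.exists_norm_le
  have hα0 := hα.1
  obtain ⟨M, hM0, hM⟩ := exists_tail_bound hα0 (sol_inWeightedL1 hsol) (half_pos hδ) R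
  set Q := ∫ y in Metric.ball (0 : E N) (1 / 4), ‖y‖ ^ 2 ∂kern N α with hQ
  set B := (kern N α).real (Metric.ball (0 : E N) (1 / 4))ᶜ with hB
  have hB0 : 0 ≤ B := measureReal_nonneg
  -- The `16` compensates `(1/4)²`: `K/16 = C + 1` exceeds the constant in the upper bound for `u`,
  -- which keeps the minimizer below within `l/4` of `x`.
  set K := 16 * C + 16 with hK
  have hK0 : 0 < K := by positivity
  refine ⟨K * Q + M + 2 * C * B, min 1 (δ / 4), lt_min one_pos (by linarith), fun x hx hxd => ?_⟩
  set l := bdist Ω x with hl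
  have hl0 : 0 < l := bdist_pos hΩ hne hx
  have hl1 : l < 1 := hxd.trans_le (min_le_left _ _)
  have hlδ : l < δ / 4 := hxd.trans_le (min_le_right _ _)
  have hlτ : 0 < l ^ τ := by positivity
  have hdist : ∀ z ∈ Metric.closedBall x (l / 2), z ∈ Ω ∧ l / 2 ≤ bdist Ω z ∧
      bdist Ω z ≤ 2 * l := fun z hz => by
    have hz' : dist z x ≤ l / 2 := hz
    refine ⟨ball_bdist_subset hx (Metric.closedBall_subset_ball (by linarith) hz), ?_, ?_⟩
    · have := bdist_le_add (Ω := Ω) x z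
      rw [dist_comm] at this
      linarith
    · have := bdist_le_add (Ω := Ω) z x
      linarith
  have hcont : ContinuousOn (fun z => u z + K * l ^ (τ - 2) * ‖z - x‖ ^ 2)
      (Metric.closedBall x (l / 2)) :=
    ((sol_continuousOn hsol).mono fun z hz => (hdist z hz).1).add (by fun_prop)
  -- A merely continuous `u` need not be touched from below at `x` itself; minimizing `u` plus a
  -- paraboloid yields a nearby point where it is.
  obtain ⟨z, hz, hmin⟩ := (isCompact_closedBall x (l / 2)).exists_isMinOn
    ⟨x, Metric.mem_closedBall_self (by positivity)⟩ hcont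
  obtain ⟨hzΩ, hzd1, hzd2⟩ := hdist z hz
  have hl2 : l ^ (τ - 2) * l ^ 2 = l ^ τ := by
    rw [← Real.rpow_natCast l 2, ← Real.rpow_add hl0]; norm_num
  have huz := hu z hzΩ (by linarith)
  have hzx : dist z x < l / 4 := by
    by_contra hcon
    rw [not_lt] at hcon
    have h1 : u z + K * l ^ (τ - 2) * ‖z - x‖ ^ 2 ≤ u x + K * l ^ (τ - 2) * ‖x - x‖ ^ 2 :=
      hmin (Metric.mem_closedBall_self (by positivity))
    have h2 := (hu x hx (by linarith)).2
    rw [sub_self, norm_zero, ← dist_eq_norm] at h1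
    have h3 : 0 ≤ u z := le_trans (mul_nonneg hc.le (Real.rpow_nonneg (bdist_nonneg z) τ)) huz.1
    have h4 : (l / 4) ^ 2 ≤ dist z x ^ 2 := by gcongr
    have h5 : K * l ^ (τ - 2) * (l / 4) ^ 2 ≤ K * l ^ (τ - 2) * dist z x ^ 2 := by gcongr
    have h6 : K * l ^ (τ - 2) * (l / 4) ^ 2 = K / 16 * l ^ τ := by rw [← hl2]; ring
    have h7 : K / 16 * l ^ τ = C * l ^ τ + l ^ τ := by rw [hK]; ring
    have h8 : bdist Ω x = l := rfl
    rw [h8] at h2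
    linarith
  have hsub : Metric.closedBall z (l / 4) ⊆ Metric.closedBall x (l / 2) :=
    Metric.closedBall_subset_closedBall' (by linarith)
  set φ : E N → ℝ := fun y => u z + K * l ^ (τ - 2) * (‖z - x‖ ^ 2 - ‖y - x‖ ^ 2) with hφ
  set w := glue (Metric.ball z (l / 4)) φ u with hw
  have hφz : u z = φ z := by simp [hφ]
  have hwz : w z = u z := by rw [hw, glue_of_mem (Metric.mem_ball_self (by positivity)), ← hφz]
  have hmemb : ∀ y : E N, z + l • y ∈ Metric.ball z (l / 4) ↔ y ∈ Metric.ball (0 : E N) (1 / 4) := by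
    intro y
    simp only [Metric.mem_ball, dist_self_add_left, norm_smul, dist_zero_right,
      Real.norm_of_nonneg hl0.le]
    constructor <;> intro h <;> nlinarith
  have hinner : ∀ y ∈ Metric.ball (0 : E N) (1 / 4),
      w (z + l • y) + w (z - l • y) - 2 * w z = -(2 * K * l ^ τ) * ‖y‖ ^ 2 := by
    intro y hy
    have hy' : -y ∈ Metric.ball (0 : E N) (1 / 4) := by simpa using hy
    have h1 := (hmemb y).2 hy
    have h2 := (hmemb (-y)).2 hy'
    rw [smul_neg, ← sub_eq_add_neg] at h2
    rw [hwz, hw, glue_of_mem h1, glue_of_mem h2]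
    have h3 := norm_add_sq_add_norm_sub_sq (z - x) (l • y)
    rw [norm_smul, Real.norm_of_nonneg hl0.le] at h3
    have e1 : z + l • y - x = z - x + l • y := by abel
    have e2 : z - l • y - x = z - x - l • y := by abel
    simp only [hφ, e1, e2]
    have e3 : -(2 * K * l ^ τ) * ‖y‖ ^ 2 = -(K * l ^ (τ - 2)) * (2 * (l * ‖y‖) ^ 2) := by
      rw [← hl2]; ring
    rw [e3]
    linear_combination -(K * l ^ (τ - 2)) * h3
  have hout : ∀ y ∈ (Metric.ball (0 : E N) (1 / 4))ᶜ, w (z + l • y) = u (z + l • y) :=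
    fun y hy => by rw [hw, glue_of_notMem (fun hh => hy ((hmemb y).1 hh))]
  have hms : MeasurableSet (Metric.ball (0 : E N) (1 / 4))ᶜ :=
    Metric.isOpen_ball.measurableSet.compl
  obtain ⟨M', -, hM'⟩ := exists_tail_bound hα0 (sol_inWeightedL1 hsol)
    (show 0 < l * (1 / 4) by positivity) R
  have hio : IntegrableOn (fun y => u (z + l • y)) (Metric.ball (0 : E N) (1 / 4))ᶜ (kern N α) :=
    integrableOn_comp_smul_kern (f := fun y => u (z + y)) hl0 (hM' z (hR z hzΩ)).1
  have hgi : IntegrableOn (fun y => w (z + l • y)) (Metric.ball (0 : E N) (1 / 4))ᶜ (kern N α) :=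
    hio.congr_fun (fun y hy => (hout y hy).symm) hms
  obtain ⟨hint, hval⟩ := fracLap_scaled hα0 (show (0 : ℝ) < 1 / 4 by norm_num) hl0 hinner
    ((integrableOn_norm_sq_kern hN hα.2 (1 / 4)).const_mul _) hgi
  have htest := le_fracLap_glue hsol (show 0 < l / 4 by positivity)
    (fun y hy => (hdist y (hsub hy)).1) (φ := φ) (by
      have : ContDiff ℝ 2 φ := by
        have h1 : ContDiff ℝ 2 fun y : E N => ‖y - x‖ ^ 2 := (contDiff_id.sub contDiff_const).norm_sq ℝ
        exact contDiff_const.add (contDiff_const.mul (contDiff_const.sub h1))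
      exact this.contDiffOn) hφz (fun y hy => by
      have : u z + K * l ^ (τ - 2) * ‖z - x‖ ^ 2 ≤ u y + K * l ^ (τ - 2) * ‖y - x‖ ^ 2 :=
        hmin (hsub (Metric.ball_subset_closedBall hy))
      simp only [hφ]
      linarith) hint
  refine ⟨z, hzΩ, hzd1, hzd2, htest.trans ?_⟩
  rw [hval, setIntegral_congr_fun hms hout,
    setIntegral_comp_smul_kern hl0 (fun y => u (z + y)), hwz, integral_const_mul, ← hQ, ← hB]
  -- Only a lower bound for the outer integral is needed. Within distance `δ/2` of `z` the function
  -- `u` is nonnegative almost everywhere, so only the far tail can be negative.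
  have hpos : ∀ᵐ y ∂kern N α, ‖y‖ < δ / 2 → 0 ≤ u (z + y) := by
    filter_upwards [ae_kern_add (α := α) (ae_mem_or_eq_zero hΩ hC2 hsol) z] with y hy hyn
    rcases hy with hy | hy
    · refine le_trans ?_ (hu _ hy ?_).1
      · have := bdist_nonneg (Ω := Ω) (z + y)
        positivity
      · have := bdist_le_add (Ω := Ω) (z + y) z
        rw [dist_self_add_left] at this
        linarith
    · exact hy.2.ge
  have htail := neg_tail_le_setIntegral (hM' z (hR z hzΩ)).1 (hM z (hR z hzΩ)).1 hpos
  have hMz := (hM z (hR z hzΩ)).2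
  have hl2α : 0 < l ^ (2 * α) := by positivity
  have e1 : l ^ (-(2 * α)) * l ^ (2 * α) = 1 := by rw [← Real.rpow_add hl0]; simp
  have e2 : l ^ (τ - 2 * α) = l ^ (-(2 * α)) * l ^ τ := by
    rw [← Real.rpow_add hl0]; congr 1; ring
  have e3 : 1 ≤ l ^ (τ - 2 * α) :=
    Real.one_le_rpow_of_pos_of_le_one_of_nonpos hl0 hl1.le (by linarith [hτ.2])
  have huz2 : u z ≤ 2 * C * l ^ τ := by
    have := rpow_le_of_div_two_le hτ hl0 hzd1
    nlinarith [huz.2]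
  set I := ∫ y in (Metric.ball (0 : E N) (l * (1 / 4)))ᶜ, u (z + y) ∂kern N α
  set p := l ^ (-(2 * α)) with hp
  have hp0 : 0 < p := by positivity
  have hI : -M ≤ I := by linarith
  calc -(1 / 2) * p * (-(2 * K * l ^ τ) * Q + 2 * (l ^ (2 * α) * I) - 2 * u z * B)
      = K * Q * (p * l ^ τ) - (p * l ^ (2 * α)) * I + p * (u z * B) := by ring
    _ = K * Q * l ^ (τ - 2 * α) - I + p * (u z * B) := by rw [e1, ← e2]; ring
    _ ≤ K * Q * l ^ (τ - 2 * α) + M * l ^ (τ - 2 * α) + p * (2 * C * l ^ τ * B) := by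
      have h1 : p * (u z * B) ≤ p * (2 * C * l ^ τ * B) := by gcongr
      have h2 : M ≤ M * l ^ (τ - 2 * α) := le_mul_of_one_le_right hM0 e3
      linarith
    _ = _ := by rw [e2]; ring

/-! ### Comparing the outer integral with that of an affine profile by a shear. -/

section OuterAbove

variable {α τ : ℝ} {n b : E N}

lemma setLIntegral_kern (α : ℝ) {A : Set (E N)} (hA : MeasurableSet A) (f : E N → ENNReal) :
    ∫⁻ y in A, f y ∂kern N α =
      ∫⁻ y in A, ENNReal.ofReal ((‖y‖ ^ ((N : ℝ) + 2 * α))⁻¹) * f y := by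
  rw [kern, powMeas, restrict_withDensity hA]
  exact lintegral_withDensity_eq_lintegral_mul_non_measurable _ (measurable_powDensity _)
    (ae_of_all _ fun _ => ENNReal.ofReal_lt_top) f

/-- The shear by `e = F - (μ + ⟨n,·⟩)` along `b` turns `F` into the affine function exactly. Since
`|e b| ≤ ε |y|`, the kernel changes by at most `(1+ε)^(N+2α)`, and the image stays outside the ball
of radius `(1-ε)ρ`. -/
lemma lintegral_posPow_shear_le (hα : 0 < α) (hnb : inner ℝ n b = 1) {F : E N → ℝ}
    (hF : Differentiable ℝ F) (hFb : ∀ (z : E N) (a : ℝ), F (z + a • b) = F z + a)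
    {μ ρ ε : ℝ} (hρ : 0 < ρ) (hε0 : 0 < ε) (hε1 : ε < 1) {A : Set (E N)} (hA : MeasurableSet A)
    (hAρ : ∀ y ∈ A, ρ ≤ ‖y‖)
    (he : ∀ y ∈ A, ‖(F y - (μ + inner ℝ n y)) • b‖ ≤ ε * ‖y‖) :
    ∫⁻ y in A, ENNReal.ofReal (posPow τ (F y)) ∂kern N α ≤
      ENNReal.ofReal ((1 + ε) ^ ((N : ℝ) + 2 * α)) *
        ∫⁻ y in (Metric.ball 0 ((1 - ε) * ρ))ᶜ,
          ENNReal.ofReal (posPow τ (μ + inner ℝ n y)) ∂kern N α := by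
  set q : ℝ := (N : ℝ) + 2 * α with hq
  have hq0 : 0 < q := by positivity
  set e : E N → ℝ := fun y => F y - (μ + inner ℝ n y) with hedef
  have hed : Differentiable ℝ e :=
    hF.sub ((differentiable_const μ).add ((differentiable_const n).inner ℝ differentiable_id))
  have heb : ∀ (z : E N) (a : ℝ), e (z + a • b) = e z := fun z a => by
    simp only [hedef, hFb, inner_add_right, inner_smul_right, hnb]; ring
  have hms : MeasurableSet (Metric.ball (0 : E N) ((1 - ε) * ρ))ᶜ :=
    Metric.isOpen_ball.measurableSet.compl
  rw [setLIntegral_kern α hA, setLIntegral_kern α hms,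
    ← lintegral_const_mul' _ _ ENNReal.ofReal_ne_top]
  set g : E N → ENNReal := fun y => ENNReal.ofReal ((1 + ε) ^ q) *
    (ENNReal.ofReal ((‖y‖ ^ q)⁻¹) * ENNReal.ofReal (posPow τ (μ + inner ℝ n y))) with hg
  have hlow : ∀ y ∈ A, (1 - ε) * ρ ≤ ‖y + e y • b‖ ∧ 0 < ‖y + e y • b‖ := fun y hy => by
    have h1 := he y hy
    have h2 := hAρ y hy
    have h3 := norm_sub_le_norm_add y (e y • b)
    have h4 : (1 - ε) * ρ ≤ (1 - ε) * ‖y‖ := by gcongr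
    have h5 : (1 - ε) * ‖y‖ = ‖y‖ - ε * ‖y‖ := by ring
    have h6 : 0 < (1 - ε) * ρ := mul_pos (by linarith) hρ
    have h7 : ‖e y • b‖ ≤ ε * ‖y‖ := h1
    constructor <;> linarith
  calc ∫⁻ y in A, ENNReal.ofReal ((‖y‖ ^ q)⁻¹) * ENNReal.ofReal (posPow τ (F y))
      ≤ ∫⁻ y in A, g (y + e y • b) := by
        refine setLIntegral_mono' hA fun y hy => ?_
        have hy0 : 0 < ‖y‖ := hρ.trans_le (hAρ y hy)
        have h1 : μ + inner ℝ n (y + e y • b) = F y := by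
          simp only [hedef, inner_add_right, inner_smul_right, hnb]; ring
        simp only [hg, h1]
        rw [← mul_assoc (ENNReal.ofReal ((1 + ε) ^ q)),
          ← ENNReal.ofReal_mul (p := (1 + ε) ^ q) (by positivity)]
        refine mul_le_mul' (ENNReal.ofReal_le_ofReal ?_) le_rfl
        have h2 : ‖y + e y • b‖ ≤ (1 + ε) * ‖y‖ := by
          have h3 : ‖e y • b‖ ≤ ε * ‖y‖ := he y hy
          linarith [norm_add_le y (e y • b)]
        have h4 := (hlow y hy).2
        rw [inv_eq_one_div, ← div_eq_mul_inv, div_le_div_iff₀ (by positivity) (by positivity),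
          one_mul, ← Real.mul_rpow (by positivity) hy0.le]
        exact Real.rpow_le_rpow h4.le h2 hq0.le
    _ = ∫⁻ y in (fun z => z + e z • b) '' A, g y := lintegral_shear hed heb hA g
    _ ≤ _ := by
        refine lintegral_mono_set ?_
        rintro _ ⟨y, hy, rfl⟩
        simpa using (hlow y hy).1

/-- Homogeneity: rescaling by `μ` gives `μ^τ` from the profile and `μ^(-2α)` from the kernel. -/
lemma integrableOn_posPow_affine (hN : 1 ≤ N) (hα : α ∈ Set.Ioo (0 : ℝ) 1)
    (hτ : τ ∈ Set.Ioo (-1 : ℝ) 0) (hn : ‖n‖ = 1) {μ ρ : ℝ} (hμ : 0 < μ) (hρ : 0 < ρ) :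
    IntegrableOn (fun y : E N => posPow τ (μ + inner ℝ n y)) (Metric.ball 0 (μ * ρ))ᶜ (kern N α) ∧
      ∫ y in (Metric.ball 0 (μ * ρ))ᶜ, posPow τ (μ + inner ℝ n y) ∂kern N α =
        μ ^ (τ - 2 * α) * halfOuter α τ n ρ := by
  have h1 : ∀ y : E N, posPow τ (μ + inner ℝ n (μ • y)) = μ ^ τ * posPow τ (1 + inner ℝ n y) := by
    intro y
    rw [← posPow_mul hμ, inner_smul_right]; ring_nf
  constructor
  · have h2 : IntegrableOn (fun y : E N => posPow τ (μ + inner ℝ n (μ • y))) (Metric.ball 0 ρ)ᶜ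
        (kern N α) := by
      simp_rw [h1]
      exact (integrableOn_posPow_inner hN hα hτ hn hρ).const_mul _
    rw [show ρ = μ⁻¹ * (μ * ρ) by field_simp] at h2
    have h3 := integrableOn_comp_smul_kern (inv_pos.2 hμ) h2
    simp_rw [smul_smul, mul_inv_cancel₀ hμ.ne', one_smul] at h3
    exact h3
  · have h2 := setIntegral_comp_smul_kern (α := α) (ρ := ρ) hμ
      (fun y : E N => posPow τ (μ + inner ℝ n y))
    simp_rw [h1] at h2
    rw [integral_const_mul] at h2
    have h3 : 0 < μ ^ (2 * α) := by positivity
    rw [Real.rpow_sub hμ, div_mul_eq_mul_div, eq_div_iff h3.ne', mul_comm, ← h2]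
    rfl

lemma setIntegral_posPow_shear_le (hN : 1 ≤ N) (hα : α ∈ Set.Ioo (0 : ℝ) 1)
    (hτ : τ ∈ Set.Ioo (-1 : ℝ) 0) (hn : ‖n‖ = 1) (hnb : inner ℝ n b = 1) {F : E N → ℝ}
    (hF : Differentiable ℝ F) (hFb : ∀ (z : E N) (a : ℝ), F (z + a • b) = F z + a)
    {μ ρ ε : ℝ} (hμ : 0 < μ) (hρ : 0 < ρ) (hε0 : 0 < ε) (hε1 : ε < 1) {A : Set (E N)}
    (hA : MeasurableSet A) (hAρ : ∀ y ∈ A, μ * ρ ≤ ‖y‖)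
    (he : ∀ y ∈ A, ‖(F y - (μ + inner ℝ n y)) • b‖ ≤ ε * ‖y‖) :
    IntegrableOn (fun y => posPow τ (F y)) A (kern N α) ∧
      ∫ y in A, posPow τ (F y) ∂kern N α ≤
        (1 + ε) ^ ((N : ℝ) + 2 * α) * (μ ^ (τ - 2 * α) * halfOuter α τ n ((1 - ε) * ρ)) := by
  have h := lintegral_posPow_shear_le (τ := τ) hα.1 hnb hF hFb (mul_pos hμ hρ) hε0 hε1 hA hAρ he
  have hρ' : 0 < (1 - ε) * ρ := mul_pos (by linarith) hρ
  obtain ⟨hi, hv⟩ := integrableOn_posPow_affine hN hα hτ hn hμ hρ'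
  rw [show (1 - ε) * (μ * ρ) = μ * ((1 - ε) * ρ) by ring,
    ← ofReal_integral_eq_lintegral_ofReal hi (ae_of_all _ fun _ => posPow_nonneg _ _), hv,
    ← ENNReal.ofReal_mul (by positivity)] at h
  have hmeas : AEStronglyMeasurable (fun y => posPow τ (F y)) ((kern N α).restrict A) :=
    ((measurable_posPow τ).comp hF.continuous.measurable).aestronglyMeasurable
  have hint : IntegrableOn (fun y => posPow τ (F y)) A (kern N α) := by
    refine ⟨hmeas, ?_⟩
    rw [hasFiniteIntegral_iff_ofReal (ae_of_all _ fun _ => posPow_nonneg _ _)]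
    exact h.trans_lt ENNReal.ofReal_lt_top
  refine ⟨hint, ?_⟩
  rw [← ofReal_integral_eq_lintegral_ofReal hint (ae_of_all _ fun _ => posPow_nonneg _ _)] at h
  refine (ENNReal.ofReal_le_ofReal_iff ?_).1 h
  have : 0 ≤ halfOuter α τ n ((1 - ε) * ρ) := integral_nonneg fun _ => posPow_nonneg _ _
  positivity

lemma setIntegral_le_add_tail {ρ r T I M : ℝ} {f P : E N → ℝ} (hT : 0 ≤ T)
    (hf : IntegrableOn f (Metric.ball 0 ρ)ᶜ (kern N α))
    (hfr : IntegrableOn f (Metric.ball 0 r)ᶜ (kern N α))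
    (hfM : ∫ y in (Metric.ball 0 r)ᶜ, |f y| ∂kern N α ≤ M)
    {A : Set (E N)} (hA : MeasurableSet A) (hAr : ∀ y, ρ ≤ ‖y‖ → y ∉ A → r ≤ ‖y‖)
    (hP0 : ∀ y, 0 ≤ P y) (hP : IntegrableOn P A (kern N α)) (hPI : ∫ y in A, P y ∂kern N α ≤ I)
    (hle : ∀ᵐ y ∂kern N α, y ∈ A → f y ≤ T * P y) :
    ∫ y in (Metric.ball 0 ρ)ᶜ, f y ∂kern N α ≤ T * I + M := by
  have hms : ∀ r, MeasurableSet (Metric.ball (0 : E N) r)ᶜ :=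
    fun r => Metric.isOpen_ball.measurableSet.compl
  have i1 := (integrable_indicator_iff hA).2 (hP.const_mul T)
  have i2 := (integrable_indicator_iff (hms r)).2 hfr.abs
  calc ∫ y in (Metric.ball 0 ρ)ᶜ, f y ∂kern N α
      = ∫ y, (Metric.ball 0 ρ)ᶜ.indicator f y ∂kern N α := (integral_indicator (hms ρ)).symm
    _ ≤ ∫ y, (A.indicator (fun y => T * P y) y + (Metric.ball 0 r)ᶜ.indicator (fun y => |f y|) y)
          ∂kern N α := by
        refine integral_mono_ae ((integrable_indicator_iff (hms ρ)).2 hf) (i1.add i2) ?_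
        filter_upwards [hle] with y hy
        have n1 : 0 ≤ A.indicator (fun y => T * P y) y :=
          Set.indicator_nonneg (fun y _ => mul_nonneg hT (hP0 y)) y
        have n2 : 0 ≤ (Metric.ball 0 r)ᶜ.indicator (fun y => |f y|) y :=
          Set.indicator_nonneg (fun y _ => abs_nonneg (f y)) y
        by_cases h1 : y ∈ (Metric.ball (0 : E N) ρ)ᶜ
        · rw [Set.indicator_of_mem h1]
          by_cases h2 : y ∈ A
          · rw [Set.indicator_of_mem h2] at n1 ⊢
            linarith [hy h2]
          · have h3 := hAr y (by simpa using h1) h2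
            rw [Set.indicator_of_mem (show y ∈ (Metric.ball (0 : E N) r)ᶜ by simpa using h3)] at n2 ⊢
            linarith [le_abs_self (f y)]
        · rw [Set.indicator_of_notMem h1]
          exact add_nonneg n1 n2
    _ = T * (∫ y in A, P y ∂kern N α) + ∫ y in (Metric.ball 0 r)ᶜ, |f y| ∂kern N α := by
        rw [integral_add i1 i2, integral_indicator hA, integral_indicator (hms r),
          integral_const_mul]
    _ ≤ T * I + M := by gcongr

end OuterAbove

/-! ### Testing from above with the half-space profile. -/

section TestAbove

variable {α τ : ℝ} {n : E N}

/-- The test function `t ℓ^τ + k |·-x|²` with `ℓ = l + ⟨n, ·-x⟩`. -/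
def affTest (τ t k l : ℝ) (n x y : E N) : ℝ := t * (l + inner ℝ n (y - x)) ^ τ + k * ‖y - x‖ ^ 2

lemma affine_bounds (hn : ‖n‖ = 1) {x y : E N} {l r : ℝ} (hy : dist y x ≤ r) :
    l - r ≤ l + inner ℝ n (y - x) ∧ l + inner ℝ n (y - x) ≤ l + r := by
  have h := abs_real_inner_le_norm n (y - x)
  rw [hn, one_mul, ← dist_eq_norm] at h
  constructor <;> linarith [(abs_le.1 h).1, (abs_le.1 h).2]

lemma contDiffOn_affTest {s : Set (E N)} {t k l : ℝ} {x : E N}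
    (hs : ∀ y ∈ s, 0 < l + inner ℝ n (y - x)) : ContDiffOn ℝ 2 (affTest τ t k l n x) s := by
  have h1 : ContDiff ℝ 2 fun y : E N => ‖y - x‖ ^ 2 := (contDiff_id.sub contDiff_const).norm_sq ℝ
  have h2 : ContDiff ℝ 2 fun y : E N => l + (inner ℝ n (y - x) : ℝ) :=
    contDiff_const.add (contDiff_const.inner ℝ (contDiff_id.sub contDiff_const))
  exact (contDiffOn_const.mul (h2.contDiffOn.rpow_const_of_ne fun y hy => (hs y hy).ne')).add
    (contDiffOn_const.mul h1.contDiffOn)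

/-- The test function is almost above `u` on the ball and almost equal to it at `x`. The maximum of
the difference is therefore forced near `x` by a quadratic term that need only beat the gaps:
`2(T-t)`, since `ℓ^τ ≤ 2 l^τ`, and `t-S`. The `16` is `(1/4)⁻²`; as the gaps close, `K` can be taken
small. -/
lemma exists_touching_point (hτ : τ ∈ Set.Ioo (-1 : ℝ) 0) (hn : ‖n‖ = 1) {x : E N}
    {l t T S K : ℝ} (hl : 0 < l) (hT : t ≤ T) (hK0 : 0 ≤ K)
    (hK : 16 * (2 * (T - t) + (t - S)) < K)
    {u : E N → ℝ} (hu : ContinuousOn u (Metric.closedBall x (l / 2)))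
    (hup : ∀ y ∈ Metric.closedBall x (l / 2), u y ≤ T * (l + inner ℝ n (y - x)) ^ τ)
    (hx : S * l ^ τ ≤ u x) :
    ∃ z, dist z x < l / 4 ∧
      (∀ y ∈ Metric.closedBall x (l / 2), u y ≤ affTest τ t (K * l ^ (τ - 2)) l n x y
        + (u z - affTest τ t (K * l ^ (τ - 2)) l n x z)) ∧
      t * (l + inner ℝ n (z - x)) ^ τ - (t - S) * l ^ τ ≤ u z := by
  set k := K * l ^ (τ - 2) with hk
  have hk0 : 0 ≤ k := by positivity
  have hpos : ∀ y ∈ Metric.closedBall x (l / 2), l / 2 ≤ l + inner ℝ n (y - x) := fun y hy => by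
    have := (affine_bounds (l := l) hn (Metric.mem_closedBall.1 hy)).1
    linarith
  have hcont : ContinuousOn (fun y => u y - affTest τ t k l n x y) (Metric.closedBall x (l / 2)) :=
    hu.sub (contDiffOn_affTest fun y hy => by linarith [hpos y hy]).continuousOn
  have hxm : x ∈ Metric.closedBall x (l / 2) := Metric.mem_closedBall_self (by positivity)
  obtain ⟨z, hz, hmax⟩ := (isCompact_closedBall x (l / 2)).exists_isMaxOn ⟨x, hxm⟩ hcont
  have hmax' : ∀ y ∈ Metric.closedBall x (l / 2),
      u y - affTest τ t k l n x y ≤ u z - affTest τ t k l n x z := fun y hy => hmax hy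
  have hlτ : 0 < l ^ τ := by positivity
  have hax : affTest τ t k l n x x = t * l ^ τ := by simp [affTest]
  have hxz := hmax' x hxm
  rw [hax] at hxz
  have haz : affTest τ t k l n x z = t * (l + inner ℝ n (z - x)) ^ τ + k * dist z x ^ 2 := by
    rw [affTest, dist_eq_norm]
  have hkz : 0 ≤ k * dist z x ^ 2 := by positivity
  refine ⟨z, ?_, fun y hy => by linarith [hmax' y hy], by linarith⟩
  by_contra hcon
  rw [not_lt] at hcon
  have h1 := hup z hz
  have h2 := rpow_le_of_div_two_le hτ hl (hpos z hz)
  have h3 : k * (l / 4) ^ 2 ≤ k * dist z x ^ 2 := by gcongr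
  have hl2 : l ^ (τ - 2) * l ^ 2 = l ^ τ := by
    rw [← Real.rpow_natCast l 2, ← Real.rpow_add hl]; norm_num
  have h4 : k * (l / 4) ^ 2 = K / 16 * l ^ τ := by rw [hk, ← hl2]; ring
  have h5 : (T - t) * (l + inner ℝ n (z - x)) ^ τ ≤ (T - t) * (2 * l ^ τ) := by
    gcongr
  have h6 : 16 * (2 * (T - t) + (t - S)) * l ^ τ < K * l ^ τ := by gcongr
  linarith

lemma fracLap_glue_affTest (hN : 1 ≤ N) (hα : α ∈ Set.Ioo (0 : ℝ) 1)
    (hτ : τ ∈ Set.Ioo (-1 : ℝ) 0) (hn : ‖n‖ = 1) {x z : E N} {l t k μ a : ℝ} {u : E N → ℝ}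
    (hu : InWeightedL1 α u) (hμ : 0 < μ) (hμz : l + inner ℝ n (z - x) = μ)
    (hz : u z = affTest τ t k l n x z + a) :
    Integrable (fracIntegrand α (glue (Metric.ball z (μ / 8))
      (fun y => affTest τ t k l n x y + a) u) z) ∧
    fracLap α (glue (Metric.ball z (μ / 8)) (fun y => affTest τ t k l n x y + a) u) z =
      -(1 / 2) * μ ^ (-(2 * α)) *
        (t * μ ^ τ * (∫ y in Metric.ball 0 (1 / 8), posPowDiff τ (inner ℝ n y) ∂kern N α)
          + 2 * k * μ ^ 2 * (∫ y in Metric.ball (0 : E N) (1 / 8), ‖y‖ ^ 2 ∂kern N α)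
          + 2 * (μ ^ (2 * α) *
            ∫ y in (Metric.ball 0 (μ * (1 / 8)))ᶜ, u (z + y) ∂kern N α)
          - 2 * u z * (kern N α).real (Metric.ball (0 : E N) (1 / 8))ᶜ) := by
  set φ : E N → ℝ := fun y => affTest τ t k l n x y + a with hφ
  set w := glue (Metric.ball z (μ / 8)) φ u with hw
  have hwz : w z = u z := by rw [hw, glue_of_mem (Metric.mem_ball_self (by positivity)), hz]
  have hmemb : ∀ y : E N, z + μ • y ∈ Metric.ball z (μ / 8) ↔ y ∈ Metric.ball (0 : E N) (1 / 8) := by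
    intro y
    simp only [Metric.mem_ball, dist_self_add_left, norm_smul, dist_zero_right,
      Real.norm_of_nonneg hμ.le]
    constructor <;> intro h <;> nlinarith
  have hφv : ∀ y ∈ Metric.ball (0 : E N) (1 / 8), φ (z + μ • y)
      = t * (μ ^ τ * posPow τ (1 + inner ℝ n y)) + k * ‖(z - x) + μ • y‖ ^ 2 + a := by
    intro y hy
    have hy' : ‖y‖ < 1 / 8 := by simpa using hy
    have h1 := abs_real_inner_le_norm n y
    rw [hn, one_mul] at h1
    have h2 : 0 < 1 + inner ℝ n y := by linarith [(abs_le.1 h1).1]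
    have e1 : z + μ • y - x = (z - x) + μ • y := by abel
    have e2 : l + inner ℝ n ((z - x) + μ • y) = μ * (1 + inner ℝ n y) := by
      rw [inner_add_right, inner_smul_right, ← add_assoc, hμz]; ring
    simp only [hφ, affTest, e1, e2]
    rw [posPow_of_pos h2, Real.mul_rpow hμ.le h2.le]
  have hinner : ∀ y ∈ Metric.ball (0 : E N) (1 / 8),
      w (z + μ • y) + w (z - μ • y) - 2 * w z
        = t * μ ^ τ * posPowDiff τ (inner ℝ n y) + 2 * k * μ ^ 2 * ‖y‖ ^ 2 := by
    intro y hy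
    have hy' : -y ∈ Metric.ball (0 : E N) (1 / 8) := by simpa using hy
    have h1 := (hmemb y).2 hy
    have h2 := (hmemb (-y)).2 hy'
    have h3 := hφv y hy
    have h4 := hφv (-y) hy'
    rw [smul_neg, ← sub_eq_add_neg] at h2 h4
    rw [← sub_eq_add_neg, inner_neg_right, ← sub_eq_add_neg] at h4
    have h5 := norm_add_sq_add_norm_sub_sq (z - x) (μ • y)
    rw [norm_smul, Real.norm_of_nonneg hμ.le] at h5
    have h6 : u z = t * μ ^ τ + k * ‖z - x‖ ^ 2 + a := by rw [hz, affTest, hμz]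
    rw [hwz, h6, hw, glue_of_mem h1, glue_of_mem h2, h3, h4, posPowDiff]
    linear_combination k * h5
  have hout : ∀ y ∈ (Metric.ball (0 : E N) (1 / 8))ᶜ, w (z + μ • y) = u (z + μ • y) :=
    fun y hy => by rw [hw, glue_of_notMem (fun hh => hy ((hmemb y).1 hh))]
  have hms : MeasurableSet (Metric.ball (0 : E N) (1 / 8))ᶜ :=
    Metric.isOpen_ball.measurableSet.compl
  obtain ⟨M', -, hM'⟩ := exists_tail_bound hα.1 hu (show 0 < μ * (1 / 8) by positivity) ‖z‖
  have hio : IntegrableOn (fun y => u (z + μ • y)) (Metric.ball (0 : E N) (1 / 8))ᶜ (kern N α) :=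
    integrableOn_comp_smul_kern (f := fun y => u (z + y)) hμ (hM' z le_rfl).1
  have hgi : IntegrableOn (fun y => w (z + μ • y)) (Metric.ball (0 : E N) (1 / 8))ᶜ (kern N α) :=
    hio.congr_fun (fun y hy => (hout y hy).symm) hms
  have i1 : IntegrableOn (fun y : E N => t * μ ^ τ * posPowDiff τ (inner ℝ n y))
      (Metric.ball 0 (1 / 8)) (kern N α) :=
    ((integrable_posPowDiff_inner hN hα hτ hn).integrableOn).const_mul _
  have i2 : IntegrableOn (fun y : E N => 2 * k * μ ^ 2 * ‖y‖ ^ 2)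
      (Metric.ball 0 (1 / 8)) (kern N α) :=
    (integrableOn_norm_sq_kern hN hα.2 (1 / 8)).const_mul _
  obtain ⟨hint, hval⟩ := fracLap_scaled hα.1 (show (0 : ℝ) < 1 / 8 by norm_num) hμ hinner
    (i1.add i2) hgi
  refine ⟨hint, ?_⟩
  rw [hval, setIntegral_congr_fun hms hout, setIntegral_comp_smul_kern hμ (fun y => u (z + y)),
    hwz, integral_add i1 i2, integral_const_mul, integral_const_mul]

/-- A touching point within `l/4` of `x` has height `μ ≤ 5l/4`. The exponent is above `-3`, and
`(4/5)^(-3) = 125/64 < 2`. -/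
lemma four_fifths_rpow_le (hτ : τ ∈ Set.Ioo (-1 : ℝ) 0) {l μ : ℝ} (hμ : 0 < μ)
    (h : 4 / 5 * μ ≤ l) : l ^ (τ - 2) * μ ^ 2 ≤ 2 * μ ^ τ := by
  have h1 : l ^ (τ - 2) ≤ (4 / 5 * μ) ^ (τ - 2) :=
    Real.rpow_le_rpow_of_nonpos (by positivity) h (by linarith [hτ.2])
  have h2 : ((4 : ℝ) / 5) ^ (τ - 2) ≤ 2 :=
    calc ((4 : ℝ) / 5) ^ (τ - 2) ≤ (4 / 5) ^ (-3 : ℝ) :=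
          Real.rpow_le_rpow_of_exponent_ge (by norm_num) (by norm_num) (by linarith [hτ.1])
      _ ≤ 2 := by
        rw [show (-3 : ℝ) = ((-3 : ℤ) : ℝ) by norm_num, Real.rpow_intCast]; norm_num
  have hl2 : μ ^ (τ - 2) * μ ^ 2 = μ ^ τ := by
    rw [← Real.rpow_natCast μ 2, ← Real.rpow_add hμ]; norm_num
  rw [Real.mul_rpow (by norm_num) hμ.le] at h1
  calc l ^ (τ - 2) * μ ^ 2 ≤ (4 / 5) ^ (τ - 2) * μ ^ (τ - 2) * μ ^ 2 := by gcongr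
    _ = (4 / 5) ^ (τ - 2) * μ ^ τ := by rw [mul_assoc, hl2]
    _ ≤ 2 * μ ^ τ := by gcongr

end TestAbove

section TestAbove

variable {α τ : ℝ}

lemma rpow_le_mul_rpow (hτ : τ ∈ Set.Ioo (-1 : ℝ) 0) {s x d : ℝ} (hs : 1 ≤ s) (hx : 0 < x)
    (h : x ≤ s * d) : d ^ τ ≤ s * x ^ τ := by
  have hs0 : 0 < s := by linarith
  have h1 : s⁻¹ * x ≤ d := by rwa [inv_mul_le_iff₀ hs0]
  calc d ^ τ ≤ (s⁻¹ * x) ^ τ := Real.rpow_le_rpow_of_nonpos (by positivity) h1 hτ.2.le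
    _ = s ^ (-τ) * x ^ τ := by
      rw [Real.mul_rpow (by positivity) hx.le, Real.inv_rpow hs0.le, Real.rpow_neg hs0.le]
    _ ≤ s * x ^ τ := by
      gcongr
      calc s ^ (-τ) ≤ s ^ (1 : ℝ) := Real.rpow_le_rpow_of_exponent_le hs (by linarith [hτ.1])
        _ = s := Real.rpow_one s

/-- The constant bounding the second differences from above; it tends to
`t ∫ (x₊^τ second difference)` as `ε → 0`. -/
def aboveConst (α τ : ℝ) (n : E N) (t ε : ℝ) : ℝ :=
  t * (∫ y in Metric.ball 0 (1 / 8), posPowDiff τ (inner ℝ n y) ∂kern N α)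
    + 4 * (16 * (2 * ((t + ε) * (1 + ε) ^ 2 - t) + (t - (t - ε) * (1 - ε))) + ε)
      * (∫ y in Metric.ball (0 : E N) (1 / 8), ‖y‖ ^ 2 ∂kern N α)
    + 2 * ((t + ε) * (1 + ε)) *
      ((1 + ε) ^ ((N : ℝ) + 2 * α) * halfOuter α τ n ((1 - ε) * (1 / 8)))
    - 2 * (t - 2 * (t - (t - ε) * (1 - ε))) * (kern N α).real (Metric.ball (0 : E N) (1 / 8))ᶜ

lemma tendsto_aboveConst (hN : 1 ≤ N) (hα : α ∈ Set.Ioo (0 : ℝ) 1)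
    (hτ : τ ∈ Set.Ioo (-1 : ℝ) 0) {n : E N} (hn : ‖n‖ = 1) (t : ℝ) :
    Tendsto (aboveConst α τ n t) (𝓝[>] 0)
      (𝓝 (t * ∫ y : E N, posPowDiff τ (inner ℝ n y) ∂kern N α)) := by
  have hH := tendsto_halfOuter hN hα hτ hn (show (0 : ℝ) < 1 / 8 by norm_num)
  have hcont : ∀ g : ℝ → ℝ, ContinuousAt g 0 → Tendsto g (𝓝[>] 0) (𝓝 (g 0)) :=
    fun g hg => hg.tendsto.mono_left nhdsWithin_le_nhds
  have hpow : ContinuousAt (fun ε : ℝ => (1 + ε) ^ ((N : ℝ) + 2 * α)) 0 :=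
    ContinuousAt.rpow_const (by fun_prop) (Or.inl (by norm_num))
  have h1 := hcont (fun ε => 4 * (16 * (2 * ((t + ε) * (1 + ε) ^ 2 - t) +
    (t - (t - ε) * (1 - ε))) + ε)) (by fun_prop)
  have h2 := hcont (fun ε => 2 * ((t + ε) * (1 + ε))) (by fun_prop)
  have h3 := hcont _ hpow
  have h4 := hcont (fun ε => 2 * (t - 2 * (t - (t - ε) * (1 - ε)))) (by fun_prop)
  have := ((tendsto_const_nhds (x := t * ∫ y in Metric.ball 0 (1 / 8),
      posPowDiff τ (inner ℝ n y) ∂kern N α)).add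
    (h1.mul_const (∫ y in Metric.ball (0 : E N) (1 / 8), ‖y‖ ^ 2 ∂kern N α))).add
    (h2.mul (h3.mul hH)) |>.sub
    (h4.mul_const ((kern N α).real (Metric.ball (0 : E N) (1 / 8))ᶜ))
  refine this.congr' (Eventually.of_forall fun ε => rfl) |>.trans (le_of_eq ?_)
  congr 1
  rw [integral_posPowDiff_inner_split hN hα hτ hn (show (0 : ℝ) < 1 / 8 by norm_num)]
  norm_num
  ring

/-- In the application `p, v, w, m, d` are `μ^(-2α)`, `μ^τ`, `μ^(2α)`, `μ^(τ-2α)`, `μ²`, and `I` is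
the outer integral. -/
lemma test_above_algebra {p m t v w k d K Q Y s x B T L H I M : ℝ} (hp : 0 ≤ p) (hQ : 0 ≤ Q)
    (hB : 0 ≤ B) (hpw : p * w = 1) (hpv : p * v = m) (hk : k * d ≤ K * (2 * v))
    (hx : s * v ≤ x) (hI : I ≤ T * (L * (m * H)) + M) :
    -(1 / 2) * (m * (t * Y + 4 * K * Q + 2 * T * (L * H) - 2 * s * B) + 2 * M) ≤
      -(1 / 2) * p * (t * v * Y + 2 * k * d * Q + 2 * (w * I) - 2 * x * B) := by
  subst hpv
  have h1 : p * (k * d) * Q ≤ p * (K * (2 * v)) * Q := by gcongr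
  have h2 : p * (s * v) * B ≤ p * x * B := by gcongr
  have h3 : p * (w * I) = I := by rw [← mul_assoc, hpw, one_mul]
  linarith

/-- The integral away from a touching point, compared with that of the half-space profile. -/
lemma Chart.setIntegral_outer_le (hN : 1 ≤ N) (hα : α ∈ Set.Ioo (0 : ℝ) 1)
    (hτ : τ ∈ Set.Ioo (-1 : ℝ) 0) {Ω : Set (E N)} (hΩ : IsOpen Ω)
    (hC2 : IsC2Domain Ω) {h : E N → ℝ → ℝ} {u : E N → ℝ}
    (hsol : IsViscositySol α Ω h (fun _ => 0) u ∨ IsClassicalSol α Ω h (fun _ => 0) u)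
    {x₀ : E N} (c : Chart Ω x₀) {t ε κ r l μ M : ℝ} {x z : E N} {U : Set (E N)}
    (hε0 : 0 < ε) (hε1 : ε ≤ 1 / 4) (ht : 0 < t) (hκ0 : 0 ≤ κ) (hκb : 4 * κ * ‖c.b‖ ≤ ε)
    (haff : ∀ y ∈ Metric.ball x₀ r, ∀ w ∈ U, |c.D y - c.D w - inner ℝ c.n (y - w)| ≤ κ * ‖y - w‖)
    (hxU : x ∈ U)
    (hupD : ∀ y ∈ Metric.ball x₀ r, y ∈ Ω → 0 < c.D y ∧ u y ≤ (t + ε) * (1 + ε) * c.D y ^ τ)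
    (hl : c.D x = l) (hzx : dist z x < l / 4) (hzx₀ : dist z x₀ < r / 2)
    (hμ : μ = l + inner ℝ c.n (z - x)) (hμ0 : 0 < μ) (hlμ : l ≤ 4 / 3 * μ)
    (htail : IntegrableOn (fun y => u (z + y)) (Metric.ball 0 (r / 2))ᶜ (kern N α))
    (hM : ∫ y in (Metric.ball 0 (r / 2))ᶜ, |u (z + y)| ∂kern N α ≤ M) :
    ∫ y in (Metric.ball 0 (μ * (1 / 8)))ᶜ, u (z + y) ∂kern N α ≤
      (t + ε) * (1 + ε) * ((1 + ε) ^ ((N : ℝ) + 2 * α) *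
        (μ ^ (τ - 2 * α) * halfOuter α τ c.n ((1 - ε) * (1 / 8)))) + M := by
  have hn := c.norm_n
  set A : Set (E N) := {y | μ * (1 / 8) ≤ ‖y‖} ∩ (fun y => z + y) ⁻¹' Metric.ball x₀ r with hA
  have hAm : MeasurableSet A := (isClosed_le continuous_const continuous_norm).measurableSet.inter
    ((Metric.isOpen_ball.preimage (by fun_prop)).measurableSet)
  have hε1' : ε < 1 := by linarith
  obtain ⟨hPi, hPI⟩ := setIntegral_posPow_shear_le hN hα hτ hn c.inner_b
    (F := fun y => c.D (z + y)) (c.diff.comp ((differentiable_const z).add differentiable_id))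
    (fun y a => by rw [← add_assoc, c.translate]) hμ0 (show (0 : ℝ) < 1 / 8 by norm_num) hε0 hε1'
    hAm (fun y hy => hy.1) (fun y hy => by
      have h1 := haff (z + y) hy.2 x hxU
      have h2 : c.D (z + y) - (μ + inner ℝ c.n y)
          = c.D (z + y) - c.D x - inner ℝ c.n (z + y - x) := by
        rw [hμ, hl, show z + y - x = (z - x) + y by abel, inner_add_right]; ring
      rw [norm_smul, Real.norm_eq_abs, h2]
      have h3 : ‖z + y - x‖ ≤ dist z x + ‖y‖ := by
        rw [show z + y - x = (z - x) + y by abel, dist_eq_norm]; exact norm_add_le _ _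
      have h4 : μ * (1 / 8) ≤ ‖y‖ := hy.1
      -- From `|z - x| < l/4 ≤ μ/3` and `μ/8 ≤ |y|` one gets `|z + y - x| ≤ (8/3 + 1)|y| ≤ 4|y|`;
      -- this is the `4` in `4 κ |b| ≤ ε`.
      have h5 : κ * ‖z + y - x‖ ≤ κ * (4 * ‖y‖) := by gcongr; linarith
      calc _ ≤ κ * (4 * ‖y‖) * ‖c.b‖ := by gcongr; exact h1.trans h5
        _ = 4 * κ * ‖c.b‖ * ‖y‖ := by ring
        _ ≤ ε * ‖y‖ := by gcongr)
  obtain ⟨M', -, hM'⟩ := exists_tail_bound hα.1 (sol_inWeightedL1 hsol)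
    (show 0 < μ * (1 / 8) by positivity) ‖z‖
  exact setIntegral_le_add_tail (T := (t + ε) * (1 + ε)) (by positivity)
    (hM' z le_rfl).1 htail hM hAm
    (fun y hy hyA => by
      by_contra hcon
      refine hyA ⟨hy, ?_⟩
      rw [Set.mem_preimage, Metric.mem_ball]
      have := dist_triangle (z + y) z x₀
      rw [dist_self_add_left] at this
      linarith)
    (fun y => posPow_nonneg τ _) hPi hPI (by
      filter_upwards [ae_kern_add (α := α) (ae_mem_or_eq_zero hΩ hC2 hsol) z] with y hy hyA
      rcases hy with hy | hy
      · obtain ⟨h1, h2⟩ := hupD _ hyA.2 hy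
        rwa [posPow_of_pos h1]
      · rw [hy.2]
        exact mul_nonneg (by positivity) (posPow_nonneg τ _))

set_option maxHeartbeats 800000 in
lemma exists_test_above_at (hN : 1 ≤ N) (hα : α ∈ Set.Ioo (0 : ℝ) 1)
    (hτ : τ ∈ Set.Ioo (-1 : ℝ) 0) {Ω : Set (E N)} (hΩ : IsOpen Ω) (hb : Bornology.IsBounded Ω)
    (hC2 : IsC2Domain Ω) {h : E N → ℝ → ℝ} {u : E N → ℝ}
    (hsol : IsViscositySol α Ω h (fun _ => 0) u ∨ IsClassicalSol α Ω h (fun _ => 0) u)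
    {x₀ : E N} (hx₀ : x₀ ∈ frontier Ω) (c : Chart Ω x₀) {t ε : ℝ} (hε0 : 0 < ε) (hε1 : ε ≤ 1 / 4)
    (hεt : ε ≤ t)
    (hup : ∃ δ > 0, ∀ x ∈ Ω, bdist Ω x < δ → u x ≤ (t + ε) * bdist Ω x ^ τ)
    (hfr : ∀ ρ > 0, ∃ x ∈ Ω, dist x x₀ < ρ ∧ (t - ε) * bdist Ω x ^ τ ≤ u x) :
    ∃ M : ℝ, ∀ δ > 0, ∃ z ∈ Ω, ∃ μ, 0 < μ ∧ μ < δ ∧ μ / 2 ≤ bdist Ω z ∧ bdist Ω z ≤ 2 * μ ∧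
      (t - 2 * (t - (t - ε) * (1 - ε))) * μ ^ τ ≤ u z ∧
      -(1 / 2) * (μ ^ (τ - 2 * α) * aboveConst α τ c.n t ε + 2 * M) ≤ h z (u z) := by
  obtain ⟨R, hR⟩ := hb.exists_norm_le
  obtain ⟨δε, hδε, hup⟩ := hup
  have hne : (frontier Ω).Nonempty := ⟨x₀, hx₀⟩
  have hn := c.norm_n
  have ht : 0 < t := hε0.trans_le hεt
  -- The first bound makes each replacement among distance, `D` and affine function cost a factor of
  -- order `1 ± ε`; the second makes the shear displacement at most `ε |y|`.
  set κ := min (ε / 8) (ε / (4 * (1 + ‖c.b‖))) with hκ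
  have hκ0 : 0 < κ := by positivity
  have hκε : κ ≤ ε / 8 := min_le_left _ _
  have hκb : 4 * κ * ‖c.b‖ ≤ ε := by
    have h1 : κ ≤ ε / (4 * (1 + ‖c.b‖)) := min_le_right _ _
    rw [le_div_iff₀ (by positivity)] at h1
    nlinarith [norm_nonneg c.b]
  obtain ⟨r₁, hr₁, hmem, haff, hcmp⟩ := c.exists_radius hΩ hx₀ hκ0 (by linarith)
  set r := min r₁ δε with hr
  have hr0 : 0 < r := lt_min hr₁ hδε
  have hrr : Metric.ball x₀ r ⊆ Metric.ball x₀ r₁ := Metric.ball_subset_ball (min_le_left _ _)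
  have hdx₀ : ∀ y, bdist Ω y ≤ dist y x₀ := fun y => Metric.infDist_le_dist_of_mem hx₀
  have hupD : ∀ y ∈ Metric.ball x₀ r, y ∈ Ω → 0 < c.D y ∧
      u y ≤ (t + ε) * (1 + ε) * c.D y ^ τ := fun y hy hyΩ => by
    have hD := (hmem y (hrr hy)).1 hyΩ
    refine ⟨hD, (hup y hyΩ ((hdx₀ y).trans_lt
      (lt_of_lt_of_le (Metric.mem_ball.1 hy) (min_le_right _ _)))).trans ?_⟩
    have h1 := (hcmp y (hrr hy) hyΩ).2
    have h2 : bdist Ω y ^ τ ≤ (1 + ε) * c.D y ^ τ := by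
      refine rpow_le_mul_rpow hτ (by linarith) hD (h1.trans ?_)
      have := bdist_nonneg (Ω := Ω) y
      gcongr
      linarith
    rw [mul_assoc]
    gcongr
  obtain ⟨M, hM0, hM⟩ := exists_tail_bound hα.1 (sol_inWeightedL1 hsol) (half_pos hr0) R
  refine ⟨M, fun δ hδ => ?_⟩
  obtain ⟨x, hxΩ, hxd, hux⟩ := hfr (min (r / 8) (δ / 4)) (lt_min (by linarith) (by linarith))
  have hxr : dist x x₀ < r / 8 := hxd.trans_le (min_le_left _ _)
  have hxδ : dist x x₀ < δ / 4 := hxd.trans_le (min_le_right _ _)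
  have hxb : x ∈ Metric.ball x₀ r₁ := hrr (Metric.mem_ball.2 (by linarith))
  set l := c.D x with hl
  have hl0 : 0 < l := (hmem x hxb).1 hxΩ
  have hl2 : l ≤ 2 * dist x x₀ := by
    have h1 := (hcmp x hxb hxΩ).2
    have h2 := hdx₀ x
    have h3 := bdist_nonneg (Ω := Ω) x
    nlinarith
  have hCB : ∀ y ∈ Metric.closedBall x (l / 2), y ∈ Metric.ball x₀ r ∧ y ∈ Ω ∧
      0 < l + inner ℝ c.n (y - x) ∧ |c.D y - (l + inner ℝ c.n (y - x))| ≤ κ * dist y x ∧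
      u y ≤ (t + ε) * (1 + ε) ^ 2 * (l + inner ℝ c.n (y - x)) ^ τ := fun y hy => by
    have hyx : dist y x ≤ l / 2 := hy
    have hyr : y ∈ Metric.ball x₀ r := by
      rw [Metric.mem_ball]
      linarith [dist_triangle y x x₀]
    have h1 := haff y (hrr hyr) x hxb
    rw [← dist_eq_norm, sub_sub] at h1
    have h2 := (affine_bounds (l := l) hn hyx).1
    have h3 := (abs_le.1 h1).1
    have h4 : κ * dist y x ≤ κ * (l + inner ℝ c.n (y - x)) := by gcongr; linarith
    have h5 : 0 < l + inner ℝ c.n (y - x) := by linarith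
    have h6 : (1 - κ) * (l + inner ℝ c.n (y - x)) ≤ c.D y := by linarith
    have h7 : 0 < c.D y := lt_of_lt_of_le (mul_pos (by linarith) h5) h6
    have hyΩ := (hmem y (hrr hyr)).2 h7
    refine ⟨hyr, hyΩ, h5, h1, (hupD y hyr hyΩ).2.trans ?_⟩
    have h8 : c.D y ^ τ ≤ (1 + ε) * (l + inner ℝ c.n (y - x)) ^ τ := by
      refine rpow_le_mul_rpow hτ (by linarith) h5 ?_
      have h9 : 1 ≤ (1 + ε) * (1 - κ) := by nlinarith
      calc l + inner ℝ c.n (y - x) ≤ ((1 + ε) * (1 - κ)) * (l + inner ℝ c.n (y - x)) :=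
            le_mul_of_one_le_left h5.le h9
        _ ≤ (1 + ε) * c.D y := by rw [mul_assoc]; gcongr
    calc (t + ε) * (1 + ε) * c.D y ^ τ
        ≤ (t + ε) * (1 + ε) * ((1 + ε) * (l + inner ℝ c.n (y - x)) ^ τ) := by gcongr
      _ = _ := by ring
  have hSx : (t - ε) * (1 - ε) * l ^ τ ≤ u x := by
    refine le_trans ?_ hux
    have h1 : l ^ τ ≤ (1 - ε)⁻¹ * bdist Ω x ^ τ := by
      refine rpow_le_mul_rpow hτ ((one_le_inv₀ (by linarith)).2 (by linarith))
        (bdist_pos hΩ hne hxΩ) ?_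
      rw [← div_eq_inv_mul, le_div_iff₀ (by linarith), mul_comm]
      refine le_trans ?_ (hcmp x hxb hxΩ).1
      have := bdist_nonneg (Ω := Ω) x
      gcongr
      linarith
    rw [← div_eq_inv_mul, le_div_iff₀ (by linarith)] at h1
    rw [mul_assoc, mul_comm (1 - ε)]
    have : 0 ≤ t - ε := by linarith
    gcongr
  -- `T` carries two factors `1 + ε`, for passing from the distance to `D` and from `D` to the
  -- affine function. `S` carries only one `1 - ε`, since the affine function equals `D` at `x`.
  set S := (t - ε) * (1 - ε) with hS
  set T := (t + ε) * (1 + ε) ^ 2 with hT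
  have hSt : 0 ≤ t - S := by rw [hS]; nlinarith
  have htT : t ≤ T := by rw [hT]; nlinarith [sq_nonneg ε]
  set K := 16 * (2 * (T - t) + (t - S)) + ε with hK
  have hK0 : 0 ≤ K := by rw [hK]; linarith
  obtain ⟨z, hzx, hzmax, hzu⟩ := exists_touching_point hτ hn hl0 htT hK0
    (show 16 * (2 * (T - t) + (t - S)) < K by rw [hK]; linarith)
    ((sol_continuousOn hsol).mono fun y hy => (hCB y hy).2.1) (fun y hy => (hCB y hy).2.2.2.2) hSx
  obtain ⟨hzr, hzΩ, -, hzD, -⟩ := hCB z (Metric.mem_closedBall.2 (by linarith))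
  set μ := l + inner ℝ c.n (z - x) with hμ
  obtain ⟨hμ1, hμ2⟩ := affine_bounds (l := l) hn hzx.le
  rw [← hμ] at hμ1 hμ2
  have hμ0 : 0 < μ := by linarith
  have hzx₀ : dist z x₀ < r / 2 := by linarith [dist_triangle z x x₀]
  have hsub : Metric.closedBall z (μ / 8) ⊆ Metric.closedBall x (l / 2) :=
    Metric.closedBall_subset_closedBall' (by linarith)
  set k := K * l ^ (τ - 2) with hk
  set a := u z - affTest τ t k l c.n x z with ha
  have hza : u z = affTest τ t k l c.n x z + a := by rw [ha]; ring
  obtain ⟨hint, hval⟩ := fracLap_glue_affTest hN hα hτ hn (sol_inWeightedL1 hsol) hμ0 hμ.symm hza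
  have htest := fracLap_glue_le hsol (show 0 < μ / 8 by positivity)
    (fun y hy => (hCB y (hsub hy)).2.1)
    ((contDiffOn_affTest fun y hy => (hCB y (hsub hy)).2.2.1).add contDiffOn_const) hza
    (fun y hy => hzmax y (hsub (Metric.ball_subset_closedBall hy))) hint
  have hDz : |c.D z - μ| ≤ κ * (l / 4) := hzD.trans (by gcongr)
  have huz : (t - 2 * (t - S)) * μ ^ τ ≤ u z := by
    have h1 := rpow_le_of_div_two_le hτ hμ0 (show μ / 2 ≤ l by linarith)
    have h2 : (t - S) * l ^ τ ≤ (t - S) * (2 * μ ^ τ) := by gcongr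
    linarith
  have hDz1 := (abs_le.1 hDz).1
  have hDz2 := (abs_le.1 hDz).2
  have hκl : κ * (l / 4) ≤ μ / 32 :=
    calc κ * (l / 4) ≤ 1 / 32 * (l / 4) := by gcongr; linarith
      _ ≤ μ / 32 := by linarith
  have hcz := hcmp z (hrr hzr) hzΩ
  have hbz := bdist_nonneg (Ω := Ω) z
  have hcz1 : 31 / 32 * bdist Ω z ≤ (1 - κ) * bdist Ω z := by gcongr; linarith
  have hcz2 : (1 + κ) * bdist Ω z ≤ 33 / 32 * bdist Ω z := by gcongr; linarith
  refine ⟨z, hzΩ, μ, hμ0, by linarith, by linarith, by linarith, huz, le_trans ?_ htest⟩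
  have houter := c.setIntegral_outer_le hN hα hτ hΩ hC2 hsol hε0 hε1 ht hκ0.le hκb
    (fun y hy => haff y (hrr hy)) hxb hupD (l := l) rfl hzx hzx₀ hμ hμ0 (by linarith) (hM z (hR z hzΩ)).1
    (hM z (hR z hzΩ)).2
  rw [hval, aboveConst]
  refine test_above_algebra (by positivity) (integral_nonneg fun y => by positivity)
    measureReal_nonneg ?_ ?_ ?_ huz houter
  · rw [← Real.rpow_add hμ0]; simp
  · rw [← Real.rpow_add hμ0]; congr 1; ring
  · rw [hk, mul_assoc]
    exact mul_le_mul_of_nonneg_left (four_fifths_rpow_le hτ hμ0 (by linarith)) hK0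

end TestAbove

lemma exists_rpow_mul_lt {a b c : ℝ} (X Y : ℝ) (ha : 0 < a) (hb : 0 < b) (hc : 0 < c) :
    ∃ δ > 0, ∀ μ, 0 < μ → μ < δ → X * μ ^ a + Y * μ ^ b < c := by
  have h : ContinuousAt (fun μ : ℝ => X * μ ^ a + Y * μ ^ b) 0 :=
    (continuousAt_const.mul (Real.continuousAt_rpow_const 0 a (Or.inr ha.le))).add
      (continuousAt_const.mul (Real.continuousAt_rpow_const 0 b (Or.inr hb.le)))
  have h2 := h.tendsto.eventually_lt_const (u := c)
    (by simpa [Real.zero_rpow ha.ne', Real.zero_rpow hb.ne'] using hc)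
  obtain ⟨δ, hδ, h3⟩ := Metric.eventually_nhds_iff.1 h2
  refine ⟨δ, hδ, fun μ h0 h1 => h3 ?_⟩
  rwa [Real.dist_eq, sub_zero, abs_of_pos h0]

/-! ### The limsup of `u d^(-τ)` and a boundary point where it is approached. -/

section LimSup

variable {Ω : Set (E N)} {u : E N → ℝ} {τ : ℝ}

/-- `t` is the infimum of the constants that bound `u d^(-τ)` near the boundary; it is positive
because of the lower rate. -/
lemma exists_limsup_constant (hΩ : IsOpen Ω) (hne : (frontier Ω).Nonempty) {c C δ : ℝ}
    (hc : 0 < c) (hδ : 0 < δ)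
    (hu : ∀ x ∈ Ω, bdist Ω x < δ → c * bdist Ω x ^ τ ≤ u x ∧ u x ≤ C * bdist Ω x ^ τ) :
    ∃ t, 0 < t ∧ (∀ ε > 0, ∃ δ > 0, ∀ x ∈ Ω, bdist Ω x < δ → u x ≤ (t + ε) * bdist Ω x ^ τ) ∧
      ∀ ε > 0, ∀ δ > 0, ∃ x ∈ Ω, bdist Ω x < δ ∧ (t - ε) * bdist Ω x ^ τ ≤ u x := by
  set S : Set ℝ := {s | ∃ δ > 0, ∀ x ∈ Ω, bdist Ω x < δ → u x ≤ s * bdist Ω x ^ τ} with hS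
  have hCS : C ∈ S := ⟨δ, hδ, fun x hx hd => (hu x hx hd).2⟩
  have hlow : ∀ s ∈ S, c ≤ s := by
    rintro s ⟨δ', hδ', h⟩
    obtain ⟨x, hx, hd⟩ := exists_bdist_lt hne (lt_min hδ hδ')
    have h1 := (hu x hx (hd.trans_le (min_le_left _ _))).1
    have h2 := h x hx (hd.trans_le (min_le_right _ _))
    exact le_of_mul_le_mul_right (h1.trans h2) (Real.rpow_pos_of_pos (bdist_pos hΩ hne hx) τ)
  refine ⟨sInf S, hc.trans_le (le_csInf ⟨C, hCS⟩ hlow), fun ε hε => ?_, fun ε hε δ' hδ' => ?_⟩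
  · obtain ⟨s, ⟨δ', hδ', h⟩, hs⟩ := exists_lt_of_csInf_lt ⟨C, hCS⟩ (lt_add_of_pos_right (sInf S) hε)
    refine ⟨δ', hδ', fun x hx hd => (h x hx hd).trans ?_⟩
    have := Real.rpow_nonneg (bdist_nonneg (Ω := Ω) x) τ
    gcongr
  · by_contra! hcon
    have : sInf S - ε ∈ S := ⟨δ', hδ', fun x hx hd => (hcon x hx hd).le⟩
    linarith [csInf_le ⟨c, hlow⟩ this]

/-- Compactness of the closure of `Ω`: almost maximal points with distance tending to `0` accumulate
at a boundary point, where one chart serves every `ε`. -/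
lemma exists_concentration_point (hb : Bornology.IsBounded Ω) (hne : (frontier Ω).Nonempty) {t : ℝ}
    (h : ∀ ε > 0, ∀ δ > 0, ∃ x ∈ Ω, bdist Ω x < δ ∧ (t - ε) * bdist Ω x ^ τ ≤ u x) :
    ∃ x₀ ∈ frontier Ω, ∀ ε > 0, ∀ ρ > 0, ∃ x ∈ Ω, dist x x₀ < ρ ∧
      (t - ε) * bdist Ω x ^ τ ≤ u x := by
  have hk : ∀ k : ℕ, (0 : ℝ) < 1 / (k + 1) := fun k => by positivity
  choose x hxΩ hxd hxu using fun k : ℕ => h _ (hk k) _ (hk k)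
  obtain ⟨x₀, -, φ, hφ, hlim⟩ := hb.isCompact_closure.tendsto_subseq
    (fun k => subset_closure (hxΩ k))
  have h0 : Tendsto (fun k : ℕ => (1 : ℝ) / (k + 1)) atTop (𝓝 0) :=
    tendsto_one_div_add_atTop_nhds_zero_nat
  have h1 : Tendsto (fun k => bdist Ω (x (φ k))) atTop (𝓝 (bdist Ω x₀)) :=
    ((Metric.continuous_infDist_pt _).tendsto x₀).comp hlim
  have h2 : bdist Ω x₀ = 0 := by
    refine tendsto_nhds_unique h1 (squeeze_zero (fun _ => bdist_nonneg _)
      (fun k => (hxd (φ k)).le) (h0.comp hφ.tendsto_atTop))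
  refine ⟨x₀, (isClosed_frontier.mem_iff_infDist_zero hne).2 h2, fun ε hε ρ hρ => ?_⟩
  have e1 := Metric.tendsto_nhds.1 hlim ρ hρ
  have e2 := (h0.comp hφ.tendsto_atTop).eventually_lt_const hε
  obtain ⟨k, hk1, hk2⟩ := (e1.and e2).exists
  refine ⟨x (φ k), hxΩ _, hk1, le_trans ?_ (hxu (φ k))⟩
  have := Real.rpow_nonneg (bdist_nonneg (Ω := Ω) (x (φ k))) τ
  gcongr
  exact le_of_lt hk2

end LimSup

/-- Testing from above with the half-space profile, at points close to the boundary where `u d^(-τ)`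
is almost maximal. -/
lemma exists_test_above {α τ : ℝ} (hN : 1 ≤ N) (hα : α ∈ Set.Ioo (0 : ℝ) 1)
    (hτ : τ ∈ Set.Ioo (-1 : ℝ) 0) {Ω : Set (E N)} (hΩ : IsOpen Ω) (hb : Bornology.IsBounded Ω)
    (hC2 : IsC2Domain Ω) (hne : (frontier Ω).Nonempty) {h : E N → ℝ → ℝ} {u : E N → ℝ}
    (hsol : IsViscositySol α Ω h (fun _ => 0) u ∨ IsClassicalSol α Ω h (fun _ => 0) u)
    {c C δ : ℝ} (hc : 0 < c) (hδ : 0 < δ)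
    (hu : ∀ x ∈ Ω, bdist Ω x < δ → c * bdist Ω x ^ τ ≤ u x ∧ u x ≤ C * bdist Ω x ^ τ) :
    ∃ t A : ℝ, 0 < t ∧ 0 < A ∧ ∀ η > 0, ∀ δ > 0, ∃ z ∈ Ω, ∃ μ, 0 < μ ∧ μ < δ ∧
      μ / 2 ≤ bdist Ω z ∧ bdist Ω z ≤ 2 * μ ∧ t * μ ^ τ ≤ u z ∧
      -(1 / 2) * (A * Cfun α τ + η) * μ ^ (τ - 2 * α) ≤ h z (u z) := by
  obtain ⟨t, ht, hup, hfr⟩ := exists_limsup_constant hΩ hne hc hδ hu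
  obtain ⟨x₀, hx₀, hx₀f⟩ := exists_concentration_point hb hne hfr
  obtain ⟨ch⟩ := exists_chart hC2 hx₀
  set σ := (sliceConst ((ℝ ∙ ch.n)ᗮ : Submodule ℝ (E N)) ((N : ℝ) + 2 * α)).toReal with hσ
  have hσ0 : 0 < σ := ENNReal.toReal_pos (sliceConst_pos _).ne' (sliceConst_kern_lt_top hα.1).ne
  refine ⟨t / 2, t * (2 * σ), by positivity, by positivity, fun η hη δ' hδ' => ?_⟩
  have hlim := tendsto_aboveConst hN hα hτ ch.norm_n t
  rw [integral_posPowDiff_inner hN ch.norm_n, ← hσ] at hlim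
  have e1 := hlim.eventually_lt_const
    (show t * (σ * (2 * Cfun α τ)) < t * (2 * σ) * Cfun α τ + η / 2 by linarith)
  have e2 : ∀ᶠ ε in 𝓝[>] (0 : ℝ), 2 * (t - (t - ε) * (1 - ε)) < t / 2 := by
    have hcont : ContinuousAt (fun ε : ℝ => 2 * (t - (t - ε) * (1 - ε))) 0 := by fun_prop
    exact (hcont.tendsto.mono_left nhdsWithin_le_nhds).eventually_lt_const (by simpa using ht)
  have e3 := Ioo_mem_nhdsGT (show (0 : ℝ) < min (1 / 4) t by positivity)
  obtain ⟨ε, hε1, hε2, hε3⟩ := (e1.and (e2.and e3)).exists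
  obtain ⟨M, hM⟩ := exists_test_above_at hN hα hτ hΩ hb hC2 hsol hx₀ ch hε3.1
    (hε3.2.le.trans (min_le_left _ _)) (hε3.2.le.trans (min_le_right _ _)) (hup ε hε3.1)
    (hx₀f ε hε3.1)
  -- The tail constant `M` depends on `ε`, hence on `η`, but not on `μ`. Since `τ - 2α < 0` it is
  -- absorbed into `η μ^(τ-2α)` once `μ` is small.
  have hexp : 0 < 2 * α - τ := by linarith [hα.1, hτ.2]
  obtain ⟨δ₂, hδ₂, hsmall⟩ := exists_rpow_mul_lt (2 * M) 0 hexp hexp (half_pos hη)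
  obtain ⟨z, hz, μ, hμ0, hμδ, hd1, hd2, huz, hh⟩ := hM (min δ' δ₂) (lt_min hδ' hδ₂)
  refine ⟨z, hz, μ, hμ0, hμδ.trans_le (min_le_left _ _), hd1, hd2, le_trans ?_ huz,
    le_trans ?_ hh⟩
  · gcongr
    linarith
  · have h1 := hsmall μ hμ0 (hμδ.trans_le (min_le_right _ _))
    have hm : 0 < μ ^ (τ - 2 * α) := by positivity
    have h2 : μ ^ (2 * α - τ) * μ ^ (τ - 2 * α) = 1 := by
      rw [← Real.rpow_add hμ0]; simp
    have h3 : 2 * M ≤ η / 2 * μ ^ (τ - 2 * α) := by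
      calc 2 * M = (2 * M * μ ^ (2 * α - τ) + 0 * μ ^ (2 * α - τ)) * μ ^ (τ - 2 * α) := by
            rw [zero_mul, add_zero, mul_assoc, h2, mul_one]
        _ ≤ η / 2 * μ ^ (τ - 2 * α) := by gcongr
    have h4 : μ ^ (τ - 2 * α) * aboveConst α τ ch.n t ε
        ≤ μ ^ (τ - 2 * α) * (t * (2 * σ) * Cfun α τ + η / 2) := by gcongr
    linarith

/-! ### The three competing powers. -/

section Equation

variable {α p γ τ : ℝ} {Ω : Set (E N)} {f u : E N → ℝ}

lemma abs_rpow_mul_self {p s : ℝ} (hs : 0 < s) : |s| ^ (p - 1) * s = s ^ p := by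
  rw [abs_of_pos hs, Real.rpow_sub_one hs.ne']
  field_simp

/-- No solution has the rate `τ` if the source dominates both other terms. -/
lemma false_of_source_dominates (hN : 1 ≤ N) (hα : α ∈ Set.Ioo (0 : ℝ) 1)
    (hτ : τ ∈ Set.Ioo (-1 : ℝ) 0) (hp : 0 < p) (hγ : γ < 0) (hΩ : IsOpen Ω)
    (hb : Bornology.IsBounded Ω) (hC2 : IsC2Domain Ω) (hne : (frontier Ω).Nonempty)
    (hsol : IsViscositySol α Ω (fun x s => f x - |s| ^ (p - 1) * s) (fun _ => 0) u ∨
      IsClassicalSol α Ω (fun x s => f x - |s| ^ (p - 1) * s) (fun _ => 0) u)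
    (hf : HasBoundaryRate Ω f γ) (hu : HasBoundaryRate Ω u τ)
    (h1 : γ < τ * p) (h2 : γ < τ - 2 * α) : False := by
  obtain ⟨cf, Cf, δf, hcf, hCf, hδf, hfb⟩ := hf.exists_bounds hΩ hne
  obtain ⟨c, C, δ, hc, hC, hδ, hub⟩ := hu.exists_bounds hΩ hne
  obtain ⟨K, δ', hδ', htest⟩ := exists_test_below hN hα hτ hΩ hb hC2 hne hsol hc hC hδ hub
  have hc2 : 0 < cf * 2 ^ γ := by positivity
  obtain ⟨δ₂, hδ₂, hsmall⟩ := exists_rpow_mul_lt ((2 * C) ^ p) K (sub_pos.2 h1) (sub_pos.2 h2) hc2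
  obtain ⟨x, hx, hxd⟩ := exists_bdist_lt (Ω := Ω) hne
    (lt_min (lt_min hδ' hδ₂) (lt_min (half_pos hδ) (half_pos hδf)))
  obtain ⟨hxd1, hxd2⟩ := lt_min_iff.1 hxd
  obtain ⟨hx1, hx2⟩ := lt_min_iff.1 hxd1
  obtain ⟨hx3, hx4⟩ := lt_min_iff.1 hxd2
  obtain ⟨z, hz, hz1, hz2, hh⟩ := htest x hx hx1
  set l := bdist Ω x with hl
  have hl0 : 0 < l := bdist_pos hΩ hne hx
  have hdz := bdist_pos hΩ hne hz
  obtain ⟨hu1, hu2⟩ := hub z hz (by linarith)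
  have hf1 := (hfb z hz (by linarith)).1
  have hu0 : 0 < u z := lt_of_lt_of_le (by positivity) hu1
  rw [abs_rpow_mul_self hu0] at hh
  have h3 : u z ^ p ≤ (2 * C) ^ p * l ^ (τ * p) := by
    rw [Real.rpow_mul hl0.le, ← Real.mul_rpow (by positivity) (by positivity)]
    refine Real.rpow_le_rpow hu0.le (hu2.trans ?_) hp.le
    have := rpow_le_of_div_two_le hτ hl0 hz1
    nlinarith
  have h4 : cf * 2 ^ γ * l ^ γ ≤ f z := by
    refine le_trans ?_ hf1
    rw [mul_assoc, ← Real.mul_rpow (by norm_num) hl0.le]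
    exact mul_le_mul_of_nonneg_left (Real.rpow_le_rpow_of_nonpos hdz hz2 hγ.le) hcf.le
  have h5 := hsmall l hl0 hx2
  have h6 : (2 * C) ^ p * l ^ (τ * p) + K * l ^ (τ - 2 * α)
      = ((2 * C) ^ p * l ^ (τ * p - γ) + K * l ^ (τ - 2 * α - γ)) * l ^ γ := by
    rw [add_mul, mul_assoc, mul_assoc, ← Real.rpow_add hl0, ← Real.rpow_add hl0, sub_add_cancel,
      sub_add_cancel]
  have h7 := mul_lt_mul_of_pos_right h5 (Real.rpow_pos_of_pos hl0 γ)
  linarith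

/-- Testing from above, reduced to a scalar inequality in `μ`; the constants do not depend on `η`
and `δ`, so each later case only compares exponents. -/
lemma exists_upper_inequality (hN : 1 ≤ N) (hα : α ∈ Set.Ioo (0 : ℝ) 1)
    (hτ : τ ∈ Set.Ioo (-1 : ℝ) 0) (hp : 0 < p) (hγ : γ < 0) (hΩ : IsOpen Ω)
    (hb : Bornology.IsBounded Ω) (hC2 : IsC2Domain Ω) (hne : (frontier Ω).Nonempty)
    (hsol : IsViscositySol α Ω (fun x s => f x - |s| ^ (p - 1) * s) (fun _ => 0) u ∨
      IsClassicalSol α Ω (fun x s => f x - |s| ^ (p - 1) * s) (fun _ => 0) u)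
    (hf : HasBoundaryRate Ω f γ) (hu : HasBoundaryRate Ω u τ) :
    ∃ A a F : ℝ, 0 < A ∧ 0 < a ∧ ∀ η > 0, ∀ δ > 0, ∃ μ, 0 < μ ∧ μ < δ ∧
      a * μ ^ (τ * p) ≤ F * μ ^ γ + (A * Cfun α τ + η) * μ ^ (τ - 2 * α) := by
  obtain ⟨cf, Cf, δf, hcf, hCf, hδf, hfb⟩ := hf.exists_bounds hΩ hne
  obtain ⟨c, C, δ, hc, hC, hδ, hub⟩ := hu.exists_bounds hΩ hne
  obtain ⟨t, A, ht, hA, htest⟩ := exists_test_above hN hα hτ hΩ hb hC2 hne hsol hc hδ hub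
  -- Halving `A` and testing with `2 * η` accounts for the factor `1/2` in the fractional Laplacian.
  refine ⟨A / 2, t ^ p, Cf * (1 / 2) ^ γ, by positivity, by positivity, fun η hη δ' hδ' => ?_⟩
  obtain ⟨z, hz, μ, hμ0, hμδ, hd1, hd2, huz, hh⟩ := htest (2 * η) (by positivity) (min δ' (δf / 2))
    (lt_min hδ' (half_pos hδf))
  refine ⟨μ, hμ0, hμδ.trans_le (min_le_left _ _), ?_⟩
  have hμf : μ < δf / 2 := hμδ.trans_le (min_le_right _ _)
  have hf2 := (hfb z hz (by linarith)).2
  have htμ : 0 < t * μ ^ τ := by positivity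
  rw [abs_rpow_mul_self (htμ.trans_le huz)] at hh
  have h1 : t ^ p * μ ^ (τ * p) ≤ u z ^ p := by
    rw [Real.rpow_mul hμ0.le, ← Real.mul_rpow ht.le (by positivity)]
    exact Real.rpow_le_rpow htμ.le huz hp.le
  have h2 : f z ≤ Cf * (1 / 2) ^ γ * μ ^ γ := by
    refine hf2.trans ?_
    rw [mul_assoc, ← Real.mul_rpow (by norm_num) hμ0.le]
    exact mul_le_mul_of_nonneg_left
      (Real.rpow_le_rpow_of_nonpos (by positivity) (by linarith) hγ.le) hCf.le
  linarith

/-- No solution has the rate `τ` if the absorption dominates both other terms. -/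
lemma false_of_absorption_dominates {A a F : ℝ} (ha : 0 < a)
    (h : ∀ η > 0, ∀ δ > 0, ∃ μ : ℝ, 0 < μ ∧ μ < δ ∧
      a * μ ^ (τ * p) ≤ F * μ ^ γ + (A * Cfun α τ + η) * μ ^ (τ - 2 * α))
    (h1 : τ * p < γ) (h2 : τ * p < τ - 2 * α) : False := by
  obtain ⟨δ, hδ, hsmall⟩ := exists_rpow_mul_lt F (A * Cfun α τ + 1) (sub_pos.2 h1) (sub_pos.2 h2) ha
  obtain ⟨μ, hμ0, hμδ, hμ⟩ := h 1 one_pos δ hδ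
  have h3 := mul_lt_mul_of_pos_right (hsmall μ hμ0 hμδ) (Real.rpow_pos_of_pos hμ0 (τ * p))
  rw [add_mul, mul_assoc, mul_assoc, ← Real.rpow_add hμ0, ← Real.rpow_add hμ0, sub_add_cancel,
    sub_add_cancel] at h3
  linarith

/-- With equal exponents the diffusion could balance the absorption only through a positive `C(τ)`;
here its coefficient is at most `η`, chosen as `a/2`, and the source takes less than the other half.
-/
lemma false_of_balance {A a F : ℝ} (hA : 0 < A) (ha : 0 < a)
    (h : ∀ η > 0, ∀ δ > 0, ∃ μ : ℝ, 0 < μ ∧ μ < δ ∧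
      a * μ ^ (τ * p) ≤ F * μ ^ γ + (A * Cfun α τ + η) * μ ^ (τ - 2 * α))
    (h1 : τ - 2 * α < γ) (h2 : τ * p = τ - 2 * α) (hC : Cfun α τ ≤ 0) : False := by
  obtain ⟨δ, hδ, hsmall⟩ := exists_rpow_mul_lt F 0 (sub_pos.2 h1) (sub_pos.2 h1) (half_pos ha)
  obtain ⟨μ, hμ0, hμδ, hμ⟩ := h (a / 2) (half_pos ha) δ hδ
  have hpos := Real.rpow_pos_of_pos hμ0 (τ - 2 * α)
  have h3 := mul_lt_mul_of_pos_right (hsmall μ hμ0 hμδ) hpos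
  rw [zero_mul, add_zero, mul_assoc, ← Real.rpow_add hμ0, sub_add_cancel] at h3
  rw [h2] at hμ
  have h4 : A * Cfun α τ * μ ^ (τ - 2 * α) ≤ 0 :=
    mul_nonpos_of_nonpos_of_nonneg (mul_nonpos_of_nonneg_of_nonpos hA.le hC) hpos.le
  linarith

/-- If `C(τ) < 0` the diffusion has the same sign as the absorption, and the weaker source cannot
compensate them, whatever the exponent of the absorption. -/
lemma false_of_diffusion_dominates {A a F : ℝ} (hA : 0 < A) (ha : 0 < a)
    (h : ∀ η > 0, ∀ δ > 0, ∃ μ : ℝ, 0 < μ ∧ μ < δ ∧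
      a * μ ^ (τ * p) ≤ F * μ ^ γ + (A * Cfun α τ + η) * μ ^ (τ - 2 * α))
    (h1 : τ - 2 * α < γ) (hC : Cfun α τ < 0) : False := by
  have hAC : 0 < -(A * Cfun α τ) := neg_pos.2 (mul_neg_of_pos_of_neg hA hC)
  obtain ⟨δ, hδ, hsmall⟩ := exists_rpow_mul_lt F 0 (sub_pos.2 h1) (sub_pos.2 h1) (half_pos hAC)
  obtain ⟨μ, hμ0, hμδ, hμ⟩ := h _ (half_pos hAC) δ hδ
  have hpos := Real.rpow_pos_of_pos hμ0 (τ - 2 * α)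
  have h3 := mul_lt_mul_of_pos_right (hsmall μ hμ0 hμδ) hpos
  rw [zero_mul, add_zero, mul_assoc, ← Real.rpow_add hμ0, sub_add_cancel] at h3
  have h4 : 0 < a * μ ^ (τ * p) := by positivity
  linarith

end Equation

end LargeSol

end

/-! ### Comparison of the exponents in the two regimes. -/

theorem theorem1p4 (N : ℕ) (hN : 2 ≤ N) (Ω : Set (LargeSol.E N))
    (hΩ_open : IsOpen Ω) (hΩ_bdd : Bornology.IsBounded Ω) (hΩ_conn : IsConnected Ω)
    (hΩ_C2 : LargeSol.IsC2Domain Ω)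
    (α : ℝ) (hα : α ∈ Set.Ioo (0 : ℝ) 1) (p : ℝ) (hp : 1 < p)
    (f : LargeSol.E N → ℝ) (hf_holder : LargeSol.IsLocallyHolder Ω f)
    (hf_nonneg : ∀ x ∈ Ω, 0 ≤ f x)
    (γ : ℝ) (hγ : γ ∈ Set.Ioo (-1 - 2 * α) 0) (hf_rate : LargeSol.HasBoundaryRate Ω f γ) :
    (1 - 2 * α / LargeSol.tau0 α ≤ p →
      -2 * α - 2 * α / (p - 1) ≤ γ → γ < -2 * α →
      ∀ τ ∈ Set.Ioo (-1 : ℝ) 0, τ ≠ γ + 2 * α →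
        ¬ ∃ u : LargeSol.E N → ℝ,
          LargeSol.IsLargeSolution α p Ω f u ∧ LargeSol.HasBoundaryRate Ω u τ) ∧
    (1 + 2 * α < p →
      γ < -2 * α - 2 * α / (p - 1) →
      ∀ τ ∈ Set.Ioo (-1 : ℝ) 0, τ ≠ γ / p →
        ¬ ∃ u : LargeSol.E N → ℝ,
          LargeSol.IsLargeSolution α p Ω f u ∧ LargeSol.HasBoundaryRate Ω u τ) := by
  have hN1 : 1 ≤ N := by omega
  have : Nonempty (Fin N) := ⟨⟨0, by omega⟩⟩
  have hne := LargeSol.frontier_nonempty hΩ_bdd hΩ_conn.nonempty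
  have hp0 : 0 < p := by linarith
  have hp1 : 0 < p - 1 := by linarith
  constructor
  · rintro hpτ hγ1 - τ hτ hτγ ⟨u, ⟨hsol, -⟩, hu⟩
    have hγ2 : -(2 * α) ≤ (γ + 2 * α) * (p - 1) := by
      have : -(2 * α) / (p - 1) ≤ γ + 2 * α := by rw [neg_div]; linarith
      rwa [div_le_iff₀ hp1] at this
    rcases lt_or_gt_of_ne hτγ with h | h
    · obtain ⟨A, a, F, hA, ha, hineq⟩ := LargeSol.exists_upper_inequality hN1 hα hτ hp0 hγ.2
        hΩ_open hΩ_bdd hΩ_C2 hne hsol hf_rate hu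
      obtain ⟨⟨-, hτ0⟩, hC0, hCneg⟩ := LargeSol.tau0_spec hα
      -- The lower bound on `p`, multiplied by the negative number `τ₀`.
      have hcrit : LargeSol.tau0 α * (p - 1) ≤ -(2 * α) := by
        have h1 : -(2 * α / LargeSol.tau0 α) ≤ p - 1 := by linarith
        have h2 := mul_le_mul_of_nonpos_left h1 hτ0.le
        have h3 : LargeSol.tau0 α * -(2 * α / LargeSol.tau0 α) = -(2 * α) := by
          have := hτ0.ne
          field_simp
        linarith
      -- The source is weaker than the diffusion here; the sign of `τ (p-1) + 2α` decides whether
      -- absorption or diffusion is the more singular.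
      rcases lt_trichotomy (τ * (p - 1)) (-(2 * α)) with h1 | h1 | h1
      · exact LargeSol.false_of_absorption_dominates ha hineq (by linarith) (by linarith)
      · refine LargeSol.false_of_balance hA ha hineq (by linarith) (by linarith) ?_
        have h2 : LargeSol.tau0 α ≤ τ := le_of_mul_le_mul_right (hcrit.trans h1.ge) hp1
        rcases h2.eq_or_lt with h3 | h3
        · rw [← h3, hC0]
        · exact (hCneg τ h3 hτ.2).le
      · exact LargeSol.false_of_diffusion_dominates hA ha hineq (by linarith)
          (hCneg τ (lt_of_mul_lt_mul_right (hcrit.trans_lt h1) hp1.le) hτ.2)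
    · refine LargeSol.false_of_source_dominates hN1 hα hτ hp0 hγ.2 hΩ_open hΩ_bdd hΩ_C2 hne hsol
        hf_rate hu ?_ (by linarith)
      -- The lower bound on `γ` reads `γ ≤ (γ + 2α) p`, and `(γ + 2α) p < τ p`.
      have := mul_lt_mul_of_pos_right h hp0
      linarith
  · rintro - hγ1 τ hτ hτγ ⟨u, ⟨hsol, -⟩, hu⟩
    have hγ2 : (γ + 2 * α) * (p - 1) < -(2 * α) := by
      have : γ + 2 * α < -(2 * α) / (p - 1) := by rw [neg_div]; linarith
      rwa [lt_div_iff₀ hp1] at this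
    rcases lt_or_gt_of_ne hτγ with h | h
    · obtain ⟨A, a, F, hA, ha, hineq⟩ := LargeSol.exists_upper_inequality hN1 hα hτ hp0 hγ.2
        hΩ_open hΩ_bdd hΩ_C2 hne hsol hf_rate hu
      rw [lt_div_iff₀ hp0] at h
      refine LargeSol.false_of_absorption_dominates ha hineq h ?_
      -- The strong-source bound is equivalent to `γ (p-1) < -2α p`, and `τ p < γ`.
      have h1 : τ * (p - 1) * p < -(2 * α) * p := by
        have := mul_lt_mul_of_pos_right h hp1
        linarith
      linarith [lt_of_mul_lt_mul_right h1 hp0.le]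
    · rw [div_lt_iff₀ hp0] at h
      refine LargeSol.false_of_source_dominates hN1 hα hτ hp0 hγ.2 hΩ_open hΩ_bdd hΩ_C2 hne hsol
        hf_rate hu h ?_
      have h1 : γ * p < (τ - 2 * α) * p := by linarith
      exact lt_of_mul_lt_mul_right h1 hp0.le
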